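/- Let $k$ be a field and let $G$ be a group with identity $e$. A *tensor category* over $k$ is a $k$-linear abelian monoidal category $(\mathcal C,\otimes,1,\alpha)$ with $\alpha_{X,Y,Z}\colon (X\otimes Y)\otimes Z\to X\otimes(Y\otimes Z)$, whose tensor product is $k$-bilinear on morphisms and exact in each variable, and with $\dim_k\operatorname{End}_{\mathcal C}(1)=1$. A *$G$-grading* of $\mathcal C$ is a decomposition $\mathcal C=\bigoplus_{\sigma\in G}\mathcal C_\sigma$ into a direct sum of full abelian subcategories (closed under isomorphism) with $\mathcal C_\sigma\otimes\mathcal C_\tau\subseteq\mathcal C_{\sigma\tau}$; then $1\in\mathcal C_e$, so $\mathcal C_e$ is a tensor category and the tensor product and associator of $\mathcal C$ make each $\mathcal C_\sigma$ a $\mathcal C_e$-bimodule category. Let $\mathcal C_\sigma\cdot\mathcal C_\tau\subseteq\mathcal C_{\sigma\tau}$ be the full subcategory of the finite direct sums $\bigoplus_i V_i\otimes W_i$ with $V_i\in\mathcal C_\sigma$, $W_i\in\mathcal C_\tau$. The grading is *strong* if the inclusion $\mathcal C_\sigma\cdot\mathcal C_\tau\hookrightarrow\mathcal C_{\sigma\tau}$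 is an equivalence of categories for all $\sigma,\tau\in G$. For a right $\mathcal C_e$-module category $\mathcal M$ and a left $\mathcal C_e$-module category $\mathcal N$, let $\mathcal M\boxtimes_{\mathcal C_e}\mathcal N$ be the $k$-linear category whose objects are the finite direct sums of symbols $[X,Y]$ with $X\in\mathcal M$, $Y\in\mathcal N$, and whose morphisms are generated by morphisms $[f,g]\colon[X,Y]\to[X',Y']$ (for $f\colon X\to X'$, $g\colon Y\to Y'$) and isomorphisms $\alpha_{X,V,Y}\colon[X\otimes V,Y]\to[X,V\otimes Y]$ (for $V\in\mathcal C_e$), subject to the relations: $[f,g]$ is $k$-bilinear in $(f,g)$ and functorial, $\alpha_{X,V,Y}$ is natural in $X$, $V$ and $Y$, and (after identifying $(X\otimes V)\otimes W$ with $X\otimes(V\otimes W)$ and $(V\otimes W)\otimes Y$ with $V\otimes(W\otimes Y)$ by the module associativity constraints) $\alpha_{X,V,W\otimes Y}\circ\alpha_{X\otimes V,W,Y}=\alpha_{X,V\otimes W,Y}$. If $\mathcal M$ and $\mathcal N$ are $\mathcal C_e$-bimodule categories, then $\mathcal C_e$ acts on $\mathcal M\boxtimes_{\mathcal C_e}\mathcal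 N$ on the left by $V\otimes[X,Y]=[V\otimes X,Y]$ and on the right by $[X,Y]\otimes V=[X,Y\otimes V]$, with $(V\otimes[X,Y])\otimes W=V\otimes([X,Y]\otimes W)$; on the morphisms $\alpha_{X,V,Y}$ the actions are defined through the middle associativity constraints of $\mathcal M$ and $\mathcal N$. **Proposition.** Let $\mathcal C=\bigoplus_{\sigma\in G}\mathcal C_\sigma$ be a tensor category with a strong $G$-grading. Then for all $\sigma,\tau\in G$ the canonical $k$-linear functor $$f_{\sigma,\tau}\colon \mathcal C_\sigma\boxtimes_{\mathcal C_e}\mathcal C_\tau\longrightarrow\mathcal C_{\sigma\tau},\qquad [X,Y]\mapsto X\otimes Y,\quad [f,g]\mapsto f\otimes g,$$ which sends the generating isomorphism $\alpha_{X,V,Y}$ of $\mathcal C_\sigma\boxtimes_{\mathcal C_e}\mathcal C_\tau$ to the associator $\alpha_{X,V,Y}$ of $\mathcal C$, is an equivalence of $\mathcal C_e$-bimodule categories. That is: $\mathcal C_\sigma\boxtimes_{\mathcal C_e}\mathcal C_\tau$ and $\mathcal C_{\sigma\tau}$ are abelian, with left and right $\mathcal C_e$-actions which are $k$-bilinear and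 exact in each variable; $f_{\sigma,\tau}$ is an equivalence of categories; and $f_{\sigma,\tau}$ carries the structure of a $k$-linear exact functor of $\mathcal C_e$-bimodule categories (compatible with the left and right actions and with the middle associativity constraints) whose structure isomorphisms on symbols are the associators $f_{\sigma,\tau}(V\otimes[X,Y])=(V\otimes X)\otimes Y\cong V\otimes(X\otimes Y)$ and $f_{\sigma,\tau}([X,Y]\otimes V)=X\otimes(Y\otimes V)\cong(X\otimes Y)\otimes V$. -/

import Mathlib

open CategoryTheory MonoidalCategory Limits
open scoped MonoidalLeftAction MonoidalRightAction

set_option linter.unusedSectionVars false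

noncomputable section

namespace TensorCat

universe w u₁ u₂ u₃ u₄ u₅ v₁ v₂ v₃ v₄ v₅

/-! ### Linear, bimodule and exact structures -/

section Actions

variable (k : Type*) [Field k] (C : Type*) [Category* C] [MonoidalCategory C]
  [Preadditive C] [Linear k C]
  (D : Type*) [Category* D] [MonoidalCategory D] [Preadditive D] [Linear k D]
  (M : Type*) [Category* M] [Preadditive M] [Linear k M]

/-- The left action bifunctor `C × M ⥤ M` is `k`-bilinear on morphisms. -/
class LinearLeftAction [MonoidalLeftAction C M] : Prop where
  add_left {c c' : C} (f g : c ⟶ c') (m : M) : (f + g) ⊵ₗ m = f ⊵ₗ m + g ⊵ₗ m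
  smul_left {c c' : C} (a : k) (f : c ⟶ c') (m : M) : (a • f) ⊵ₗ m = a • (f ⊵ₗ m)
  add_right (c : C) {m m' : M} (f g : m ⟶ m') : c ⊴ₗ (f + g) = c ⊴ₗ f + c ⊴ₗ g
  smul_right (c : C) {m m' : M} (a : k) (f : m ⟶ m') : c ⊴ₗ (a • f) = a • (c ⊴ₗ f)

/-- The right action bifunctor `M × C ⥤ M` is `k`-bilinear on morphisms. -/
class LinearRightAction [MonoidalRightAction C M] : Prop where
  add_left {m m' : M} (f g : m ⟶ m') (c : C) : (f + g) ⊵ᵣ c = f ⊵ᵣ c + g ⊵ᵣ c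
  smul_left {m m' : M} (a : k) (f : m ⟶ m') (c : C) : (a • f) ⊵ᵣ c = a • (f ⊵ᵣ c)
  add_right (m : M) {c c' : C} (f g : c ⟶ c') : m ⊴ᵣ (f + g) = m ⊴ᵣ f + m ⊴ᵣ g
  smul_right (m : M) {c c' : C} (a : k) (f : c ⟶ c') : m ⊴ᵣ (a • f) = a • (m ⊴ᵣ f)

end Actions

/-- The data making a left `C`-module category and right `D`-module category `M` into a
`C`-`D`-bimodule category: coherent natural isomorphisms `(x ⊗ m) ⊗ s ≅ x ⊗ (m ⊗ s)`. -/
class Bimodule (C D M : Type*) [Category* C] [MonoidalCategory C] [Category* D]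
    [MonoidalCategory D] [Category* M] [MonoidalLeftAction C M] [MonoidalRightAction D M] where
  middle (x : C) (m : M) (s : D) : (x ⊙ₗ m) ⊙ᵣ s ≅ x ⊙ₗ (m ⊙ᵣ s)
  naturality_left {x x' : C} (f : x ⟶ x') (m : M) (s : D) :
    (f ⊵ₗ m) ⊵ᵣ s ≫ (middle x' m s).hom = (middle x m s).hom ≫ f ⊵ₗ (m ⊙ᵣ s)
  naturality_mid (x : C) {m m' : M} (g : m ⟶ m') (s : D) :
    (x ⊴ₗ g) ⊵ᵣ s ≫ (middle x m' s).hom = (middle x m s).hom ≫ x ⊴ₗ (g ⊵ᵣ s)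
  naturality_right (x : C) (m : M) {s s' : D} (h : s ⟶ s') :
    (x ⊙ₗ m) ⊴ᵣ h ≫ (middle x m s').hom = (middle x m s).hom ≫ x ⊴ₗ (m ⊴ᵣ h)
  pentagon_left (x y : C) (m : M) (s : D) :
    (αₗ x y m).hom ⊵ᵣ s ≫ (middle x (y ⊙ₗ m) s).hom ≫ x ⊴ₗ (middle y m s).hom =
      (middle (x ⊗ y) m s).hom ≫ (αₗ x y (m ⊙ᵣ s)).hom
  pentagon_right (x : C) (m : M) (s t : D) :
    (αᵣ (x ⊙ₗ m) s t).hom ≫ (middle x m s).hom ⊵ᵣ t ≫ (middle x (m ⊙ᵣ s) t).hom =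
      (middle x m (s ⊗ t)).hom ≫ x ⊴ₗ (αᵣ m s t).hom

/-- A functor is exact if it preserves finite limits and finite colimits. -/
structure IsExact {A B : Type*} [Category* A] [Category* B] (F : A ⥤ B) : Prop where
  left : PreservesFiniteLimits F
  right : PreservesFiniteColimits F

/-- The conditions on a bimodule category over tensor categories: the underlying `k`-linear
category is abelian, and the two action bifunctors are `k`-bilinear and exact in each variable. -/
structure IsAbelianBimodule (k : Type*) [Field k] (C D M : Type*)
    [Category* C] [MonoidalCategory C] [Preadditive C] [Linear k C]
    [Category* D] [MonoidalCategory D] [Preadditive D] [Linear k D]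
    [Category* M] [pM : Preadditive M] [Linear k M]
    [MonoidalLeftAction C M] [MonoidalRightAction D M] : Prop where
  abelian : ∃ A : Abelian M, A.toPreadditive = pM
  linear_left : LinearLeftAction k C M
  linear_right : LinearRightAction k D M
  exact_left (x : C) : IsExact ((MonoidalLeftAction.curriedAction C M).obj x)
  exact_left' (m : M) : IsExact ((MonoidalLeftAction.curriedAction C M).flip.obj m)
  exact_right (s : D) : IsExact ((MonoidalRightAction.curriedAction D M).obj s)
  exact_right' (m : M) : IsExact ((MonoidalRightAction.curriedAction D M).flip.obj m)

/-- A functor between bimodule categories which is left and right linear is a bimodule functor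
if it is `k`-linear and exact, and if the two ways
`F ((x ⊗ m) ⊗ s) ⟶ x ⊗ (F m ⊗ s)` of moving the actions out of `F` agree. -/
structure IsBimoduleFunctor (k : Type*) [Field k] (C D : Type*) {M N : Type*}
    [Category* C] [MonoidalCategory C] [Category* D] [MonoidalCategory D]
    [Category* M] [Preadditive M] [Linear k M] [MonoidalLeftAction C M] [MonoidalRightAction D M]
    [Bimodule C D M]
    [Category* N] [Preadditive N] [Linear k N] [MonoidalLeftAction C N] [MonoidalRightAction D N]
    [Bimodule C D N] (F : M ⥤ N) [F.LeftLinear C] [F.RightLinear D] : Prop where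
  additive : F.Additive
  linear : F.Linear k
  exact : IsExact F
  compat (x : C) (m : M) (s : D) :
    Functor.OplaxRightLinear.δᵣ F (x ⊙ₗ m) s ≫ Functor.OplaxLeftLinear.δₗ F x m ⊵ᵣ s ≫
        (Bimodule.middle x (F.obj m) s).hom =
      F.map (Bimodule.middle x m s).hom ≫ Functor.OplaxLeftLinear.δₗ F x (m ⊙ᵣ s) ≫
        x ⊴ₗ Functor.OplaxRightLinear.δᵣ F m s

/-! ### The relative tensor product, on symbols -/

section Pre

/-- The symbols `[X, Y]` with `X` in the right module category `M` and `Y` in the left module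
category `N`. -/
structure Symb (k : Type w) (C : Type u₁) (M : Type u₂) (N : Type u₃) where
  /-- the entry in `M` -/
  fst : M
  /-- the entry in `N` -/
  snd : N

variable (k : Type w) [Field k] (C : Type u₁) [Category.{v₁} C] [MonoidalCategory C]
  (M : Type u₂) [Category.{v₂} M] [Preadditive M] [Linear k M] [MonoidalRightAction C M]
  (N : Type u₃) [Category.{v₃} N] [Preadditive N] [Linear k N] [MonoidalLeftAction C N]

/-- Formal `k`-linear combinations of composites of the generating morphisms `[f, g]`,
`α_{X,V,Y} : [X ⊗ V, Y] ⟶ [X, V ⊗ Y]` and their formal inverses. -/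
inductive FormalHom : Symb k C M N → Symb k C M N →
    Type (max w u₁ u₂ u₃ v₂ v₃)
  | pair {X X' : M} {Y Y' : N} (f : X ⟶ X') (g : Y ⟶ Y') : FormalHom ⟨X, Y⟩ ⟨X', Y'⟩
  | assoc (X : M) (V : C) (Y : N) : FormalHom ⟨X ⊙ᵣ V, Y⟩ ⟨X, V ⊙ₗ Y⟩
  | assocInv (X : M) (V : C) (Y : N) : FormalHom ⟨X, V ⊙ₗ Y⟩ ⟨X ⊙ᵣ V, Y⟩
  | comp {A B E : Symb k C M N} (s : FormalHom A B) (t : FormalHom B E) : FormalHom A E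
  | zero (A B : Symb k C M N) : FormalHom A B
  | add {A B : Symb k C M N} (s t : FormalHom A B) : FormalHom A B
  | smul {A B : Symb k C M N} (a : k) (s : FormalHom A B) : FormalHom A B

variable {k} {C} {M} {N}

/-- The relations imposed on formal morphisms: the axioms of a `k`-linear category, and
linearity, functoriality, invertibility, naturality and coherence of the generators. -/
inductive FormalRel : {A B : Symb k C M N} → FormalHom k C M N A B → FormalHom k C M N A B → Prop
  -- equivalence relation
  | refl {A B : Symb k C M N} (s : FormalHom k C M N A B) : FormalRel s s
  | symm {A B : Symb k C M N} {s t : FormalHom k C M N A B} : FormalRel s t → FormalRel t s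
  | trans {A B : Symb k C M N} {s t r : FormalHom k C M N A B} : FormalRel s t → FormalRel t r → FormalRel s r
  -- compatibility with the operations
  | comp_congr {A B E : Symb k C M N} {s s' : FormalHom k C M N A B} {t t' : FormalHom k C M N B E} :
      FormalRel s s' → FormalRel t t' → FormalRel (s.comp t) (s'.comp t')
  | add_congr {A B : Symb k C M N} {s s' t t' : FormalHom k C M N A B} :
      FormalRel s s' → FormalRel t t' → FormalRel (s.add t) (s'.add t')
  | smul_congr {A B : Symb k C M N} (a : k) {s s' : FormalHom k C M N A B} :
      FormalRel s s' → FormalRel (s.smul a) (s'.smul a)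
  -- category
  | id_comp {A B : Symb k C M N} (s : FormalHom k C M N A B) :
      FormalRel (FormalHom.comp (.pair (𝟙 A.fst) (𝟙 A.snd)) s) s
  | comp_id {A B : Symb k C M N} (s : FormalHom k C M N A B) :
      FormalRel (FormalHom.comp s (.pair (𝟙 B.fst) (𝟙 B.snd))) s
  | comp_assoc {A B E F : Symb k C M N} (s : FormalHom k C M N A B) (t : FormalHom k C M N B E)
      (r : FormalHom k C M N E F) : FormalRel ((s.comp t).comp r) (s.comp (t.comp r))
  -- `k`-vector spaces
  | add_assoc {A B : Symb k C M N} (s t r : FormalHom k C M N A B) :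
      FormalRel ((s.add t).add r) (s.add (t.add r))
  | add_comm {A B : Symb k C M N} (s t : FormalHom k C M N A B) : FormalRel (s.add t) (t.add s)
  | zero_add {A B : Symb k C M N} (s : FormalHom k C M N A B) : FormalRel ((FormalHom.zero A B).add s) s
  | zero_smul {A B : Symb k C M N} (s : FormalHom k C M N A B) : FormalRel (s.smul 0) (.zero A B)
  | one_smul {A B : Symb k C M N} (s : FormalHom k C M N A B) : FormalRel (s.smul 1) s
  | mul_smul {A B : Symb k C M N} (a b : k) (s : FormalHom k C M N A B) :
      FormalRel (s.smul (a * b)) ((s.smul b).smul a)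
  | add_smul {A B : Symb k C M N} (a b : k) (s : FormalHom k C M N A B) :
      FormalRel (s.smul (a + b)) ((s.smul a).add (s.smul b))
  | smul_add {A B : Symb k C M N} (a : k) (s t : FormalHom k C M N A B) :
      FormalRel ((s.add t).smul a) ((s.smul a).add (t.smul a))
  -- bilinearity of composition
  | add_comp {A B E : Symb k C M N} (s s' : FormalHom k C M N A B) (t : FormalHom k C M N B E) :
      FormalRel ((s.add s').comp t) ((s.comp t).add (s'.comp t))
  | comp_add {A B E : Symb k C M N} (s : FormalHom k C M N A B) (t t' : FormalHom k C M N B E) :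
      FormalRel (s.comp (t.add t')) ((s.comp t).add (s.comp t'))
  | smul_comp {A B E : Symb k C M N} (a : k) (s : FormalHom k C M N A B) (t : FormalHom k C M N B E) :
      FormalRel ((s.smul a).comp t) ((s.comp t).smul a)
  | comp_smul {A B E : Symb k C M N} (a : k) (s : FormalHom k C M N A B) (t : FormalHom k C M N B E) :
      FormalRel (s.comp (t.smul a)) ((s.comp t).smul a)
  -- linearity of the symbols
  | pair_add_left {X X' : M} {Y Y' : N} (f f' : X ⟶ X') (g : Y ⟶ Y') :
      FormalRel (.pair (f + f') g) ((FormalHom.pair f g).add (.pair f' g))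
  | pair_add_right {X X' : M} {Y Y' : N} (f : X ⟶ X') (g g' : Y ⟶ Y') :
      FormalRel (.pair f (g + g')) ((FormalHom.pair f g).add (.pair f g'))
  | pair_smul_left {X X' : M} {Y Y' : N} (a : k) (f : X ⟶ X') (g : Y ⟶ Y') :
      FormalRel (.pair (a • f) g) ((FormalHom.pair f g).smul a)
  | pair_smul_right {X X' : M} {Y Y' : N} (a : k) (f : X ⟶ X') (g : Y ⟶ Y') :
      FormalRel (.pair f (a • g)) ((FormalHom.pair f g).smul a)
  -- functoriality
  | pair_comp {X X' X'' : M} {Y Y' Y'' : N} (f : X ⟶ X') (f' : X' ⟶ X'') (g : Y ⟶ Y')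
      (g' : Y' ⟶ Y'') : FormalRel (.pair (f ≫ f') (g ≫ g')) ((FormalHom.pair f g).comp (.pair f' g'))
  -- invertibility
  | assoc_assocInv (X : M) (V : C) (Y : N) :
      FormalRel ((FormalHom.assoc X V Y).comp (.assocInv X V Y)) (.pair (𝟙 (X ⊙ᵣ V)) (𝟙 Y))
  | assocInv_assoc (X : M) (V : C) (Y : N) :
      FormalRel ((FormalHom.assocInv X V Y).comp (.assoc X V Y)) (.pair (𝟙 X) (𝟙 (V ⊙ₗ Y)))
  -- naturality
  | naturality {X X' : M} {V V' : C} {Y Y' : N} (f : X ⟶ X') (u : V ⟶ V') (g : Y ⟶ Y') :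
      FormalRel ((FormalHom.pair (f ⊙ᵣₘ u) g).comp (.assoc X' V' Y'))
        ((FormalHom.assoc X V Y).comp (.pair f (u ⊙ₗₘ g)))
  -- coherence
  | coherence (X : M) (V W : C) (Y : N) :
      FormalRel ((FormalHom.pair (αᵣ X V W).inv (𝟙 Y)).comp
          ((FormalHom.assoc X (V ⊗ W) Y).comp (.pair (𝟙 X) (αₗ V W Y).hom)))
        ((FormalHom.assoc (X ⊙ᵣ V) W Y).comp (.assoc X V (W ⊙ₗ Y)))

/-- Equality of formal morphisms modulo the relations. -/
def formalSetoid (A B : Symb k C M N) : Setoid (FormalHom k C M N A B) where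
  r := FormalRel
  iseqv := ⟨FormalRel.refl, FormalRel.symm, FormalRel.trans⟩

namespace Symb

/-- Morphisms between symbols. -/
def Hom (A B : Symb k C M N) : Type (max w u₁ u₂ u₃ v₂ v₃) := Quotient (formalSetoid A B)

instance : Category (Symb k C M N) where
  Hom := Hom
  id A := Quotient.mk _ (.pair (𝟙 A.fst) (𝟙 A.snd))
  comp f g := Quotient.map₂ FormalHom.comp (fun _ _ h _ _ h' => FormalRel.comp_congr h h') f g
  id_comp f := by
    induction f using Quotient.inductionOn with | _ s => exact Quotient.sound (FormalRel.id_comp s)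
  comp_id f := by
    induction f using Quotient.inductionOn with | _ s => exact Quotient.sound (FormalRel.comp_id s)
  assoc f g h := by
    induction f using Quotient.inductionOn with | _ s =>
    induction g using Quotient.inductionOn with | _ t =>
    induction h using Quotient.inductionOn with | _ r =>
    exact Quotient.sound (FormalRel.comp_assoc s t r)

/-- The class of a formal morphism. -/
def cls {A B : Symb k C M N} (s : FormalHom k C M N A B) : A ⟶ B := Quotient.mk (formalSetoid A B) s

lemma cls_sound {A B : Symb k C M N} {s t : FormalHom k C M N A B} (h : FormalRel s t) : cls s = cls t :=
  Quotient.sound h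

lemma ind {A B : Symb k C M N} {p : (A ⟶ B) → Prop} (h : ∀ s, p (cls s)) (f : A ⟶ B) : p f :=
  Quotient.ind h f

instance (A B : Symb k C M N) : Zero (A ⟶ B) := ⟨cls (.zero A B)⟩

instance (A B : Symb k C M N) : Add (A ⟶ B) :=
  ⟨fun f g => Quotient.map₂ FormalHom.add (fun _ _ h _ _ h' => FormalRel.add_congr h h') f g⟩

instance (A B : Symb k C M N) : SMul k (A ⟶ B) :=
  ⟨fun a f => Quotient.map (FormalHom.smul a) (fun _ _ h => FormalRel.smul_congr a h) f⟩

instance (A B : Symb k C M N) : Neg (A ⟶ B) := ⟨fun f => (-1 : k) • f⟩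

lemma cls_comp {A B E : Symb k C M N} (s : FormalHom k C M N A B) (t : FormalHom k C M N B E) :
    cls (s.comp t) = cls s ≫ cls t := rfl

lemma cls_add {A B : Symb k C M N} (s t : FormalHom k C M N A B) : cls (s.add t) = cls s + cls t := rfl

lemma cls_smul {A B : Symb k C M N} (a : k) (s : FormalHom k C M N A B) :
    cls (s.smul a) = a • cls s := rfl

lemma cls_zero (A B : Symb k C M N) : cls (FormalHom.zero A B) = 0 := rfl

lemma smul_zero' (A B : Symb k C M N) (a : k) : a • (0 : A ⟶ B) = 0 := by
  have h0 : (0 : A ⟶ B) = (0 : k) • (0 : A ⟶ B) := (cls_sound (FormalRel.zero_smul (.zero A B))).symm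
  have h1 : a • ((0 : k) • (0 : A ⟶ B)) = (a * 0) • (0 : A ⟶ B) :=
    (cls_sound (FormalRel.mul_smul a 0 (.zero A B))).symm
  rw [mul_zero, ← h0] at h1
  exact h1

instance (A B : Symb k C M N) : AddCommGroup (A ⟶ B) where
  add_assoc f g h := by
    induction f using ind with | _ s =>
    induction g using ind with | _ t =>
    induction h using ind with | _ r =>
    exact cls_sound (FormalRel.add_assoc s t r)
  add_comm f g := by
    induction f using ind with | _ s =>
    induction g using ind with | _ t =>
    exact cls_sound (FormalRel.add_comm s t)
  zero_add f := by
    induction f using ind with | _ s =>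
    exact cls_sound (FormalRel.zero_add s)
  add_zero f := by
    induction f using ind with | _ s =>
    exact cls_sound ((FormalRel.add_comm _ _).trans (FormalRel.zero_add s))
  neg_add_cancel f := by
    induction f using ind with | _ s =>
    have h : FormalRel ((s.smul (-1)).add s) (FormalHom.zero A B) :=
      ((FormalRel.add_congr (FormalRel.refl _) (FormalRel.one_smul s).symm).trans
        (FormalRel.add_smul (-1) 1 s).symm).trans
        (by rw [neg_add_cancel]; exact FormalRel.zero_smul s)
    exact cls_sound h
  nsmul := nsmulRec
  zsmul := zsmulRec

instance : Preadditive (Symb k C M N) where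
  add_comp _ _ _ f g h := by
    induction f using ind with | _ s =>
    induction g using ind with | _ t =>
    induction h using ind with | _ r =>
    exact cls_sound (FormalRel.add_comp s t r)
  comp_add _ _ _ f g h := by
    induction f using ind with | _ s =>
    induction g using ind with | _ t =>
    induction h using ind with | _ r =>
    exact cls_sound (FormalRel.comp_add s t r)

instance (A B : Symb k C M N) : Module k (A ⟶ B) where
  one_smul f := by
    induction f using ind with | _ s => exact cls_sound (FormalRel.one_smul s)
  mul_smul a b f := by
    induction f using ind with | _ s => exact cls_sound (FormalRel.mul_smul a b s)
  smul_zero a := smul_zero' A B a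
  smul_add a f g := by
    induction f using ind with | _ s =>
    induction g using ind with | _ t =>
    exact cls_sound (FormalRel.smul_add a s t)
  add_smul a b f := by
    induction f using ind with | _ s => exact cls_sound (FormalRel.add_smul a b s)
  zero_smul f := by
    induction f using ind with | _ s => exact cls_sound (FormalRel.zero_smul s)

instance : Linear k (Symb k C M N) where
  smul_comp _ _ _ a f g := by
    induction f using ind with | _ s =>
    induction g using ind with | _ t =>
    exact cls_sound (FormalRel.smul_comp a s t)
  comp_smul _ _ _ f a g := by
    induction f using ind with | _ s =>
    induction g using ind with | _ t =>
    exact cls_sound (FormalRel.comp_smul a s t)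

/-- The morphism `[f, g] : [X, Y] ⟶ [X', Y']`. -/
def pair {X X' : M} {Y Y' : N} (f : X ⟶ X') (g : Y ⟶ Y') :
    (⟨X, Y⟩ : Symb k C M N) ⟶ ⟨X', Y'⟩ := cls (.pair f g)

lemma pair_id (X : M) (Y : N) : pair (k := k) (C := C) (𝟙 X) (𝟙 Y) = 𝟙 _ := rfl

lemma pair_comp {X X' X'' : M} {Y Y' Y'' : N} (f : X ⟶ X') (f' : X' ⟶ X'') (g : Y ⟶ Y')
    (g' : Y' ⟶ Y'') :
    pair (k := k) (C := C) f g ≫ pair f' g' = pair (f ≫ f') (g ≫ g') :=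
  (cls_sound (FormalRel.pair_comp f f' g g')).symm

/-- The isomorphism `[f, g]` for isomorphisms `f`, `g`. -/
def pairIso {X X' : M} {Y Y' : N} (f : X ≅ X') (g : Y ≅ Y') :
    (⟨X, Y⟩ : Symb k C M N) ≅ ⟨X', Y'⟩ where
  hom := pair f.hom g.hom
  inv := pair f.inv g.inv
  hom_inv_id := by rw [pair_comp, f.hom_inv_id, g.hom_inv_id, pair_id]
  inv_hom_id := by rw [pair_comp, f.inv_hom_id, g.inv_hom_id, pair_id]

/-- The isomorphism `α_{X,V,Y} : [X ⊗ V, Y] ≅ [X, V ⊗ Y]`. -/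
def assocIso (X : M) (V : C) (Y : N) :
    (⟨X ⊙ᵣ V, Y⟩ : Symb k C M N) ≅ ⟨X, V ⊙ₗ Y⟩ where
  hom := cls (.assoc X V Y)
  inv := cls (.assocInv X V Y)
  hom_inv_id := cls_sound (FormalRel.assoc_assocInv X V Y)
  inv_hom_id := cls_sound (FormalRel.assocInv_assoc X V Y)

lemma assoc_naturality {X X' : M} {V V' : C} {Y Y' : N} (f : X ⟶ X') (u : V ⟶ V')
    (g : Y ⟶ Y') :
    pair (k := k) (C := C) (f ⊙ᵣₘ u) g ≫ (assocIso X' V' Y').hom =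
      (assocIso X V Y).hom ≫ pair f (u ⊙ₗₘ g) :=
  cls_sound (FormalRel.naturality f u g)

lemma coherence (X : M) (V W : C) (Y : N) :
    pair (k := k) (C := C) (αᵣ X V W).inv (𝟙 Y) ≫ (assocIso X (V ⊗ W) Y).hom ≫
        pair (𝟙 X) (αₗ V W Y).hom =
      (assocIso (X ⊙ᵣ V) W Y).hom ≫ (assocIso X V (W ⊙ₗ Y)).hom :=
  cls_sound (FormalRel.coherence X V W Y)

lemma pair_add_left {X X' : M} {Y Y' : N} (f f' : X ⟶ X') (g : Y ⟶ Y') :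
    pair (k := k) (C := C) (f + f') g = pair f g + pair f' g :=
  cls_sound (FormalRel.pair_add_left f f' g)

lemma pair_add_right {X X' : M} {Y Y' : N} (f : X ⟶ X') (g g' : Y ⟶ Y') :
    pair (k := k) (C := C) f (g + g') = pair f g + pair f g' :=
  cls_sound (FormalRel.pair_add_right f g g')

lemma pair_smul_left {X X' : M} {Y Y' : N} (a : k) (f : X ⟶ X') (g : Y ⟶ Y') :
    pair (k := k) (C := C) (a • f) g = a • pair f g :=
  cls_sound (FormalRel.pair_smul_left a f g)

lemma pair_smul_right {X X' : M} {Y Y' : N} (a : k) (f : X ⟶ X') (g : Y ⟶ Y') :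
    pair (k := k) (C := C) f (a • g) = a • pair f g :=
  cls_sound (FormalRel.pair_smul_right a f g)

end Symb

/-- A balanced `k`-bilinear functor (a "`C`-bilinear functor") `M × N ⥤ D`. -/
structure BilinearFunctor (k : Type w) [Field k] (C : Type u₁) [Category.{v₁} C]
    [MonoidalCategory C]
    (M : Type u₂) [Category.{v₂} M] [Preadditive M] [Linear k M] [MonoidalRightAction C M]
    (N : Type u₃) [Category.{v₃} N] [Preadditive N] [Linear k N] [MonoidalLeftAction C N]
    (D : Type u₄) [Category.{v₄} D] [Preadditive D] [Linear k D] where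
  obj : M → N → D
  map {X X' : M} {Y Y' : N} (f : X ⟶ X') (g : Y ⟶ Y') : obj X Y ⟶ obj X' Y'
  map_id (X : M) (Y : N) : map (𝟙 X) (𝟙 Y) = 𝟙 (obj X Y)
  map_comp {X X' X'' : M} {Y Y' Y'' : N} (f : X ⟶ X') (f' : X' ⟶ X'') (g : Y ⟶ Y')
    (g' : Y' ⟶ Y'') : map (f ≫ f') (g ≫ g') = map f g ≫ map f' g'
  map_add_left {X X' : M} {Y Y' : N} (f f' : X ⟶ X') (g : Y ⟶ Y') :
    map (f + f') g = map f g + map f' g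
  map_add_right {X X' : M} {Y Y' : N} (f : X ⟶ X') (g g' : Y ⟶ Y') :
    map f (g + g') = map f g + map f g'
  map_smul_left {X X' : M} {Y Y' : N} (a : k) (f : X ⟶ X') (g : Y ⟶ Y') :
    map (a • f) g = a • map f g
  map_smul_right {X X' : M} {Y Y' : N} (a : k) (f : X ⟶ X') (g : Y ⟶ Y') :
    map f (a • g) = a • map f g
  balance (X : M) (V : C) (Y : N) : obj (X ⊙ᵣ V) Y ≅ obj X (V ⊙ₗ Y)
  naturality {X X' : M} {V V' : C} {Y Y' : N} (f : X ⟶ X') (u : V ⟶ V') (g : Y ⟶ Y') :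
    map (f ⊙ᵣₘ u) g ≫ (balance X' V' Y').hom = (balance X V Y).hom ≫ map f (u ⊙ₗₘ g)
  coherence (X : M) (V W : C) (Y : N) :
    map (αᵣ X V W).inv (𝟙 Y) ≫ (balance X (V ⊗ W) Y).hom ≫ map (𝟙 X) (αₗ V W Y).hom =
      (balance (X ⊙ᵣ V) W Y).hom ≫ (balance X V (W ⊙ₗ Y)).hom

namespace BilinearFunctor

variable {D : Type u₄} [Category.{v₄} D] [Preadditive D] [Linear k D]
  (F : BilinearFunctor k C M N D)

/-- The value of a bilinear functor on formal morphisms. -/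
def onFormal : {A B : Symb k C M N} → FormalHom k C M N A B →
    (F.obj A.fst A.snd ⟶ F.obj B.fst B.snd)
  | _, _, .pair f g => F.map f g
  | _, _, .assoc X V Y => (F.balance X V Y).hom
  | _, _, .assocInv X V Y => (F.balance X V Y).inv
  | _, _, .comp s t => onFormal s ≫ onFormal t
  | _, _, .zero _ _ => 0
  | _, _, .add s t => onFormal s + onFormal t
  | _, _, .smul a s => a • onFormal s

lemma onFormal_eq {A B : Symb k C M N} {s t : FormalHom k C M N A B} (h : FormalRel s t) :
    F.onFormal s = F.onFormal t := by
  induction h with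
  | refl => rfl
  | symm _ ih => exact ih.symm
  | trans _ _ ih ih' => exact ih.trans ih'
  | comp_congr _ _ ih ih' => simp only [onFormal, ih, ih']
  | add_congr _ _ ih ih' => simp only [onFormal, ih, ih']
  | smul_congr _ _ ih => simp only [onFormal, ih]
  | id_comp => simp only [onFormal, F.map_id, Category.id_comp]
  | comp_id => simp only [onFormal, F.map_id, Category.comp_id]
  | comp_assoc => simp only [onFormal, Category.assoc]
  | add_assoc => simp only [onFormal, add_assoc]
  | add_comm => simp only [onFormal, add_comm]
  | zero_add => simp only [onFormal, zero_add]
  | zero_smul => simp only [onFormal, zero_smul]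
  | one_smul => simp only [onFormal, one_smul]
  | mul_smul => simp only [onFormal, mul_smul]
  | add_smul => simp only [onFormal, add_smul]
  | smul_add => simp only [onFormal, smul_add]
  | add_comp => simp only [onFormal, Preadditive.add_comp]
  | comp_add => simp only [onFormal, Preadditive.comp_add]
  | smul_comp => simp only [onFormal, Linear.smul_comp]
  | comp_smul => simp only [onFormal, Linear.comp_smul]
  | pair_add_left => simp only [onFormal, F.map_add_left]
  | pair_add_right => simp only [onFormal, F.map_add_right]
  | pair_smul_left => simp only [onFormal, F.map_smul_left]
  | pair_smul_right => simp only [onFormal, F.map_smul_right]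
  | pair_comp => simp only [onFormal, F.map_comp]
  | assoc_assocInv => simp only [onFormal, F.map_id, Iso.hom_inv_id]
  | assocInv_assoc => simp only [onFormal, F.map_id, Iso.inv_hom_id]
  | naturality => simp only [onFormal, F.naturality]
  | coherence => simp only [onFormal, F.coherence]

/-- The `k`-linear functor on symbols induced by a bilinear functor. -/
def lift : Symb k C M N ⥤ D where
  obj A := F.obj A.fst A.snd
  map f := Quotient.lift F.onFormal (fun _ _ h => F.onFormal_eq h) f
  map_id A := F.map_id A.fst A.snd
  map_comp f g := by
    induction f using Symb.ind with | _ s =>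
    induction g using Symb.ind with | _ t => rfl

instance : F.lift.Additive where
  map_add {_ _ f g} := by
    induction f using Symb.ind with | _ s =>
    induction g using Symb.ind with | _ t => rfl

instance : F.lift.Linear k where
  map_smul f a := by
    induction f using Symb.ind with | _ s => rfl

@[simp] lemma lift_obj (X : M) (Y : N) : F.lift.obj ⟨X, Y⟩ = F.obj X Y := rfl

lemma lift_map_pair {X X' : M} {Y Y' : N} (f : X ⟶ X') (g : Y ⟶ Y') :
    F.lift.map (Symb.pair f g) = F.map f g := rfl

lemma lift_map_assoc (X : M) (V : C) (Y : N) :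
    F.lift.map (Symb.assocIso X V Y).hom = (F.balance X V Y).hom := rfl

end BilinearFunctor

/-- Naturality of a family of morphisms between linear functors on symbols can be checked on the
generators. -/
lemma Symb.naturality_of_generators {D : Type u₄} [Category.{v₄} D] [Preadditive D] [Linear k D]
    (F G : Symb k C M N ⥤ D) [F.Additive] [G.Additive] [F.Linear k] [G.Linear k]
    (φ : ∀ A, F.obj A ⟶ G.obj A)
    (hpair : ∀ {X X' : M} {Y Y' : N} (f : X ⟶ X') (g : Y ⟶ Y'),
      F.map (Symb.pair f g) ≫ φ ⟨X', Y'⟩ = φ ⟨X, Y⟩ ≫ G.map (Symb.pair f g))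
    (hassoc : ∀ (X : M) (V : C) (Y : N),
      F.map (Symb.assocIso X V Y).hom ≫ φ ⟨X, V ⊙ₗ Y⟩ =
        φ ⟨X ⊙ᵣ V, Y⟩ ≫ G.map (Symb.assocIso X V Y).hom)
    {A B : Symb k C M N} (f : A ⟶ B) : F.map f ≫ φ B = φ A ≫ G.map f := by
  induction f using Symb.ind with | _ s =>
  induction s with
  | pair f g => exact hpair f g
  | assoc X V Y => exact hassoc X V Y
  | assocInv X V Y =>
    change F.map (Symb.assocIso X V Y).inv ≫ φ _ = φ _ ≫ G.map (Symb.assocIso X V Y).inv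
    rw [← Functor.mapIso_inv, ← Functor.mapIso_inv, Iso.inv_comp_eq, ← Category.assoc,
      Iso.eq_comp_inv]
    exact (hassoc X V Y).symm
  | comp s t hs ht =>
    rw [Symb.cls_comp, F.map_comp, G.map_comp, Category.assoc, ht, ← Category.assoc, hs,
      Category.assoc]
  | zero A B => rw [Symb.cls_zero, F.map_zero, G.map_zero, zero_comp, comp_zero]
  | add s t hs ht =>
    rw [Symb.cls_add, F.map_add, G.map_add, Preadditive.add_comp, Preadditive.comp_add, hs, ht]
  | smul a s hs =>
    rw [Symb.cls_smul, F.map_smul, G.map_smul, Linear.smul_comp, Linear.comp_smul, hs]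

end Pre

/-! ### Coherence in bimodule categories -/

section Coherence

variable {C D M : Type*} [Category* C] [MonoidalCategory C] [Category* D] [MonoidalCategory D]
  [Category* M] [MonoidalLeftAction C M] [MonoidalRightAction D M] [Bimodule C D M]

lemma middle_inv_naturality {x : C} {m m' : M} (f : m ⟶ m') {s s' : D} (u : s ⟶ s') :
    x ⊴ₗ (f ⊙ᵣₘ u) ≫ (Bimodule.middle x m' s').inv =
      (Bimodule.middle x m s).inv ≫ ((x ⊴ₗ f) ⊙ᵣₘ u) := by
  rw [Iso.comp_inv_eq, Category.assoc, Iso.eq_inv_comp, MonoidalRightAction.actionHom_def,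
    MonoidalRightAction.actionHom_def, MonoidalLeftAction.actionHomRight_comp, Category.assoc,
    Bimodule.naturality_right, ← Category.assoc, ← Category.assoc, Bimodule.naturality_mid]

lemma middle_inv_naturality_left {x x' : C} (f : x ⟶ x') (m : M) (s : D) :
    f ⊵ₗ (m ⊙ᵣ s) ≫ (Bimodule.middle x' m s).inv =
      (Bimodule.middle x m s).inv ≫ (f ⊵ₗ m) ⊵ᵣ s := by
  rw [Iso.comp_inv_eq, Category.assoc, Iso.eq_inv_comp, Bimodule.naturality_left]

lemma middle_pentagon_left_inv (x y : C) (m : M) (s : D) :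
    (Bimodule.middle (x ⊗ y) m s).inv ≫ (αₗ x y m).hom ⊵ᵣ s =
      (αₗ x y (m ⊙ᵣ s)).hom ≫ x ⊴ₗ (Bimodule.middle y m s).inv ≫
        (Bimodule.middle x (y ⊙ₗ m) s).inv := by
  rw [Iso.inv_comp_eq, ← Category.assoc, ← Category.assoc, Iso.eq_comp_inv,
    ← Bimodule.pentagon_left, Category.assoc, Category.assoc,
    MonoidalLeftAction.actionHomRight_hom_inv, Category.comp_id]

lemma middle_unit_left (m : M) (s : D) :
    (Bimodule.middle (𝟙_ C) m s).hom ≫ (λₗ[C] (m ⊙ᵣ s)).hom = (λₗ[C] m).hom ⊵ᵣ s := by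
  have faith : ∀ {a b : M} (f g : a ⟶ b), (𝟙_ C) ⊴ₗ f = (𝟙_ C) ⊴ₗ g → f = g := by
    intro a b f g h
    simpa using h
  apply faith
  have h1 := MonoidalLeftAction.rightUnitor_actionHom (𝟙_ C) (m ⊙ᵣ s)
  have h2 := MonoidalLeftAction.rightUnitor_actionHom (𝟙_ C) m
  have h3 := Bimodule.pentagon_left (𝟙_ C) (𝟙_ C) m s
  have h4 := Bimodule.naturality_left (ρ_ (𝟙_ C)).hom m s
  have h5 := Bimodule.naturality_mid (𝟙_ C) (λₗ[C] m).hom s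
  rw [← cancel_epi ((αₗ (𝟙_ C) (𝟙_ C) m).hom ⊵ᵣ s ≫
    (Bimodule.middle (𝟙_ C) ((𝟙_ C) ⊙ₗ m) s).hom)]
  rw [Category.assoc, Category.assoc, ← h5, MonoidalLeftAction.actionHomRight_comp,
    ← Category.assoc (Bimodule.middle (𝟙_ C) ((𝟙_ C) ⊙ₗ m) s).hom, ← Category.assoc, h3,
    Category.assoc, ← h1, ← h4, h2, MonoidalRightAction.comp_actionHomLeft, Category.assoc]

lemma middle_unit_right (x : C) (m : M) :
    (Bimodule.middle x m (𝟙_ D)).hom ≫ x ⊴ₗ (ρᵣ[D] m).hom = (ρᵣ[D] (x ⊙ₗ m)).hom := by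
  have faith : ∀ {a b : M} (f g : a ⟶ b), f ⊵ᵣ (𝟙_ D) = g ⊵ᵣ (𝟙_ D) → f = g := by
    intro a b f g h
    simpa using h
  apply faith
  have h1 := MonoidalRightAction.actionHom_leftUnitor (𝟙_ D) (x ⊙ₗ m)
  have h2 := MonoidalRightAction.actionHom_leftUnitor (𝟙_ D) m
  have h3 := Bimodule.pentagon_right x m (𝟙_ D) (𝟙_ D)
  have h4 := Bimodule.naturality_right x m (λ_ (𝟙_ D)).hom
  have h5 := Bimodule.naturality_mid x (ρᵣ[D] m).hom (𝟙_ D)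
  rw [← cancel_mono (Bimodule.middle x m (𝟙_ D)).hom,
    ← cancel_epi (αᵣ (x ⊙ₗ m) (𝟙_ D) (𝟙_ D)).hom]
  rw [MonoidalRightAction.comp_actionHomLeft, Category.assoc, h5,
    ← Category.assoc _ _ (x ⊴ₗ _), ← Category.assoc _ _ (x ⊴ₗ _), h3,
    Category.assoc, ← MonoidalLeftAction.actionHomRight_comp, ← h2, ← h4, h1, Category.assoc]

end Coherence

section SymbNaturality

variable {k : Type w} [Field k] {C : Type u₁} [Category.{v₁} C] [MonoidalCategory C]
  {M : Type u₂} [Category.{v₂} M] [Preadditive M] [Linear k M] [MonoidalRightAction C M]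
  {N : Type u₃} [Category.{v₃} N] [Preadditive N] [Linear k N] [MonoidalLeftAction C N]

/-- Moving a morphism acting on the first entry past `α_{X,V,Y}`. -/
lemma Symb.assoc_naturality_fst {X X' : M} (V : C) (Y : N) (f : X ⟶ X') :
    Symb.pair (k := k) (C := C) (f ⊵ᵣ V) (𝟙 Y) ≫ (Symb.assocIso X' V Y).hom =
      (Symb.assocIso X V Y).hom ≫ Symb.pair f (𝟙 (V ⊙ₗ Y)) := by
  have h := Symb.assoc_naturality (k := k) f (𝟙 V) (𝟙 Y)
  rwa [MonoidalRightAction.actionHom_id, MonoidalLeftAction.actionHom_id,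
    MonoidalLeftAction.id_actionHomLeft] at h

/-- Moving a morphism acting on the second entry past `α_{X,V,Y}`. -/
lemma Symb.assoc_naturality_snd (X : M) (V : C) {Y Y' : N} (g : Y ⟶ Y') :
    Symb.pair (k := k) (C := C) (𝟙 (X ⊙ᵣ V)) g ≫ (Symb.assocIso X V Y').hom =
      (Symb.assocIso X V Y).hom ≫ Symb.pair (𝟙 X) (V ⊴ₗ g) := by
  have h := Symb.assoc_naturality (k := k) (𝟙 X) (𝟙 V) g
  rwa [MonoidalRightAction.actionHom_id, MonoidalRightAction.id_actionHomLeft,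
    MonoidalLeftAction.id_actionHom] at h

end SymbNaturality

/-! ### Actions on symbols -/

section LeftAct

variable (k : Type w) [Field k] {C₁ : Type u₄} [Category.{v₄} C₁] [MonoidalCategory C₁]
  [Preadditive C₁] [Linear k C₁]
  (C : Type u₁) [Category.{v₁} C] [MonoidalCategory C]
  (M : Type u₂) [Category.{v₂} M] [Preadditive M] [Linear k M] [MonoidalRightAction C M]
  [MonoidalLeftAction C₁ M] [LinearLeftAction k C₁ M] [Bimodule C₁ C M]
  (N : Type u₃) [Category.{v₃} N] [Preadditive N] [Linear k N] [MonoidalLeftAction C N]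

/-- The endofunctor `[X, Y] ↦ [x ⊗ X, Y]`, as a bilinear functor. -/
def leftBilinear (x : C₁) : BilinearFunctor k C M N (Symb k C M N) where
  obj X Y := ⟨x ⊙ₗ X, Y⟩
  map f g := Symb.pair (x ⊴ₗ f) g
  map_id X Y := by rw [MonoidalLeftAction.actionHomRight_id, Symb.pair_id]
  map_comp f f' g g' := by rw [MonoidalLeftAction.actionHomRight_comp, Symb.pair_comp]
  map_add_left f f' g := by rw [LinearLeftAction.add_right k, Symb.pair_add_left]
  map_add_right f g g' := by rw [Symb.pair_add_right]
  map_smul_left a f g := by rw [LinearLeftAction.smul_right, Symb.pair_smul_left]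
  map_smul_right a f g := by rw [Symb.pair_smul_right]
  balance X V Y :=
    Symb.pairIso (Bimodule.middle x X V).symm (Iso.refl Y) ≪≫ Symb.assocIso (x ⊙ₗ X) V Y
  naturality {X X' V V' Y Y'} f u g := by
    simp only [Iso.trans_hom, Symb.pairIso, Iso.symm_hom, Iso.refl_hom, Category.assoc,
      ← Symb.assoc_naturality]
    rw [← Category.assoc, ← Category.assoc, Symb.pair_comp, Symb.pair_comp,
      middle_inv_naturality, Category.comp_id, Category.id_comp]
  coherence X V W Y := by
    have e : x ⊴ₗ (αᵣ X V W).inv ≫ (Bimodule.middle x X (V ⊗ W)).inv =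
        (Bimodule.middle x (X ⊙ᵣ V) W).inv ≫ (Bimodule.middle x X V).inv ⊵ᵣ W ≫
          (αᵣ (x ⊙ₗ X) V W).inv := by
      rw [Iso.comp_inv_eq, Category.assoc, Category.assoc, Iso.eq_inv_comp,
        ← cancel_mono (x ⊴ₗ (αᵣ X V W).hom), Category.assoc, Category.assoc, Category.assoc,
        ← Bimodule.pentagon_right, MonoidalLeftAction.actionHomRight_inv_hom,
        Category.comp_id, Iso.inv_hom_id_assoc, ← Category.assoc,
        ← MonoidalRightAction.comp_actionHomLeft, Iso.inv_hom_id,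
        MonoidalRightAction.id_actionHomLeft, Category.id_comp]
    have n := Symb.assoc_naturality (k := k) (Bimodule.middle x X V).inv (𝟙 W) (𝟙 Y)
    rw [MonoidalRightAction.actionHom_id] at n
    have n' := Symb.assoc_naturality (k := k) (Bimodule.middle x X V).inv (𝟙 V) (𝟙 (W ⊙ₗ Y))
    simp only [Iso.trans_hom, Symb.pairIso, Iso.symm_hom, Iso.refl_hom, Category.assoc,
      MonoidalLeftAction.actionHomRight_id]
    have h1 : Symb.pair (k := k) (C := C) (x ⊴ₗ (αᵣ X V W).inv) (𝟙 Y) ≫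
        Symb.pair (Bimodule.middle x X (V ⊗ W)).inv (𝟙 Y) =
        Symb.pair (Bimodule.middle x (X ⊙ᵣ V) W).inv (𝟙 Y) ≫
        Symb.pair ((Bimodule.middle x X V).inv ⊵ᵣ W) (𝟙 Y) ≫
        Symb.pair (αᵣ (x ⊙ₗ X) V W).inv (𝟙 Y) := by
      simp only [Symb.pair_comp, e, Category.comp_id]
    rw [← Category.assoc (Symb.pair (x ⊴ₗ (αᵣ X V W).inv) (𝟙 Y)), h1]
    simp only [Category.assoc]
    rw [Symb.coherence, ← Category.assoc (Symb.pair ((Bimodule.middle x X V).inv ⊵ᵣ W) (𝟙 Y)), n]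
    simp only [Category.assoc, MonoidalLeftAction.actionHom_id,
      MonoidalLeftAction.id_actionHomLeft]

/-- `[X, Y] ↦ [x ⊗ X, Y]`, acting on the morphisms `α_{X,V,Y}` through the middle associativity
of the bimodule category `M`. -/
abbrev leftFunctor (x : C₁) : Symb k C M N ⥤ Symb k C M N := (leftBilinear k C M N x).lift

/-- The action of an object `x` on morphisms between symbols. -/
def lAct (x : C₁) {A B : Symb k C M N} (h : A ⟶ B) :
    (⟨x ⊙ₗ A.fst, A.snd⟩ : Symb k C M N) ⟶ ⟨x ⊙ₗ B.fst, B.snd⟩ :=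
  (leftFunctor k C M N x).map h

variable {k C M N} in
lemma lAct_id (x : C₁) (A : Symb k C M N) : lAct k C M N x (𝟙 A) = 𝟙 _ :=
  (leftFunctor k C M N x).map_id A

variable {k C M N} in
lemma lAct_comp (x : C₁) {A B E : Symb k C M N} (h : A ⟶ B) (h' : B ⟶ E) :
    lAct k C M N x (h ≫ h') = lAct k C M N x h ≫ lAct k C M N x h' :=
  (leftFunctor k C M N x).map_comp h h'

variable {k C M N} in
lemma lAct_pair (x : C₁) {X X' : M} {Y Y' : N} (f : X ⟶ X') (g : Y ⟶ Y') :
    lAct k C M N x (Symb.pair f g) = Symb.pair (x ⊴ₗ f) g := rfl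

variable {k C M N} in
lemma lAct_assoc (x : C₁) (X : M) (V : C) (Y : N) :
    lAct k C M N x (Symb.assocIso X V Y).hom =
      Symb.pair (Bimodule.middle x X V).inv (𝟙 Y) ≫ (Symb.assocIso (x ⊙ₗ X) V Y).hom := rfl

lemma lAct_naturality {x x' : C₁} (f : x ⟶ x') {A B : Symb k C M N} (h : A ⟶ B) :
    lAct k C M N x h ≫ Symb.pair (f ⊵ₗ B.fst) (𝟙 B.snd) =
      Symb.pair (f ⊵ₗ A.fst) (𝟙 A.snd) ≫ lAct k C M N x' h := by
  refine Symb.naturality_of_generators (leftFunctor k C M N x) (leftFunctor k C M N x')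
    (fun A => Symb.pair (f ⊵ₗ A.fst) (𝟙 A.snd)) ?_ ?_ h
  · intro X X' Y Y' g g'
    change Symb.pair (x ⊴ₗ g) g' ≫ Symb.pair (f ⊵ₗ X') (𝟙 Y') =
      Symb.pair (f ⊵ₗ X) (𝟙 Y) ≫ Symb.pair (x' ⊴ₗ g) g'
    rw [Symb.pair_comp, Symb.pair_comp, MonoidalLeftAction.action_exchange, Category.comp_id,
      Category.id_comp]
  · intro X V Y
    change (_ ≫ _) ≫ Symb.pair (f ⊵ₗ X) (𝟙 (V ⊙ₗ Y)) =
      Symb.pair (f ⊵ₗ (X ⊙ᵣ V)) (𝟙 Y) ≫ _ ≫ _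
    rw [Category.assoc]
    change _ ≫ (Symb.assocIso (x ⊙ₗ X) V Y).hom ≫ Symb.pair (f ⊵ₗ X) (𝟙 (V ⊙ₗ Y)) = _
    rw [← Symb.assoc_naturality_fst, ← Category.assoc, ← Category.assoc]
    congr 1
    change Symb.pair (Bimodule.middle x X V).inv (𝟙 Y) ≫ _ =
      _ ≫ Symb.pair (Bimodule.middle x' X V).inv (𝟙 Y)
    rw [Symb.pair_comp, Symb.pair_comp, middle_inv_naturality_left]

lemma lAct_assoc_naturality (x y : C₁) {A B : Symb k C M N} (h : A ⟶ B) :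
    lAct k C M N (x ⊗ y) h ≫ Symb.pair (αₗ x y B.fst).hom (𝟙 B.snd) =
      Symb.pair (αₗ x y A.fst).hom (𝟙 A.snd) ≫ lAct k C M N x (lAct k C M N y h) := by
  refine Symb.naturality_of_generators (leftFunctor k C M N (x ⊗ y))
    (leftFunctor k C M N y ⋙ leftFunctor k C M N x)
    (fun A => Symb.pair (αₗ x y A.fst).hom (𝟙 A.snd)) ?_ ?_ h
  · intro X X' Y Y' g g'
    change Symb.pair ((x ⊗ y) ⊴ₗ g) g' ≫ Symb.pair (αₗ x y X').hom (𝟙 Y') =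
      Symb.pair (αₗ x y X).hom (𝟙 Y) ≫ Symb.pair (x ⊴ₗ y ⊴ₗ g) g'
    rw [Symb.pair_comp, Symb.pair_comp, MonoidalLeftAction.tensor_actionHomRight,
      Category.assoc, Category.assoc, Iso.inv_hom_id, Category.comp_id, Category.comp_id,
      Category.id_comp]
  · intro X V Y
    change (_ ≫ (Symb.assocIso ((x ⊗ y) ⊙ₗ X) V Y).hom) ≫
        Symb.pair (αₗ x y X).hom (𝟙 (V ⊙ₗ Y)) =
      Symb.pair (αₗ x y (X ⊙ᵣ V)).hom (𝟙 Y) ≫ lAct k C M N x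
        (Symb.pair (Bimodule.middle y X V).inv (𝟙 Y) ≫ (Symb.assocIso (y ⊙ₗ X) V Y).hom)
    rw [lAct_comp, lAct_assoc, Category.assoc, ← Symb.assoc_naturality_fst]
    change Symb.pair (Bimodule.middle (x ⊗ y) X V).inv (𝟙 Y) ≫ _ ≫ _ =
      _ ≫ Symb.pair (x ⊴ₗ (Bimodule.middle y X V).inv) (𝟙 Y) ≫ _ ≫ _
    simp only [← Category.assoc]
    congr 1
    simp only [Category.assoc, Symb.pair_comp, middle_pentagon_left_inv, Category.comp_id]

lemma lAct_unit_naturality {A B : Symb k C M N} (h : A ⟶ B) :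
    Symb.pair (λₗ[C₁] A.fst).hom (𝟙 A.snd) ≫ h =
      lAct k C M N (𝟙_ C₁) h ≫ Symb.pair (λₗ[C₁] B.fst).hom (𝟙 B.snd) := by
  symm
  refine Symb.naturality_of_generators (leftFunctor k C M N (𝟙_ C₁)) (𝟭 _)
    (fun A => Symb.pair (λₗ[C₁] A.fst).hom (𝟙 A.snd)) ?_ ?_ h
  · intro X X' Y Y' g g'
    change Symb.pair ((𝟙_ C₁) ⊴ₗ g) g' ≫ Symb.pair (λₗ[C₁] X').hom (𝟙 Y') =
      Symb.pair (λₗ[C₁] X).hom (𝟙 Y) ≫ Symb.pair g g'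
    rw [Symb.pair_comp, Symb.pair_comp, MonoidalLeftAction.actionUnitIso_hom_naturality,
      Category.comp_id, Category.id_comp]
  · intro X V Y
    change (Symb.pair (Bimodule.middle (𝟙_ C₁) X V).inv (𝟙 Y) ≫
        (Symb.assocIso ((𝟙_ C₁) ⊙ₗ X) V Y).hom) ≫
        Symb.pair (λₗ[C₁] X).hom (𝟙 (V ⊙ₗ Y)) =
      Symb.pair (λₗ[C₁] (X ⊙ᵣ V)).hom (𝟙 Y) ≫ (Symb.assocIso X V Y).hom
    rw [Category.assoc, ← Symb.assoc_naturality_fst, ← Category.assoc, Symb.pair_comp,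
      ← middle_unit_left, Iso.inv_hom_id_assoc, Category.comp_id]

/-- The left action on symbols, `x ⊗ [X, Y] = [x ⊗ X, Y]`. -/
instance : MonoidalLeftAction C₁ (Symb k C M N) where
  actionObj x A := ⟨x ⊙ₗ A.fst, A.snd⟩
  actionHomLeft f A := Symb.pair (f ⊵ₗ A.fst) (𝟙 A.snd)
  actionHomRight x _ _ h := lAct k C M N x h
  actionAssocIso x y A := Symb.pairIso (αₗ x y A.fst) (Iso.refl A.snd)
  actionUnitIso A := Symb.pairIso (λₗ[C₁] A.fst) (Iso.refl A.snd)
  actionHomRight_id x A := (leftFunctor k C M N x).map_id A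
  id_actionHomLeft x A := by rw [MonoidalLeftAction.id_actionHomLeft]; rfl
  actionHom_comp {_ _ c'' A B _} f₁ f₂ g₁ g₂ := by
    change Symb.pair ((f₁ ≫ f₂) ⊵ₗ A.fst) (𝟙 A.snd) ≫ lAct k C M N c'' (g₁ ≫ g₂) =
      (Symb.pair (f₁ ⊵ₗ A.fst) (𝟙 A.snd) ≫ lAct k C M N _ g₁) ≫
        Symb.pair (f₂ ⊵ₗ B.fst) (𝟙 B.snd) ≫ lAct k C M N _ g₂
    rw [MonoidalLeftAction.comp_actionHomLeft, lAct_comp, Category.assoc,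
      ← Category.assoc (lAct k C M N _ g₁), lAct_naturality,
      Category.assoc, ← Category.assoc (Symb.pair (f₁ ⊵ₗ A.fst) (𝟙 A.snd)), Symb.pair_comp,
      Category.comp_id]
  actionAssocIso_hom_naturality {c₁ c₂ c₃ c₄ A B} f g h := by
    have e : (f ⊗ₘ g) ⊵ₗ A.fst ≫ (αₗ c₂ c₄ A.fst).hom =
        (αₗ c₁ c₃ A.fst).hom ≫ f ⊵ₗ (c₃ ⊙ₗ A.fst) ≫ c₂ ⊴ₗ (g ⊵ₗ A.fst) := by
      have := MonoidalLeftAction.actionAssocIso_hom_naturality f g (𝟙 A.fst)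
      rwa [MonoidalLeftAction.actionHom_id, MonoidalLeftAction.actionHom_id,
        MonoidalLeftAction.actionHom_def f] at this
    change (Symb.pair ((f ⊗ₘ g) ⊵ₗ A.fst) (𝟙 A.snd) ≫ lAct k C M N (c₂ ⊗ c₄) h) ≫
        Symb.pair (αₗ c₂ c₄ B.fst).hom (𝟙 B.snd) =
      Symb.pair (αₗ c₁ c₃ A.fst).hom (𝟙 A.snd) ≫
        Symb.pair (f ⊵ₗ (c₃ ⊙ₗ A.fst)) (𝟙 A.snd) ≫ lAct k C M N c₂
          (Symb.pair (g ⊵ₗ A.fst) (𝟙 A.snd) ≫ lAct k C M N c₄ h)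
    rw [Category.assoc, lAct_assoc_naturality, lAct_comp]
    change _ = _ ≫ _ ≫ Symb.pair (c₂ ⊴ₗ (g ⊵ₗ A.fst)) (𝟙 A.snd) ≫ _
    simp only [← Category.assoc, Symb.pair_comp, Category.comp_id]
    rw [e, Category.assoc]
  actionUnitIso_hom_naturality h := lAct_unit_naturality k C M N h
  whiskerLeft_actionHomLeft c c' c'' f A := by
    change Symb.pair ((c ◁ f) ⊵ₗ A.fst) (𝟙 A.snd) =
      Symb.pair (αₗ c c' A.fst).hom (𝟙 A.snd) ≫ Symb.pair (c ⊴ₗ f ⊵ₗ A.fst) (𝟙 A.snd) ≫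
        Symb.pair (αₗ c c'' A.fst).inv (𝟙 A.snd)
    simp only [Symb.pair_comp, Category.comp_id, MonoidalLeftAction.whiskerLeft_actionHomLeft]
  whiskerRight_actionHomLeft {c c'} c'' f A := by
    change Symb.pair ((f ▷ c'') ⊵ₗ A.fst) (𝟙 A.snd) =
      Symb.pair (αₗ c c'' A.fst).hom (𝟙 A.snd) ≫ Symb.pair (f ⊵ₗ (c'' ⊙ₗ A.fst)) (𝟙 A.snd) ≫
        Symb.pair (αₗ c' c'' A.fst).inv (𝟙 A.snd)
    rw [Symb.pair_comp, Symb.pair_comp, Category.comp_id, Category.comp_id,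
      ← MonoidalLeftAction.whiskerRight_actionHomLeft]
  associator_actionHom c₁ c₂ c₃ A := by
    change Symb.pair ((α_ c₁ c₂ c₃).hom ⊵ₗ A.fst) (𝟙 A.snd) ≫
        Symb.pair (αₗ c₁ (c₂ ⊗ c₃) A.fst).hom (𝟙 A.snd) ≫
          Symb.pair (c₁ ⊴ₗ (αₗ c₂ c₃ A.fst).hom) (𝟙 A.snd) =
      Symb.pair (αₗ (c₁ ⊗ c₂) c₃ A.fst).hom (𝟙 A.snd) ≫
        Symb.pair (αₗ c₁ c₂ (c₃ ⊙ₗ A.fst)).hom (𝟙 A.snd)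
    simp only [Symb.pair_comp, Category.comp_id, MonoidalLeftAction.associator_actionHom]
  leftUnitor_actionHom c A := by
    change Symb.pair ((λ_ c).hom ⊵ₗ A.fst) (𝟙 A.snd) =
      Symb.pair (αₗ (𝟙_ C₁) c A.fst).hom (𝟙 A.snd) ≫
        Symb.pair (λₗ[C₁] (c ⊙ₗ A.fst)).hom (𝟙 A.snd)
    simp only [Symb.pair_comp, Category.comp_id, MonoidalLeftAction.leftUnitor_actionHom]
  rightUnitor_actionHom c A := by
    change Symb.pair ((ρ_ c).hom ⊵ₗ A.fst) (𝟙 A.snd) =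
      Symb.pair (αₗ c (𝟙_ C₁) A.fst).hom (𝟙 A.snd) ≫
        Symb.pair (c ⊴ₗ (λₗ[C₁] A.fst).hom) (𝟙 A.snd)
    simp only [Symb.pair_comp, Category.comp_id, MonoidalLeftAction.rightUnitor_actionHom]

instance : LinearLeftAction k C₁ (Symb k C M N) where
  add_left f g A := by
    change Symb.pair ((f + g) ⊵ₗ A.fst) (𝟙 A.snd) = _
    rw [LinearLeftAction.add_left k, Symb.pair_add_left]; rfl
  smul_left a f A := by
    change Symb.pair ((a • f) ⊵ₗ A.fst) (𝟙 A.snd) = _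
    rw [LinearLeftAction.smul_left, Symb.pair_smul_left]; rfl
  add_right x _ _ f g := (leftFunctor k C M N x).map_add
  smul_right x _ _ a f := (leftFunctor k C M N x).map_smul a f

end LeftAct

section RightAct

variable (k : Type w) [Field k] {C₃ : Type u₄} [Category.{v₄} C₃] [MonoidalCategory C₃]
  [Preadditive C₃] [Linear k C₃]
  (C : Type u₁) [Category.{v₁} C] [MonoidalCategory C]
  (M : Type u₂) [Category.{v₂} M] [Preadditive M] [Linear k M] [MonoidalRightAction C M]
  (N : Type u₃) [Category.{v₃} N] [Preadditive N] [Linear k N] [MonoidalLeftAction C N]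
  [MonoidalRightAction C₃ N] [LinearRightAction k C₃ N] [Bimodule C C₃ N]

/-- The endofunctor `[X, Y] ↦ [X, Y ⊗ s]`, as a bilinear functor. -/
def rightBilinear (s : C₃) : BilinearFunctor k C M N (Symb k C M N) where
  obj X Y := ⟨X, Y ⊙ᵣ s⟩
  map f g := Symb.pair f (g ⊵ᵣ s)
  map_id X Y := by rw [MonoidalRightAction.id_actionHomLeft, Symb.pair_id]
  map_comp f f' g g' := by rw [MonoidalRightAction.comp_actionHomLeft, Symb.pair_comp]
  map_add_left f f' g := by rw [Symb.pair_add_left]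
  map_add_right f g g' := by rw [LinearRightAction.add_left k, Symb.pair_add_right]
  map_smul_left a f g := by rw [Symb.pair_smul_left]
  map_smul_right a f g := by rw [LinearRightAction.smul_left, Symb.pair_smul_right]
  balance X V Y :=
    Symb.assocIso X V (Y ⊙ᵣ s) ≪≫ Symb.pairIso (Iso.refl X) (Bimodule.middle V Y s).symm
  naturality {X X' V V' Y Y'} f u g := by
    have e : (u ⊙ₗₘ (g ⊵ᵣ s)) ≫ (Bimodule.middle V' Y' s).inv =
        (Bimodule.middle V Y s).inv ≫ (u ⊙ₗₘ g) ⊵ᵣ s := by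
      rw [Iso.comp_inv_eq, Category.assoc, Iso.eq_inv_comp, MonoidalLeftAction.actionHom_def,
        MonoidalLeftAction.actionHom_def, MonoidalRightAction.comp_actionHomLeft, Category.assoc,
        Bimodule.naturality_mid, ← Category.assoc, ← Category.assoc, Bimodule.naturality_left]
    simp only [Iso.trans_hom, Symb.pairIso, Iso.symm_hom, Iso.refl_hom, Category.assoc]
    rw [← Category.assoc, Symb.assoc_naturality, Category.assoc, Symb.pair_comp, Symb.pair_comp,
      e, Category.comp_id, Category.id_comp]
  coherence X V W Y := by
    have n := Symb.assoc_naturality_snd (k := k) X V (Bimodule.middle W Y s).inv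
    simp only [Iso.trans_hom, Symb.pairIso, Iso.symm_hom, Iso.refl_hom, Category.assoc,
      MonoidalRightAction.id_actionHomLeft]
    rw [Symb.pair_comp, middle_pentagon_left_inv,
      ← Category.assoc (Symb.pair (𝟙 (X ⊙ᵣ V)) _), n, Category.assoc, Symb.pair_comp,
      ← Category.assoc (Symb.assocIso (X ⊙ᵣ V) W (Y ⊙ᵣ s)).hom, ← Symb.coherence,
      Category.assoc, Category.assoc, Symb.pair_comp]
    simp only [Category.comp_id]

/-- `[X, Y] ↦ [X, Y ⊗ s]`, acting on the morphisms `α_{X,V,Y}` through the middle associativity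
of the bimodule category `N`. -/
abbrev rightFunctor (s : C₃) : Symb k C M N ⥤ Symb k C M N := (rightBilinear k C M N s).lift

/-- The action of an object `s` on morphisms between symbols. -/
def rAct (s : C₃) {A B : Symb k C M N} (h : A ⟶ B) :
    (⟨A.fst, A.snd ⊙ᵣ s⟩ : Symb k C M N) ⟶ ⟨B.fst, B.snd ⊙ᵣ s⟩ :=
  (rightFunctor k C M N s).map h

variable {k C M N} in
lemma rAct_id (s : C₃) (A : Symb k C M N) : rAct k C M N s (𝟙 A) = 𝟙 _ :=
  (rightFunctor k C M N s).map_id A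

variable {k C M N} in
lemma rAct_comp (s : C₃) {A B E : Symb k C M N} (h : A ⟶ B) (h' : B ⟶ E) :
    rAct k C M N s (h ≫ h') = rAct k C M N s h ≫ rAct k C M N s h' :=
  (rightFunctor k C M N s).map_comp h h'

variable {k C M N} in
lemma rAct_pair (s : C₃) {X X' : M} {Y Y' : N} (f : X ⟶ X') (g : Y ⟶ Y') :
    rAct k C M N s (Symb.pair f g) = Symb.pair f (g ⊵ᵣ s) := rfl

variable {k C M N} in
lemma rAct_assoc (s : C₃) (X : M) (V : C) (Y : N) :
    rAct k C M N s (Symb.assocIso X V Y).hom =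
      (Symb.assocIso X V (Y ⊙ᵣ s)).hom ≫ Symb.pair (𝟙 X) (Bimodule.middle V Y s).inv := rfl

lemma rAct_naturality {s s' : C₃} (f : s ⟶ s') {A B : Symb k C M N} (h : A ⟶ B) :
    rAct k C M N s h ≫ Symb.pair (𝟙 B.fst) (B.snd ⊴ᵣ f) =
      Symb.pair (𝟙 A.fst) (A.snd ⊴ᵣ f) ≫ rAct k C M N s' h := by
  refine Symb.naturality_of_generators (rightFunctor k C M N s) (rightFunctor k C M N s')
    (fun A => Symb.pair (𝟙 A.fst) (A.snd ⊴ᵣ f)) ?_ ?_ h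
  · intro X X' Y Y' g g'
    change Symb.pair g (g' ⊵ᵣ s) ≫ Symb.pair (𝟙 X') (Y' ⊴ᵣ f) =
      Symb.pair (𝟙 X) (Y ⊴ᵣ f) ≫ Symb.pair g (g' ⊵ᵣ s')
    rw [Symb.pair_comp, Symb.pair_comp, MonoidalRightAction.action_exchange, Category.comp_id,
      Category.id_comp]
  · intro X V Y
    change ((Symb.assocIso X V (Y ⊙ᵣ s)).hom ≫ Symb.pair (𝟙 X) (Bimodule.middle V Y s).inv) ≫
        Symb.pair (𝟙 X) ((V ⊙ₗ Y) ⊴ᵣ f) =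
      Symb.pair (𝟙 (X ⊙ᵣ V)) (Y ⊴ᵣ f) ≫
        (Symb.assocIso X V (Y ⊙ᵣ s')).hom ≫ Symb.pair (𝟙 X) (Bimodule.middle V Y s').inv
    have e : (Bimodule.middle V Y s).inv ≫ (V ⊙ₗ Y) ⊴ᵣ f =
        V ⊴ₗ (Y ⊴ᵣ f) ≫ (Bimodule.middle V Y s').inv := by
      rw [Iso.inv_comp_eq, ← Category.assoc, Iso.eq_comp_inv, Bimodule.naturality_right]
    rw [Category.assoc, Symb.pair_comp, e, ← Category.assoc (Symb.pair _ _),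
      Symb.assoc_naturality_snd, Category.assoc, Symb.pair_comp]

lemma rAct_assoc_naturality (s t : C₃) {A B : Symb k C M N} (h : A ⟶ B) :
    rAct k C M N (s ⊗ t) h ≫ Symb.pair (𝟙 B.fst) (αᵣ B.snd s t).hom =
      Symb.pair (𝟙 A.fst) (αᵣ A.snd s t).hom ≫ rAct k C M N t (rAct k C M N s h) := by
  refine Symb.naturality_of_generators (rightFunctor k C M N (s ⊗ t))
    (rightFunctor k C M N s ⋙ rightFunctor k C M N t)
    (fun A => Symb.pair (𝟙 A.fst) (αᵣ A.snd s t).hom) ?_ ?_ h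
  · intro X X' Y Y' g g'
    change Symb.pair g (g' ⊵ᵣ (s ⊗ t)) ≫ Symb.pair (𝟙 X') (αᵣ Y' s t).hom =
      Symb.pair (𝟙 X) (αᵣ Y s t).hom ≫ Symb.pair g ((g' ⊵ᵣ s) ⊵ᵣ t)
    have e := MonoidalRightAction.actionAssocIso_hom_naturality g' (𝟙 s) (𝟙 t)
    simp only [id_tensorHom_id, MonoidalRightAction.actionHom_id] at e
    rw [Symb.pair_comp, Symb.pair_comp, e, Category.comp_id, Category.id_comp]
  · intro X V Y
    have e : (Bimodule.middle V Y (s ⊗ t)).inv ≫ (αᵣ (V ⊙ₗ Y) s t).hom =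
        V ⊴ₗ (αᵣ Y s t).hom ≫ (Bimodule.middle V (Y ⊙ᵣ s) t).inv ≫
          (Bimodule.middle V Y s).inv ⊵ᵣ t := by
      rw [Iso.inv_comp_eq, ← Category.assoc, ← Bimodule.pentagon_right]
      simp only [Category.assoc, Iso.hom_inv_id_assoc]
      rw [← MonoidalRightAction.comp_actionHomLeft, Iso.hom_inv_id,
        MonoidalRightAction.id_actionHomLeft, Category.comp_id]
    change ((Symb.assocIso X V (Y ⊙ᵣ (s ⊗ t))).hom ≫
        Symb.pair (𝟙 X) (Bimodule.middle V Y (s ⊗ t)).inv) ≫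
        Symb.pair (𝟙 X) (αᵣ (V ⊙ₗ Y) s t).hom =
      Symb.pair (𝟙 (X ⊙ᵣ V)) (αᵣ Y s t).hom ≫ rAct k C M N t
        ((Symb.assocIso X V (Y ⊙ᵣ s)).hom ≫ Symb.pair (𝟙 X) (Bimodule.middle V Y s).inv)
    rw [rAct_comp, rAct_assoc, rAct_pair, Category.assoc, Symb.pair_comp, e]
    simp only [← Category.assoc]
    rw [Symb.assoc_naturality_snd]
    simp only [Category.assoc, Symb.pair_comp, Category.comp_id]

lemma rAct_unit_naturality {A B : Symb k C M N} (h : A ⟶ B) :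
    Symb.pair (𝟙 A.fst) (ρᵣ[C₃] A.snd).hom ≫ h =
      rAct k C M N (𝟙_ C₃) h ≫ Symb.pair (𝟙 B.fst) (ρᵣ[C₃] B.snd).hom := by
  symm
  refine Symb.naturality_of_generators (rightFunctor k C M N (𝟙_ C₃)) (𝟭 _)
    (fun A => Symb.pair (𝟙 A.fst) (ρᵣ[C₃] A.snd).hom) ?_ ?_ h
  · intro X X' Y Y' g g'
    change Symb.pair g (g' ⊵ᵣ (𝟙_ C₃)) ≫ Symb.pair (𝟙 X') (ρᵣ[C₃] Y').hom =
      Symb.pair (𝟙 X) (ρᵣ[C₃] Y).hom ≫ Symb.pair g g'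
    rw [Symb.pair_comp, Symb.pair_comp, MonoidalRightAction.actionUnitIso_hom_naturality,
      Category.comp_id, Category.id_comp]
  · intro X V Y
    change ((Symb.assocIso X V (Y ⊙ᵣ (𝟙_ C₃))).hom ≫
        Symb.pair (𝟙 X) (Bimodule.middle V Y (𝟙_ C₃)).inv) ≫
        Symb.pair (𝟙 X) (ρᵣ[C₃] (V ⊙ₗ Y)).hom =
      Symb.pair (𝟙 (X ⊙ᵣ V)) (ρᵣ[C₃] Y).hom ≫ (Symb.assocIso X V Y).hom
    rw [Category.assoc, Symb.assoc_naturality_snd, Symb.pair_comp,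
      ← middle_unit_right, Iso.inv_hom_id_assoc, Category.comp_id]

/-- The right action on symbols, `[X, Y] ⊗ s = [X, Y ⊗ s]`. -/
instance : MonoidalRightAction C₃ (Symb k C M N) where
  actionObj A s := ⟨A.fst, A.snd ⊙ᵣ s⟩
  actionHomRight A _ _ f := Symb.pair (𝟙 A.fst) (A.snd ⊴ᵣ f)
  actionHomLeft h s := rAct k C M N s h
  actionAssocIso A s t := Symb.pairIso (Iso.refl A.fst) (αᵣ A.snd s t)
  actionUnitIso A := Symb.pairIso (Iso.refl A.fst) (ρᵣ[C₃] A.snd)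
  actionHomRight_id s A := by
    change Symb.pair (𝟙 A.fst) (A.snd ⊴ᵣ 𝟙 s) = _
    rw [MonoidalRightAction.actionHomRight_id]; rfl
  id_actionHomLeft s A := (rightFunctor k C M N s).map_id A
  actionHom_comp {c c' c'' A B E} f₁ f₂ g₁ g₂ := by
    change rAct k C M N c (f₁ ≫ f₂) ≫ Symb.pair (𝟙 E.fst) (E.snd ⊴ᵣ (g₁ ≫ g₂)) =
      (rAct k C M N c f₁ ≫ Symb.pair (𝟙 B.fst) (B.snd ⊴ᵣ g₁)) ≫
        rAct k C M N c' f₂ ≫ Symb.pair (𝟙 E.fst) (E.snd ⊴ᵣ g₂)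
    rw [Category.assoc, ← Category.assoc (Symb.pair (𝟙 B.fst) _), ← rAct_naturality,
      Category.assoc, Symb.pair_comp, rAct_comp, Category.assoc, Category.comp_id,
      MonoidalRightAction.actionHomRight_comp]
  actionAssocIso_hom_naturality {A B c₁ c₂ c₃ c₄} h f g := by
    have e : B.snd ⊴ᵣ (f ⊗ₘ g) ≫ (αᵣ B.snd c₂ c₄).hom =
        (αᵣ B.snd c₁ c₃).hom ≫ (B.snd ⊴ᵣ f) ⊵ᵣ c₃ ≫ (B.snd ⊙ᵣ c₂) ⊴ᵣ g := by
      have := MonoidalRightAction.actionAssocIso_hom_naturality (𝟙 B.snd) f g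
      rwa [MonoidalRightAction.id_actionHom, MonoidalRightAction.id_actionHom,
        MonoidalRightAction.actionHom_def] at this
    change (rAct k C M N (c₁ ⊗ c₃) h ≫ Symb.pair (𝟙 B.fst) (B.snd ⊴ᵣ (f ⊗ₘ g))) ≫
        Symb.pair (𝟙 B.fst) (αᵣ B.snd c₂ c₄).hom =
      Symb.pair (𝟙 A.fst) (αᵣ A.snd c₁ c₃).hom ≫
        rAct k C M N c₃ (rAct k C M N c₁ h ≫ Symb.pair (𝟙 B.fst) (B.snd ⊴ᵣ f)) ≫
          Symb.pair (𝟙 B.fst) ((B.snd ⊙ᵣ c₂) ⊴ᵣ g)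
    rw [Category.assoc, Symb.pair_comp, e, rAct_comp, Category.assoc, ← Category.assoc,
      ← Category.assoc, ← rAct_assoc_naturality, rAct_pair]
    simp only [Category.assoc, Symb.pair_comp, Category.comp_id]
  actionUnitIso_hom_naturality h := rAct_unit_naturality k C M N h
  actionHomRight_whiskerRight {c' c''} f c A := by
    change Symb.pair (𝟙 A.fst) (A.snd ⊴ᵣ (f ▷ c)) =
      Symb.pair (𝟙 A.fst) (αᵣ A.snd c' c).hom ≫ Symb.pair (𝟙 A.fst) ((A.snd ⊴ᵣ f) ⊵ᵣ c) ≫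
        Symb.pair (𝟙 A.fst) (αᵣ A.snd c'' c).inv
    simp only [Symb.pair_comp, Category.comp_id, MonoidalRightAction.actionHomRight_whiskerRight]
  whiskerRight_actionHomLeft c {c' c''} f A := by
    change Symb.pair (𝟙 A.fst) (A.snd ⊴ᵣ (c ◁ f)) =
      Symb.pair (𝟙 A.fst) (αᵣ A.snd c c').hom ≫ Symb.pair (𝟙 A.fst) ((A.snd ⊙ᵣ c) ⊴ᵣ f) ≫
        Symb.pair (𝟙 A.fst) (αᵣ A.snd c c'').inv
    rw [Symb.pair_comp, Symb.pair_comp, Category.comp_id, Category.comp_id,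
      ← MonoidalRightAction.whiskerRight_actionHomLeft]
  actionHom_associator c₁ c₂ c₃ A := by
    change Symb.pair (𝟙 A.fst) (A.snd ⊴ᵣ (α_ c₁ c₂ c₃).hom) ≫
        Symb.pair (𝟙 A.fst) (αᵣ A.snd c₁ (c₂ ⊗ c₃)).hom ≫
          Symb.pair (𝟙 A.fst) (αᵣ (A.snd ⊙ᵣ c₁) c₂ c₃).hom =
      Symb.pair (𝟙 A.fst) (αᵣ A.snd (c₁ ⊗ c₂) c₃).hom ≫
        Symb.pair (𝟙 A.fst) ((αᵣ A.snd c₁ c₂).hom ⊵ᵣ c₃)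
    simp only [Symb.pair_comp, Category.comp_id, MonoidalRightAction.actionHom_associator]
  actionHom_leftUnitor c A := by
    change Symb.pair (𝟙 A.fst) (A.snd ⊴ᵣ (λ_ c).hom) =
      Symb.pair (𝟙 A.fst) (αᵣ A.snd (𝟙_ C₃) c).hom ≫
        Symb.pair (𝟙 A.fst) ((ρᵣ[C₃] A.snd).hom ⊵ᵣ c)
    simp only [Symb.pair_comp, Category.comp_id, MonoidalRightAction.actionHom_leftUnitor]
  actionHom_rightUnitor c A := by
    change Symb.pair (𝟙 A.fst) (A.snd ⊴ᵣ (ρ_ c).hom) =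
      Symb.pair (𝟙 A.fst) (αᵣ A.snd c (𝟙_ C₃)).hom ≫
        Symb.pair (𝟙 A.fst) (ρᵣ[C₃] (A.snd ⊙ᵣ c)).hom
    simp only [Symb.pair_comp, Category.comp_id, MonoidalRightAction.actionHom_rightUnitor]

instance : LinearRightAction k C₃ (Symb k C M N) where
  add_left f g s := (rightFunctor k C M N s).map_add
  smul_left a f s := (rightFunctor k C M N s).map_smul a f
  add_right A _ _ f g := by
    change Symb.pair (𝟙 A.fst) (A.snd ⊴ᵣ (f + g)) = _
    rw [LinearRightAction.add_right k, Symb.pair_add_right]; rfl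
  smul_right A _ _ a f := by
    change Symb.pair (𝟙 A.fst) (A.snd ⊴ᵣ (a • f)) = _
    rw [LinearRightAction.smul_right, Symb.pair_smul_right]; rfl

end RightAct

section BimodAct

variable (k : Type w) [Field k] {C₁ : Type u₄} [Category.{v₄} C₁] [MonoidalCategory C₁]
  [Preadditive C₁] [Linear k C₁]
  {C₃ : Type u₅} [Category.{v₅} C₃] [MonoidalCategory C₃] [Preadditive C₃] [Linear k C₃]
  (C : Type u₁) [Category.{v₁} C] [MonoidalCategory C]
  (M : Type u₂) [Category.{v₂} M] [Preadditive M] [Linear k M] [MonoidalRightAction C M]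
  [MonoidalLeftAction C₁ M] [LinearLeftAction k C₁ M] [Bimodule C₁ C M]
  (N : Type u₃) [Category.{v₃} N] [Preadditive N] [Linear k N] [MonoidalLeftAction C N]
  [MonoidalRightAction C₃ N] [LinearRightAction k C₃ N] [Bimodule C C₃ N]

lemma rAct_lAct (x : C₁) (s : C₃) {A B : Symb k C M N} (h : A ⟶ B) :
    rAct k C M N s (lAct k C M N x h) = lAct k C M N x (rAct k C M N s h) := by
  have key := Symb.naturality_of_generators (leftFunctor k C M N x ⋙ rightFunctor k C M N s)
    (rightFunctor k C M N s ⋙ leftFunctor k C M N x)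
    (fun A => 𝟙 (⟨x ⊙ₗ A.fst, A.snd ⊙ᵣ s⟩ : Symb k C M N)) ?_ ?_ h
  · change rAct k C M N s (lAct k C M N x h) ≫ 𝟙 _ =
      𝟙 _ ≫ lAct k C M N x (rAct k C M N s h) at key
    rwa [Category.comp_id, Category.id_comp] at key
  · intro X X' Y Y' g g'
    change Symb.pair (x ⊴ₗ g) (g' ⊵ᵣ s) ≫ 𝟙 _ = 𝟙 _ ≫ Symb.pair (x ⊴ₗ g) (g' ⊵ᵣ s)
    rw [Category.comp_id, Category.id_comp]
  · intro X V Y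
    change rAct k C M N s (lAct k C M N x (Symb.assocIso X V Y).hom) ≫ 𝟙 _ =
      𝟙 _ ≫ lAct k C M N x (rAct k C M N s (Symb.assocIso X V Y).hom)
    rw [Category.comp_id, Category.id_comp, lAct_assoc, rAct_comp, rAct_assoc, rAct_assoc,
      lAct_comp, lAct_assoc, rAct_pair, lAct_pair, MonoidalRightAction.id_actionHomLeft,
      MonoidalLeftAction.actionHomRight_id, Category.assoc]

/-- The symbols form a bimodule category, with `(x ⊗ [X, Y]) ⊗ s = x ⊗ ([X, Y] ⊗ s)`. -/
instance : Bimodule C₁ C₃ (Symb k C M N) where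
  middle x A s := Iso.refl (⟨x ⊙ₗ A.fst, A.snd ⊙ᵣ s⟩ : Symb k C M N)
  naturality_left {x x'} f A s := by
    change Symb.pair (f ⊵ₗ A.fst) (𝟙 A.snd ⊵ᵣ s) ≫ 𝟙 _ =
      𝟙 _ ≫ Symb.pair (f ⊵ₗ A.fst) (𝟙 (A.snd ⊙ᵣ s))
    rw [MonoidalRightAction.id_actionHomLeft, Category.comp_id, Category.id_comp]
  naturality_mid x {A B} g s := by
    change rAct k C M N s (lAct k C M N x g) ≫ 𝟙 _ = 𝟙 _ ≫ lAct k C M N x (rAct k C M N s g)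
    rw [rAct_lAct, Category.comp_id, Category.id_comp]
  naturality_right x A s s' h := by
    change Symb.pair (𝟙 (x ⊙ₗ A.fst)) (A.snd ⊴ᵣ h) ≫ 𝟙 _ =
      𝟙 _ ≫ Symb.pair (x ⊴ₗ 𝟙 A.fst) (A.snd ⊴ᵣ h)
    rw [MonoidalLeftAction.actionHomRight_id, Category.comp_id, Category.id_comp]
  pentagon_left x y A s := by
    change Symb.pair (αₗ x y A.fst).hom (𝟙 A.snd ⊵ᵣ s) ≫ 𝟙 _ ≫ lAct k C M N x
        (𝟙 (⟨y ⊙ₗ A.fst, A.snd ⊙ᵣ s⟩ : Symb k C M N)) =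
      𝟙 _ ≫ Symb.pair (αₗ x y A.fst).hom (𝟙 (A.snd ⊙ᵣ s))
    rw [lAct_id, MonoidalRightAction.id_actionHomLeft, Category.id_comp, Category.id_comp,
      Category.comp_id]
  pentagon_right x A s t := by
    change Symb.pair (𝟙 (x ⊙ₗ A.fst)) (αᵣ A.snd s t).hom ≫ rAct k C M N t
        (𝟙 (⟨x ⊙ₗ A.fst, A.snd ⊙ᵣ s⟩ : Symb k C M N)) ≫ 𝟙 _ =
      𝟙 _ ≫ Symb.pair (x ⊴ₗ 𝟙 A.fst) (αᵣ A.snd s t).hom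
    rw [rAct_id, MonoidalLeftAction.actionHomRight_id, Category.id_comp, Category.id_comp,
      Category.comp_id]

end BimodAct

/-! ### Additive envelopes: finite sums of symbols -/

section Envelope

variable {P : Type u₁} [Category.{v₁} P] [Preadditive P]

instance (k : Type w) [Field k] [Linear k P] (A B : Mat_ P) : Module k (A ⟶ B) :=
  inferInstanceAs (Module k (∀ i j, A.X i ⟶ B.X j))

lemma mat_smul_apply {k : Type w} [Field k] [Linear k P] {A B : Mat_ P} (a : k) (f : A ⟶ B)
    (i : A.ι) (j : B.ι) : (a • f) i j = a • f i j := rfl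

instance (k : Type w) [Field k] [Linear k P] : Linear k (Mat_ P) where
  smul_comp _ _ _ a f g := by
    ext i j
    simp [mat_smul_apply, Finset.smul_sum]
  comp_smul _ _ _ f a g := by
    ext i j
    simp [mat_smul_apply, Finset.smul_sum]

variable {ι : Type} [Fintype ι]

open scoped Classical in
/-- A diagonal matrix of morphisms. -/
def diag {X Y : ι → P} (f : ∀ i, X i ⟶ Y i) : (⟨ι, X⟩ : Mat_ P) ⟶ ⟨ι, Y⟩ :=
  fun i j => if h : i = j then f i ≫ eqToHom (congrArg Y h) else 0

lemma diag_comp_apply {X Y : ι → P} (f : ∀ i, X i ⟶ Y i) {B : Mat_ P}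
    (g : (⟨ι, Y⟩ : Mat_ P) ⟶ B) (i : ι) (j : B.ι) : (diag f ≫ g) i j = f i ≫ g i j := by
  rw [Mat_.comp_apply, Finset.sum_eq_single i]
  · simp [diag]
  · intro l _ h
    simp [diag, h.symm]
  · simp

lemma comp_diag_apply {X Y : ι → P} (f : ∀ i, X i ⟶ Y i) {B : Mat_ P}
    (g : B ⟶ (⟨ι, X⟩ : Mat_ P)) (i : B.ι) (j : ι) : (g ≫ diag f) i j = g i j ≫ f j := by
  rw [Mat_.comp_apply, Finset.sum_eq_single j]
  · simp [diag]
  · intro l _ h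
    simp [diag, h]
  · simp

lemma diag_id (X : ι → P) : diag (fun i => 𝟙 (X i)) = 𝟙 (⟨ι, X⟩ : Mat_ P) := by
  ext i j
  simp [diag, Mat_.id_apply]

lemma diag_comp {X Y Z : ι → P} (f : ∀ i, X i ⟶ Y i) (g : ∀ i, Y i ⟶ Z i) :
    diag f ≫ diag g = diag (fun i => f i ≫ g i) := by
  ext i j
  rw [diag_comp_apply]
  by_cases h : i = j
  · subst h; simp [diag]
  · simp [diag, h]

lemma diag_add {X Y : ι → P} (f g : ∀ i, X i ⟶ Y i) :
    diag (fun i => f i + g i) = diag f + diag g := by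
  ext i j
  by_cases h : i = j
  · subst h; simp [diag]
  · simp [diag, h]

lemma diag_smul {k : Type w} [Field k] [Linear k P] {X Y : ι → P} (a : k)
    (f : ∀ i, X i ⟶ Y i) : diag (fun i => a • f i) = a • diag f := by
  ext i j
  rw [mat_smul_apply]
  by_cases h : i = j
  · subst h; simp [diag]
  · simp [diag, h]

/-- A diagonal isomorphism. -/
def diagIso {X Y : ι → P} (f : ∀ i, X i ≅ Y i) : (⟨ι, X⟩ : Mat_ P) ≅ ⟨ι, Y⟩ where
  hom := diag (fun i => (f i).hom)
  inv := diag (fun i => (f i).inv)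
  hom_inv_id := by rw [diag_comp]; simp only [Iso.hom_inv_id, diag_id]
  inv_hom_id := by rw [diag_comp]; simp only [Iso.inv_hom_id, diag_id]

/-- The functor out of the additive envelope induced by an additive functor to a category with
finite direct sums. -/
def matLift {D : Type u₂} [Category.{v₂} D] [Preadditive D] [HasFiniteBiproducts D] (F : P ⥤ D)
    [F.Additive] : Mat_ P ⥤ D where
  obj A := ⨁ fun i => F.obj (A.X i)
  map f := biproduct.matrix fun i j => F.map (f i j)
  map_id A := by
    ext i j
    by_cases h : j = i
    · subst h; simp
    · simp [h]
  map_comp f g := by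
    ext i j
    simp [biproduct.lift_desc]

/-- The value of the induced functor at a sum with one term. -/
def matLiftSingle {D : Type u₂} [Category.{v₂} D] [Preadditive D] [HasFiniteBiproducts D]
    (F : P ⥤ D) [F.Additive] (A : P) :
    (matLift F).obj ((Mat_.embedding P).obj A) ≅ F.obj A :=
  biproductUniqueIso (fun _ : PUnit => F.obj A)

end Envelope

section EnvelopeLeft

variable (k : Type w) [Field k] (C : Type u₁) [Category.{v₁} C] [MonoidalCategory C]
  [Preadditive C] [Linear k C]
  (P : Type u₃) [Category.{v₃} P] [Preadditive P] [Linear k P]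
  [MonoidalLeftAction C P]

variable {C P} in
/-- The action of an object on a matrix of morphisms. -/
def matL (x : C) {A B : Mat_ P} (h : A ⟶ B) :
    (⟨A.ι, fun i => x ⊙ₗ A.X i⟩ : Mat_ P) ⟶ ⟨B.ι, fun i => x ⊙ₗ B.X i⟩ :=
  fun i j => x ⊴ₗ h i j

variable {C P} in
lemma matL_apply (x : C) {A B : Mat_ P} (h : A ⟶ B) (i : A.ι) (j : B.ι) :
    matL x h i j = x ⊴ₗ h i j := rfl

lemma actionLeft_additive [LinearLeftAction k C P] (x : C) : ((MonoidalLeftAction.curriedAction C P).obj x).Additive where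
  map_add := LinearLeftAction.add_right k x _ _

variable {C P} in
lemma matL_id [LinearLeftAction k C P] (x : C) (A : Mat_ P) : matL x (𝟙 A) = 𝟙 _ :=
  have := actionLeft_additive k C P x
  ((MonoidalLeftAction.curriedAction C P).obj x).mapMat_.map_id A

variable {C P} in
lemma matL_comp [LinearLeftAction k C P] (x : C) {A B E : Mat_ P} (h : A ⟶ B) (h' : B ⟶ E) :
    matL x (h ≫ h') = matL x h ≫ matL x h' :=
  have := actionLeft_additive k C P x
  ((MonoidalLeftAction.curriedAction C P).obj x).mapMat_.map_comp h h'

variable {C P} in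
lemma matL_diag [LinearLeftAction k C P] (x : C) {ι : Type} [Fintype ι] {X Y : ι → P} (f : ∀ i, X i ⟶ Y i) :
    matL x (diag f) = diag (fun i => x ⊴ₗ f i) := by
  have := actionLeft_additive k C P x
  have h0 : ∀ A B : P, x ⊴ₗ (0 : A ⟶ B) = 0 := fun A B =>
    ((MonoidalLeftAction.curriedAction C P).obj x).map_zero A B
  ext i j
  rw [matL_apply]
  unfold diag
  split_ifs with h
  · subst h; simp
  · exact h0 _ _

/-- A left action extends to finite sums componentwise. -/
@[reducible]
def matLeftAction [LinearLeftAction k C P] : MonoidalLeftAction C (Mat_ P) where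
  actionObj x A := ⟨A.ι, fun i => x ⊙ₗ A.X i⟩
  actionHomLeft f A := diag (fun i => f ⊵ₗ A.X i)
  actionHomRight x _ _ h := matL x h
  actionAssocIso x y A := diagIso (fun i => αₗ x y (A.X i))
  actionUnitIso A := diagIso (fun i => λₗ[C] (A.X i))
  actionHomRight_id x A := matL_id k x A
  id_actionHomLeft x A := by
    simp only [MonoidalLeftAction.id_actionHomLeft]
    exact diag_id _
  actionHom_comp {c c' c'' A B E} f₁ f₂ g₁ g₂ := by
    change diag (fun i => (f₁ ≫ f₂) ⊵ₗ A.X i) ≫ matL c'' (g₁ ≫ g₂) =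
      (diag (fun i => f₁ ⊵ₗ A.X i) ≫ matL c' g₁) ≫
        diag (fun i => f₂ ⊵ₗ B.X i) ≫ matL c'' g₂
    have n : matL c' g₁ ≫ diag (fun i => f₂ ⊵ₗ B.X i) =
        diag (fun i => f₂ ⊵ₗ A.X i) ≫ matL c'' g₁ := by
      ext i j
      rw [comp_diag_apply, diag_comp_apply, matL_apply, matL_apply,
        MonoidalLeftAction.action_exchange]
    rw [matL_comp k, Category.assoc, ← Category.assoc (matL c' g₁), n, Category.assoc,
      ← Category.assoc (diag fun i => f₁ ⊵ₗ A.X i), diag_comp]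
    simp only [MonoidalLeftAction.comp_actionHomLeft]
  actionAssocIso_hom_naturality {c₁ c₂ c₃ c₄ A B} f g h := by
    change (diag (fun i => (f ⊗ₘ g) ⊵ₗ A.X i) ≫ matL (c₂ ⊗ c₄) h) ≫
        diag (fun i => (αₗ c₂ c₄ (B.X i)).hom) =
      diag (fun i => (αₗ c₁ c₃ (A.X i)).hom) ≫ diag (fun i => f ⊵ₗ (c₃ ⊙ₗ A.X i)) ≫
        matL c₂ (diag (fun i => g ⊵ₗ A.X i) ≫ matL c₄ h)
    ext i j
    rw [comp_diag_apply, diag_comp_apply, diag_comp_apply, diag_comp_apply, matL_apply, matL_apply,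
      diag_comp_apply, matL_apply]
    have := MonoidalLeftAction.actionAssocIso_hom_naturality f g (h i j)
    rwa [MonoidalLeftAction.actionHom_def, MonoidalLeftAction.actionHom_def,
      MonoidalLeftAction.actionHom_def] at this
  actionUnitIso_hom_naturality {A B} h := by
    change diag (fun i => (λₗ[C] (A.X i)).hom) ≫ h =
      matL (𝟙_ C) h ≫ diag (fun i => (λₗ[C] (B.X i)).hom)
    ext i j
    rw [diag_comp_apply, comp_diag_apply, matL_apply,
      MonoidalLeftAction.actionUnitIso_hom_naturality]
  whiskerLeft_actionHomLeft c c' c'' f A := by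
    change diag (fun i => (c ◁ f) ⊵ₗ A.X i) = diag (fun i => (αₗ c c' (A.X i)).hom) ≫
      matL c (diag (fun i => f ⊵ₗ A.X i)) ≫ diag (fun i => (αₗ c c'' (A.X i)).inv)
    simp only [matL_diag k, diag_comp, MonoidalLeftAction.whiskerLeft_actionHomLeft]
  whiskerRight_actionHomLeft {c c'} c'' f A := by
    change diag (fun i => (f ▷ c'') ⊵ₗ A.X i) = diag (fun i => (αₗ c c'' (A.X i)).hom) ≫
      diag (fun i => f ⊵ₗ (c'' ⊙ₗ A.X i)) ≫ diag (fun i => (αₗ c' c'' (A.X i)).inv)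
    simp only [diag_comp, ← MonoidalLeftAction.whiskerRight_actionHomLeft]
  associator_actionHom c₁ c₂ c₃ A := by
    change diag (fun i => (α_ c₁ c₂ c₃).hom ⊵ₗ A.X i) ≫
        diag (fun i => (αₗ c₁ (c₂ ⊗ c₃) (A.X i)).hom) ≫
          matL c₁ (diag (fun i => (αₗ c₂ c₃ (A.X i)).hom)) =
      diag (fun i => (αₗ (c₁ ⊗ c₂) c₃ (A.X i)).hom) ≫
        diag (fun i => (αₗ c₁ c₂ (c₃ ⊙ₗ A.X i)).hom)
    simp only [matL_diag k, diag_comp, MonoidalLeftAction.associator_actionHom]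
  leftUnitor_actionHom c A := by
    change diag (fun i => (λ_ c).hom ⊵ₗ A.X i) = diag (fun i => (αₗ (𝟙_ C) c (A.X i)).hom) ≫
      diag (fun i => (λₗ[C] (c ⊙ₗ A.X i)).hom)
    simp only [diag_comp, MonoidalLeftAction.leftUnitor_actionHom]
  rightUnitor_actionHom c A := by
    change diag (fun i => (ρ_ c).hom ⊵ₗ A.X i) = diag (fun i => (αₗ c (𝟙_ C) (A.X i)).hom) ≫
      matL c (diag (fun i => (λₗ[C] (A.X i)).hom))
    simp only [matL_diag k, diag_comp, MonoidalLeftAction.rightUnitor_actionHom]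

lemma matLeftAction_linear [LinearLeftAction k C P] :
    letI := matLeftAction k C P
    LinearLeftAction k C (Mat_ P) :=
  letI := matLeftAction k C P
  { add_left := fun f g A => by
      change diag (fun i => (f + g) ⊵ₗ A.X i) =
        diag (fun i => f ⊵ₗ A.X i) + diag (fun i => g ⊵ₗ A.X i)
      simp only [LinearLeftAction.add_left k, diag_add]
    smul_left := fun a f A => by
      change diag (fun i => (a • f) ⊵ₗ A.X i) = a • diag (fun i => f ⊵ₗ A.X i)
      simp only [LinearLeftAction.smul_left, diag_smul]
    add_right := fun x A B f g => by
      change matL x (f + g) = matL x f + matL x g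
      ext i j
      exact LinearLeftAction.add_right k x (f i j) (g i j)
    smul_right := fun x A B a f => by
      change matL x (a • f) = a • matL x f
      ext i j
      exact LinearLeftAction.smul_right x a (f i j) }

end EnvelopeLeft

section EnvelopeRight

variable (k : Type w) [Field k] (C : Type u₁) [Category.{v₁} C] [MonoidalCategory C]
  [Preadditive C] [Linear k C]
  (P : Type u₃) [Category.{v₃} P] [Preadditive P] [Linear k P]
  [MonoidalRightAction C P]

variable {C P} in
/-- The right action of an object on a matrix of morphisms. -/
def matR (s : C) {A B : Mat_ P} (h : A ⟶ B) :
    (⟨A.ι, fun i => A.X i ⊙ᵣ s⟩ : Mat_ P) ⟶ ⟨B.ι, fun i => B.X i ⊙ᵣ s⟩ :=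
  fun i j => h i j ⊵ᵣ s

variable {C P} in
lemma matR_apply (s : C) {A B : Mat_ P} (h : A ⟶ B) (i : A.ι) (j : B.ι) :
    matR s h i j = h i j ⊵ᵣ s := rfl

lemma actionRight_additive [LinearRightAction k C P] (s : C) :
    ((MonoidalRightAction.curriedAction C P).obj s).Additive where
  map_add := LinearRightAction.add_left k _ _ s

variable {C P} in
lemma matR_id [LinearRightAction k C P] (s : C) (A : Mat_ P) : matR s (𝟙 A) = 𝟙 _ :=
  have := actionRight_additive k C P s
  ((MonoidalRightAction.curriedAction C P).obj s).mapMat_.map_id A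

variable {C P} in
lemma matR_comp [LinearRightAction k C P] (s : C) {A B E : Mat_ P} (h : A ⟶ B) (h' : B ⟶ E) :
    matR s (h ≫ h') = matR s h ≫ matR s h' :=
  have := actionRight_additive k C P s
  ((MonoidalRightAction.curriedAction C P).obj s).mapMat_.map_comp h h'

variable {C P} in
lemma matR_diag [LinearRightAction k C P] (s : C) {ι : Type} [Fintype ι] {X Y : ι → P} (f : ∀ i, X i ⟶ Y i) :
    matR s (diag f) = diag (fun i => f i ⊵ᵣ s) := by
  have := actionRight_additive k C P s
  have h0 : ∀ A B : P, (0 : A ⟶ B) ⊵ᵣ s = 0 := fun A B =>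
    ((MonoidalRightAction.curriedAction C P).obj s).map_zero A B
  ext i j
  rw [matR_apply]
  unfold diag
  split_ifs with h
  · subst h; simp
  · exact h0 _ _

/-- A right action extends to finite sums componentwise. -/
@[reducible]
def matRightAction [LinearRightAction k C P] : MonoidalRightAction C (Mat_ P) where
  actionObj A s := ⟨A.ι, fun i => A.X i ⊙ᵣ s⟩
  actionHomRight A _ _ f := diag (fun i => A.X i ⊴ᵣ f)
  actionHomLeft h s := matR s h
  actionAssocIso A s t := diagIso (fun i => αᵣ (A.X i) s t)
  actionUnitIso A := diagIso (fun i => ρᵣ[C] (A.X i))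
  actionHomRight_id s A := by
    simp only [MonoidalRightAction.actionHomRight_id]
    exact diag_id _
  id_actionHomLeft s A := matR_id k s A
  actionHom_comp {c c' c'' A B E} f₁ f₂ g₁ g₂ := by
    change matR c (f₁ ≫ f₂) ≫ diag (fun i => E.X i ⊴ᵣ (g₁ ≫ g₂)) =
      (matR c f₁ ≫ diag (fun i => B.X i ⊴ᵣ g₁)) ≫
        matR c' f₂ ≫ diag (fun i => E.X i ⊴ᵣ g₂)
    have n : diag (fun i => B.X i ⊴ᵣ g₁) ≫ matR c' f₂ =
        matR c f₂ ≫ diag (fun i => E.X i ⊴ᵣ g₁) := by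
      ext i j
      rw [comp_diag_apply, diag_comp_apply, matR_apply, matR_apply,
        MonoidalRightAction.action_exchange]
    rw [matR_comp k, Category.assoc, Category.assoc,
      ← Category.assoc (diag fun i => B.X i ⊴ᵣ g₁), n, Category.assoc, diag_comp]
    simp only [MonoidalRightAction.actionHomRight_comp]
  actionAssocIso_hom_naturality {A B c₁ c₂ c₃ c₄} h f g := by
    change (matR (c₁ ⊗ c₃) h ≫ diag (fun i => B.X i ⊴ᵣ (f ⊗ₘ g))) ≫
        diag (fun i => (αᵣ (B.X i) c₂ c₄).hom) =
      diag (fun i => (αᵣ (A.X i) c₁ c₃).hom) ≫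
        matR c₃ (matR c₁ h ≫ diag (fun i => B.X i ⊴ᵣ f)) ≫
          diag (fun i => (B.X i ⊙ᵣ c₂) ⊴ᵣ g)
    ext i j
    rw [comp_diag_apply, comp_diag_apply, diag_comp_apply, comp_diag_apply, matR_apply, matR_apply,
      comp_diag_apply, matR_apply]
    have := MonoidalRightAction.actionAssocIso_hom_naturality (h i j) f g
    rwa [MonoidalRightAction.actionHom_def, MonoidalRightAction.actionHom_def,
      MonoidalRightAction.actionHom_def] at this
  actionUnitIso_hom_naturality {A B} h := by
    change diag (fun i => (ρᵣ[C] (A.X i)).hom) ≫ h =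
      matR (𝟙_ C) h ≫ diag (fun i => (ρᵣ[C] (B.X i)).hom)
    ext i j
    rw [diag_comp_apply, comp_diag_apply, matR_apply,
      MonoidalRightAction.actionUnitIso_hom_naturality]
  actionHomRight_whiskerRight {c' c''} f c A := by
    change diag (fun i => A.X i ⊴ᵣ (f ▷ c)) = diag (fun i => (αᵣ (A.X i) c' c).hom) ≫
      matR c (diag (fun i => A.X i ⊴ᵣ f)) ≫ diag (fun i => (αᵣ (A.X i) c'' c).inv)
    simp only [matR_diag k, diag_comp, MonoidalRightAction.actionHomRight_whiskerRight]
  whiskerRight_actionHomLeft c {c' c''} f A := by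
    change diag (fun i => A.X i ⊴ᵣ (c ◁ f)) = diag (fun i => (αᵣ (A.X i) c c').hom) ≫
      diag (fun i => (A.X i ⊙ᵣ c) ⊴ᵣ f) ≫ diag (fun i => (αᵣ (A.X i) c c'').inv)
    simp only [diag_comp, ← MonoidalRightAction.whiskerRight_actionHomLeft]
  actionHom_associator c₁ c₂ c₃ A := by
    change diag (fun i => A.X i ⊴ᵣ (α_ c₁ c₂ c₃).hom) ≫
        diag (fun i => (αᵣ (A.X i) c₁ (c₂ ⊗ c₃)).hom) ≫
          diag (fun i => (αᵣ (A.X i ⊙ᵣ c₁) c₂ c₃).hom) =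
      diag (fun i => (αᵣ (A.X i) (c₁ ⊗ c₂) c₃).hom) ≫
        matR c₃ (diag (fun i => (αᵣ (A.X i) c₁ c₂).hom))
    simp only [matR_diag k, diag_comp, MonoidalRightAction.actionHom_associator]
  actionHom_leftUnitor c A := by
    change diag (fun i => A.X i ⊴ᵣ (λ_ c).hom) = diag (fun i => (αᵣ (A.X i) (𝟙_ C) c).hom) ≫
      matR c (diag (fun i => (ρᵣ[C] (A.X i)).hom))
    simp only [matR_diag k, diag_comp, MonoidalRightAction.actionHom_leftUnitor]
  actionHom_rightUnitor c A := by
    change diag (fun i => A.X i ⊴ᵣ (ρ_ c).hom) = diag (fun i => (αᵣ (A.X i) c (𝟙_ C)).hom) ≫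
      diag (fun i => (ρᵣ[C] (A.X i ⊙ᵣ c)).hom)
    simp only [diag_comp, MonoidalRightAction.actionHom_rightUnitor]

lemma matRightAction_linear [LinearRightAction k C P] :
    letI := matRightAction k C P
    LinearRightAction k C (Mat_ P) :=
  letI := matRightAction k C P
  { add_right := fun A _ _ f g => by
      change diag (fun i => A.X i ⊴ᵣ (f + g)) =
        diag (fun i => A.X i ⊴ᵣ f) + diag (fun i => A.X i ⊴ᵣ g)
      simp only [LinearRightAction.add_right k, diag_add]
    smul_right := fun A _ _ a f => by
      change diag (fun i => A.X i ⊴ᵣ (a • f)) = a • diag (fun i => A.X i ⊴ᵣ f)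
      simp only [LinearRightAction.smul_right, diag_smul]
    add_left := fun f g s => by
      change matR s (f + g) = matR s f + matR s g
      ext i j
      exact LinearRightAction.add_left k (f i j) (g i j) s
    smul_left := fun a f s => by
      change matR s (a • f) = a • matR s f
      ext i j
      exact LinearRightAction.smul_left a (f i j) s }

end EnvelopeRight

section EnvelopeBimod

variable (k : Type w) [Field k] (C : Type u₁) [Category.{v₁} C] [MonoidalCategory C]
  [Preadditive C] [Linear k C]
  (D : Type u₂) [Category.{v₂} D] [MonoidalCategory D] [Preadditive D] [Linear k D]
  (P : Type u₃) [Category.{v₃} P] [Preadditive P] [Linear k P]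
  [MonoidalLeftAction C P] [LinearLeftAction k C P]
  [MonoidalRightAction D P] [LinearRightAction k D P] [Bimodule C D P]

/-- A bimodule structure extends to finite sums componentwise. -/
@[reducible]
def matBimodule :
    letI := matLeftAction k C P
    letI := matRightAction k D P
    Bimodule C D (Mat_ P) :=
  letI := matLeftAction k C P
  letI := matRightAction k D P
  { middle := fun x A s => diagIso (fun i => Bimodule.middle x (A.X i) s)
    naturality_left := fun {x x'} f A s => by
      change matR s (diag (fun i => f ⊵ₗ A.X i)) ≫
          diag (fun i => (Bimodule.middle x' (A.X i) s).hom) =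
        diag (fun i => (Bimodule.middle x (A.X i) s).hom) ≫ diag (fun i => f ⊵ₗ (A.X i ⊙ᵣ s))
      simp only [matR_diag k, diag_comp, Bimodule.naturality_left]
    naturality_mid := fun x {A B} g s => by
      change matR s (matL x g) ≫ diag (fun i => (Bimodule.middle x (B.X i) s).hom) =
        diag (fun i => (Bimodule.middle x (A.X i) s).hom) ≫ matL x (matR s g)
      ext i j
      rw [comp_diag_apply, diag_comp_apply, matR_apply, matL_apply, matL_apply, matR_apply,
        Bimodule.naturality_mid]
    naturality_right := fun x A {s s'} h => by
      change diag (fun i => (x ⊙ₗ A.X i) ⊴ᵣ h) ≫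
          diag (fun i => (Bimodule.middle x (A.X i) s').hom) =
        diag (fun i => (Bimodule.middle x (A.X i) s).hom) ≫ matL x (diag (fun i => A.X i ⊴ᵣ h))
      simp only [matL_diag k, diag_comp, Bimodule.naturality_right]
    pentagon_left := fun x y A s => by
      change matR s (diag (fun i => (αₗ x y (A.X i)).hom)) ≫
          diag (fun i => (Bimodule.middle x (y ⊙ₗ A.X i) s).hom) ≫
            matL x (diag (fun i => (Bimodule.middle y (A.X i) s).hom)) =
        diag (fun i => (Bimodule.middle (x ⊗ y) (A.X i) s).hom) ≫
          diag (fun i => (αₗ x y (A.X i ⊙ᵣ s)).hom)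
      simp only [matL_diag k, matR_diag k, diag_comp, Bimodule.pentagon_left]
    pentagon_right := fun x A s t => by
      change diag (fun i => (αᵣ (x ⊙ₗ A.X i) s t).hom) ≫
          matR t (diag (fun i => (Bimodule.middle x (A.X i) s).hom)) ≫
            diag (fun i => (Bimodule.middle x (A.X i ⊙ᵣ s) t).hom) =
        diag (fun i => (Bimodule.middle x (A.X i) (s ⊗ t)).hom) ≫
          matL x (diag (fun i => (αᵣ (A.X i) s t).hom))
      simp only [matL_diag k, matR_diag k, diag_comp, Bimodule.pentagon_right] }

end EnvelopeBimod

/-! ### The relative tensor product -/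

section RelTensor

variable (k : Type w) [Field k] (C : Type u₁) [Category.{v₁} C] [MonoidalCategory C]
  (M : Type u₂) [Category.{v₂} M] [Preadditive M] [Linear k M] [MonoidalRightAction C M]
  (N : Type u₃) [Category.{v₃} N] [Preadditive N] [Linear k N] [MonoidalLeftAction C N]

/-- The relative tensor product `M ⊠ N` over `C`: its objects are the finite (possibly empty) sums
of symbols `[X, Y]`, its morphisms are matrices of morphisms between symbols. -/
abbrev RelTensor := Mat_ (Symb k C M N)

variable {M N}

/-- The symbol `[X, Y]` as an object of the relative tensor product. -/
abbrev symb (X : M) (Y : N) : RelTensor k C M N :=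
  (Mat_.embedding (Symb k C M N)).obj ⟨X, Y⟩

variable (M N)

variable (C₁ : Type u₄) [Category.{v₄} C₁] [MonoidalCategory C₁] [Preadditive C₁] [Linear k C₁]
  [MonoidalLeftAction C₁ M] [LinearLeftAction k C₁ M] [Bimodule C₁ C M]
  (C₃ : Type u₅) [Category.{v₅} C₃] [MonoidalCategory C₃] [Preadditive C₃] [Linear k C₃]
  [MonoidalRightAction C₃ N] [LinearRightAction k C₃ N] [Bimodule C C₃ N]

instance : MonoidalLeftAction C₁ (RelTensor k C M N) := matLeftAction k C₁ (Symb k C M N)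

instance : LinearLeftAction k C₁ (RelTensor k C M N) := matLeftAction_linear k C₁ (Symb k C M N)

instance : MonoidalRightAction C₃ (RelTensor k C M N) := matRightAction k C₃ (Symb k C M N)

instance : LinearRightAction k C₃ (RelTensor k C M N) := matRightAction_linear k C₃ (Symb k C M N)

instance : Bimodule C₁ C₃ (RelTensor k C M N) := matBimodule k C₁ C₃ (Symb k C M N)

end RelTensor

/-! ### Graded tensor categories -/

section SubAction

variable {C : Type u₁} [Category.{v₁} C] [MonoidalCategory C]
  (P Q : ObjectProperty C) [P.IsMonoidal]

/-- If `P ⊗ P ⊆ P` and `P ⊗ Q ⊆ Q`, then `P` acts on `Q` from the left by the tensor product. -/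
@[reducible]
def subLeftAction [ObjectProperty.TensorLE P Q Q] :
    MonoidalLeftAction P.FullSubcategory Q.FullSubcategory where
  actionObj x m := ⟨x.obj ⊗ m.obj, ObjectProperty.prop_tensor x.property m.property⟩
  actionHomLeft f m := Q.homMk (f.hom ▷ m.obj)
  actionHomRight x _ _ g := Q.homMk (x.obj ◁ g.hom)
  actionAssocIso x y m := Q.isoMk (α_ x.obj y.obj m.obj)
  actionUnitIso m := Q.isoMk (λ_ m.obj)
  actionHom_comp f₁ f₂ g₁ g₂ := by
    ext
    simp [whisker_exchange_assoc]
  actionAssocIso_hom_naturality f g h := by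
    ext
    simp [MonoidalCategory.tensorHom_def]

/-- If `P ⊗ P ⊆ P` and `Q ⊗ P ⊆ Q`, then `P` acts on `Q` from the right by the tensor product. -/
@[reducible]
def subRightAction [ObjectProperty.TensorLE Q P Q] :
    MonoidalRightAction P.FullSubcategory Q.FullSubcategory where
  actionObj m x := ⟨m.obj ⊗ x.obj, ObjectProperty.prop_tensor m.property x.property⟩
  actionHomLeft g x := Q.homMk (g.hom ▷ x.obj)
  actionHomRight m _ _ f := Q.homMk (m.obj ◁ f.hom)
  actionAssocIso m x y := Q.isoMk (α_ m.obj x.obj y.obj).symm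
  actionUnitIso m := Q.isoMk (ρ_ m.obj)
  actionHom_comp f₁ f₂ g₁ g₂ := by
    ext
    simp [whisker_exchange_assoc]
  actionAssocIso_hom_naturality f g h := by
    ext
    simp [MonoidalCategory.tensorHom_def]

/-- The associator makes `Q` a bimodule category over `P`. -/
@[reducible]
def subBimodule [ObjectProperty.TensorLE P Q Q] [ObjectProperty.TensorLE Q P Q] :
    letI := subLeftAction P Q
    letI := subRightAction P Q
    Bimodule P.FullSubcategory P.FullSubcategory Q.FullSubcategory :=
  letI := subLeftAction P Q
  letI := subRightAction P Q
  { middle := fun x m s => Q.isoMk (α_ x.obj m.obj s.obj)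
    naturality_left := fun f m s => by
      apply ObjectProperty.hom_ext
      exact associator_naturality_left f.hom m.obj s.obj
    naturality_mid := fun x _ _ g s => by
      apply ObjectProperty.hom_ext
      exact associator_naturality_middle x.obj g.hom s.obj
    naturality_right := fun x m _ _ h => by
      apply ObjectProperty.hom_ext
      exact associator_naturality_right x.obj m.obj h.hom
    pentagon_left := fun x y m s => by
      apply ObjectProperty.hom_ext
      exact MonoidalCategory.pentagon x.obj y.obj m.obj s.obj
    pentagon_right := fun x m s t => by
      apply ObjectProperty.hom_ext
      change (α_ (x.obj ⊗ m.obj) s.obj t.obj).inv ≫ (α_ x.obj m.obj s.obj).hom ▷ t.obj ≫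
        (α_ x.obj (m.obj ⊗ s.obj) t.obj).hom =
          (α_ x.obj m.obj (s.obj ⊗ t.obj)).hom ≫ x.obj ◁ (α_ m.obj s.obj t.obj).inv
      monoidal }

end SubAction

/-- A tensor category: a `k`-linear abelian monoidal category whose tensor product is (`k`-bilinear
and) exact in each variable and whose unit object has one-dimensional endomorphism algebra. -/
class IsTensorCategory (k : Type w) [Field k] (C : Type u₁) [Category.{v₁} C] [Abelian C]
    [Linear k C] [MonoidalCategory C] [MonoidalPreadditive C] [MonoidalLinear k C] : Prop where
  exact_left (X : C) : IsExact (tensorLeft X)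
  exact_right (X : C) : IsExact (tensorRight X)
  unit : Module.finrank k (𝟙_ C ⟶ 𝟙_ C) = 1

attribute [local instance] Abelian.hasFiniteBiproducts

/-- A grading of a tensor category by a group `G`: full abelian subcategories `C_g` of which `C` is
the direct sum, such that `C_g ⊗ C_h ⊆ C_{gh}`. -/
structure TensorGrading (k : Type w) [Field k] (G : Type u₂) [Group G] (C : Type u₁)
    [Category.{v₁} C] [Abelian C] [Linear k C] [MonoidalCategory C] [MonoidalPreadditive C]
    [MonoidalLinear k C] [IsTensorCategory k C] where
  /-- the homogeneous objects of a given degree -/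
  part : G → ObjectProperty C
  of_iso (g : G) : (part g).IsClosedUnderIsomorphisms
  zero (g : G) : (part g).ContainsZero
  sum (g : G) : (part g).IsClosedUnderFiniteProducts
  kernel (g : G) : (part g).IsClosedUnderKernels
  cokernel (g : G) : (part g).IsClosedUnderCokernels
  decompose (X : C) : ∃ (s : Finset G) (Y : G → C), (∀ g, part g (Y g)) ∧
    Nonempty (X ≅ ⨁ fun g : s => Y g)
  hom_eq_zero {g h : G} (hgh : g ≠ h) {X Y : C} (hX : part g X) (hY : part h Y) (f : X ⟶ Y) : f = 0
  tensor {g h : G} {X Y : C} (hX : part g X) (hY : part h Y) : part (g * h) (X ⊗ Y)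

namespace TensorGrading

variable {k : Type w} [Field k] {G : Type u₂} [Group G] {C : Type u₁} [Category.{v₁} C] [Abelian C]
  [Linear k C] [MonoidalCategory C] [MonoidalPreadditive C] [MonoidalLinear k C]
  [IsTensorCategory k C] (𝒜 : TensorGrading k G C)

instance (g : G) : (𝒜.part g).IsClosedUnderIsomorphisms := 𝒜.of_iso g

instance (g : G) : (𝒜.part g).ContainsZero := 𝒜.zero g

instance (g : G) : (𝒜.part g).IsClosedUnderFiniteProducts := 𝒜.sum g

instance (g : G) : (𝒜.part g).IsClosedUnderKernels := 𝒜.kernel g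

instance (g : G) : (𝒜.part g).IsClosedUnderCokernels := 𝒜.cokernel g

/-- The homogeneous component `C_g`. -/
abbrev comp (g : G) := (𝒜.part g).FullSubcategory

/-- The unit object has degree `1`. -/
lemma part_unit : 𝒜.part 1 (𝟙_ C) := by
  have hu := IsTensorCategory.unit (k := k) (C := C)
  obtain ⟨s, Y, hY, ⟨e⟩⟩ := 𝒜.decompose (𝟙_ C)
  have : Nontrivial (𝟙_ C ⟶ 𝟙_ C) := Module.nontrivial_of_finrank_pos (R := k) (by omega)
  have h1 : 𝟙 (𝟙_ C) ≠ 0 := by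
    intro h
    obtain ⟨f, hf⟩ := exists_ne (0 : 𝟙_ C ⟶ 𝟙_ C)
    exact hf (by rw [← Category.id_comp f, h, zero_comp])
  obtain ⟨g, hg⟩ : ∃ g : s, e.hom ≫ biproduct.π (fun g : s => Y g) g ≫
      biproduct.ι (fun g : s => Y g) g ≫ e.inv ≠ 0 := by
    by_contra! hcon
    apply h1
    have ht : ∑ g, biproduct.π (fun g : s => Y g) g ≫ biproduct.ι (fun g : s => Y g) g = 𝟙 _ :=
      IsBilimit.total (biproduct.isBilimit _)
    rw [← e.hom_inv_id, ← Category.id_comp e.inv, ← ht, Preadditive.sum_comp,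
      Preadditive.comp_sum]
    exact Finset.sum_eq_zero fun g _ => by rw [Category.assoc]; exact hcon g
  set p := e.hom ≫ biproduct.π (fun g : s => Y g) g ≫
      biproduct.ι (fun g : s => Y g) g ≫ e.inv with hp
  have hpp : p ≫ p = p := by simp [hp]
  obtain ⟨a, ha⟩ := (finrank_eq_one_iff_of_nonzero' (𝟙 (𝟙_ C)) h1).mp hu p
  have ha1 : a = 1 := by
    rw [← ha, Linear.smul_comp, Category.id_comp, smul_smul] at hpp
    have h2 : (a * a - a) • 𝟙 (𝟙_ C) = 0 := by rw [sub_smul, hpp, sub_self]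
    have h3 : a * (a - 1) = 0 := by
      have := (smul_eq_zero.mp h2).resolve_right h1
      linear_combination this
    rcases mul_eq_zero.mp h3 with h | h
    · exact absurd (by rw [← ha, h, zero_smul]) hg
    · linear_combination h
  have hp1 : p = 𝟙 _ := by rw [← ha, ha1, one_smul]
  have e' : Y g ≅ 𝟙_ C :=
    { hom := biproduct.ι (fun g : s => Y g) g ≫ e.inv
      inv := e.hom ≫ biproduct.π (fun g : s => Y g) g
      hom_inv_id := by simp
      inv_hom_id := by rw [Category.assoc, ← hp, hp1] }
  have hg1 : 𝒜.part g (𝟙_ C) := (𝒜.part g).prop_of_iso e' (hY g)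
  have hg2 : 𝒜.part (g * g) (𝟙_ C) :=
    (𝒜.part _).prop_of_iso (λ_ (𝟙_ C)) (𝒜.tensor hg1 hg1)
  have hgg : (g : G) * g = g := by
    by_contra h
    exact h1 (𝒜.hom_eq_zero h hg2 hg1 _)
  rwa [mul_eq_left.mp hgg] at hg1

/-- The objects of `C_g · C_h`: finite direct sums of objects `V ⊗ W` with `V` in `C_g` and `W` in
`C_h`. -/
def prod (g h : G) : ObjectProperty C := fun Z =>
  ∃ (n : ℕ) (V W : Fin n → C), (∀ i, 𝒜.part g (V i)) ∧ (∀ i, 𝒜.part h (W i)) ∧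
    Nonempty (Z ≅ ⨁ fun i => V i ⊗ W i)

lemma prod_le (g h : G) : 𝒜.prod g h ≤ 𝒜.part (g * h) := by
  rintro Z ⟨n, V, W, hV, hW, ⟨e⟩⟩
  exact (𝒜.part (g * h)).prop_of_iso e.symm
    ((𝒜.part (g * h)).prop_of_isLimit_fan (biproduct.isLimit fun i => V i ⊗ W i)
      fun i => 𝒜.tensor (hV i) (hW i))

/-- A grading is strong if all inclusions `C_g · C_h ⥤ C_{gh}` are equivalences. -/
def IsStronglyGraded : Prop :=
  ∀ g h : G, (ObjectProperty.ιOfLE (𝒜.prod_le g h)).IsEquivalence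

instance (g : G) : HasFiniteBiproducts (𝒜.comp g) :=
  HasFiniteBiproducts.of_hasFiniteProducts

instance (g : G) : ObjectProperty.TensorLE (𝒜.part 1) (𝒜.part g) (𝒜.part g) where
  prop_tensor _ _ h₁ h₂ := by simpa using 𝒜.tensor h₁ h₂

instance (g : G) : ObjectProperty.TensorLE (𝒜.part g) (𝒜.part 1) (𝒜.part g) where
  prop_tensor _ _ h₁ h₂ := by simpa using 𝒜.tensor h₁ h₂

instance : (𝒜.part 1).IsMonoidal where
  prop_unit := 𝒜.part_unit
  prop_tensor _ _ h₁ h₂ := by simpa using 𝒜.tensor h₁ h₂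

instance (g : G) : MonoidalLeftAction (𝒜.comp 1) (𝒜.comp g) :=
  subLeftAction (𝒜.part 1) (𝒜.part g)

instance (g : G) : MonoidalRightAction (𝒜.comp 1) (𝒜.comp g) :=
  subRightAction (𝒜.part 1) (𝒜.part g)

instance (g : G) : Bimodule (𝒜.comp 1) (𝒜.comp 1) (𝒜.comp g) :=
  subBimodule (𝒜.part 1) (𝒜.part g)

instance (g : G) : LinearLeftAction k (𝒜.comp 1) (𝒜.comp g) where
  add_left f f' _ := ObjectProperty.hom_ext _ (MonoidalPreadditive.add_whiskerRight f.hom f'.hom)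
  smul_left a f m := ObjectProperty.hom_ext _ (MonoidalLinear.smul_whiskerRight a f.hom m.obj)
  add_right _ _ _ f f' := ObjectProperty.hom_ext _ (MonoidalPreadditive.whiskerLeft_add f.hom f'.hom)
  smul_right x _ _ a f := ObjectProperty.hom_ext _ (MonoidalLinear.whiskerLeft_smul x.obj a f.hom)

instance (g : G) : LinearRightAction k (𝒜.comp 1) (𝒜.comp g) where
  add_left f f' _ := ObjectProperty.hom_ext _ (MonoidalPreadditive.add_whiskerRight f.hom f'.hom)
  smul_left a f m := ObjectProperty.hom_ext _ (MonoidalLinear.smul_whiskerRight a f.hom m.obj)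
  add_right _ _ _ f f' := ObjectProperty.hom_ext _ (MonoidalPreadditive.whiskerLeft_add f.hom f'.hom)
  smul_right x _ _ a f := ObjectProperty.hom_ext _ (MonoidalLinear.whiskerLeft_smul x.obj a f.hom)

end TensorGrading

/-! ### The canonical functor -/

namespace TensorGrading

variable {k : Type w} [Field k] {G : Type u₂} [Group G] {C : Type u₁} [Category.{v₁} C] [Abelian C]
  [Linear k C] [MonoidalCategory C] [MonoidalPreadditive C] [MonoidalLinear k C]
  [IsTensorCategory k C] (𝒜 : TensorGrading k G C)

/-- The tensor product `X ⊗ Y` as an object of `C_{gh}`. -/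
abbrev tensorObj {g h : G} (X : 𝒜.comp g) (Y : 𝒜.comp h) : 𝒜.comp (g * h) :=
  ⟨X.obj ⊗ Y.obj, 𝒜.tensor X.property Y.property⟩

/-- The tensor product `C_g × C_h ⥤ C_{gh}` is a balanced bilinear functor over `C_1`, through the
associator. -/
def tensorBilinear (g h : G) :
    BilinearFunctor k (𝒜.comp 1) (𝒜.comp g) (𝒜.comp h) (𝒜.comp (g * h)) where
  obj X Y := 𝒜.tensorObj X Y
  map f f' := (𝒜.part (g * h)).homMk (f.hom ⊗ₘ f'.hom)
  map_id X Y := ObjectProperty.hom_ext _ (id_tensorHom_id X.obj Y.obj)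
  map_comp f f' g g' := ObjectProperty.hom_ext _ (by simp)
  map_add_left f f' g := ObjectProperty.hom_ext _ (MonoidalPreadditive.add_tensor f.hom f'.hom g.hom)
  map_add_right f g g' := ObjectProperty.hom_ext _
    (MonoidalPreadditive.tensor_add f.hom g.hom g'.hom)
  map_smul_left a f g := by
    apply ObjectProperty.hom_ext
    change (a • f.hom) ⊗ₘ g.hom = a • (f.hom ⊗ₘ g.hom)
    simp [MonoidalCategory.tensorHom_def]
  map_smul_right a f g := by
    apply ObjectProperty.hom_ext
    change f.hom ⊗ₘ (a • g.hom) = a • (f.hom ⊗ₘ g.hom)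
    simp [MonoidalCategory.tensorHom_def]
  balance X V Y := (𝒜.part (g * h)).isoMk (α_ X.obj V.obj Y.obj)
  naturality f u g := by
    apply ObjectProperty.hom_ext
    change ((f.hom ▷ _ ≫ _ ◁ u.hom) ⊗ₘ g.hom) ≫ (α_ _ _ _).hom =
      (α_ _ _ _).hom ≫ (f.hom ⊗ₘ (u.hom ▷ _ ≫ _ ◁ g.hom))
    rw [← MonoidalCategory.tensorHom_def, ← MonoidalCategory.tensorHom_def]
    exact associator_naturality f.hom u.hom g.hom
  coherence X V W Y := by
    apply ObjectProperty.hom_ext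
    change ((α_ X.obj V.obj W.obj).hom ⊗ₘ 𝟙 Y.obj) ≫ (α_ X.obj (V.obj ⊗ W.obj) Y.obj).hom ≫
      (𝟙 X.obj ⊗ₘ (α_ V.obj W.obj Y.obj).hom) =
        (α_ (X.obj ⊗ V.obj) W.obj Y.obj).hom ≫ (α_ X.obj V.obj (W.obj ⊗ Y.obj)).hom
    simp

/-- The canonical functor `f_{g,h} : C_g ⊠ C_h ⥤ C_{gh}` out of the relative tensor product over
`C_1`, induced by the tensor product. -/
def canonicalFunctor (g h : G) :
    RelTensor k (𝒜.comp 1) (𝒜.comp g) (𝒜.comp h) ⥤ 𝒜.comp (g * h) :=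
  matLift (𝒜.tensorBilinear g h).lift

/-- The canonical functor sends `[X, Y]` to `X ⊗ Y`. -/
def canonicalFunctorSymb {g h : G} (X : 𝒜.comp g) (Y : 𝒜.comp h) :
    (𝒜.canonicalFunctor g h).obj (symb k (𝒜.comp 1) X Y) ≅ 𝒜.tensorObj X Y :=
  matLiftSingle (𝒜.tensorBilinear g h).lift ⟨X, Y⟩

end TensorGrading

end TensorCat

end

open TensorCat

noncomputable section

namespace TensorCat

universe w u₁ u₂ u₃ v₁ v₂ v₃

/-! ### Linear functors from oplax linear functors -/

section OfOplax

open Functor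

variable {D D' : Type*} [Category* D] [Category* D'] (F : D ⥤ D')
  (C : Type*) [Category* C] [MonoidalCategory C]

/-- An oplax left linear functor with invertible lineators is left linear. -/
@[reducible]
def leftLinearOfOplax [MonoidalLeftAction C D] [MonoidalLeftAction C D'] [F.OplaxLeftLinear C]
    [∀ (c : C) (d : D), IsIso (OplaxLeftLinear.δₗ F c d)] : F.LeftLinear C where
  μₗ c d := inv (OplaxLeftLinear.δₗ F c d)
  μₗ_naturality_left f d := by
    rw [IsIso.comp_inv_eq, Category.assoc, IsIso.eq_inv_comp,
      OplaxLeftLinear.δₗ_naturality_left]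
  μₗ_naturality_right c d d' f := by
    rw [IsIso.comp_inv_eq, Category.assoc, IsIso.eq_inv_comp,
      OplaxLeftLinear.δₗ_naturality_right]
  μₗ_associativity c c' d := by
    rw [IsIso.inv_comp_eq, ← Category.assoc, OplaxLeftLinear.δₗ_associativity]
    simp only [Category.assoc]
    rw [← MonoidalLeftAction.actionHomRight_comp_assoc, IsIso.hom_inv_id,
      MonoidalLeftAction.actionHomRight_id, Category.id_comp, IsIso.hom_inv_id, Category.comp_id]
  μₗ_unitality d := by
    rw [IsIso.eq_inv_comp, OplaxLeftLinear.δₗ_unitality_hom]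
  μₗ_comp_δₗ c d := IsIso.inv_hom_id _
  δₗ_comp_μₗ c d := IsIso.hom_inv_id _

/-- An oplax right linear functor with invertible lineators is right linear. -/
@[reducible]
def rightLinearOfOplax [MonoidalRightAction C D] [MonoidalRightAction C D']
    [F.OplaxRightLinear C] [∀ (d : D) (c : C), IsIso (OplaxRightLinear.δᵣ F d c)] :
    F.RightLinear C where
  μᵣ d c := inv (OplaxRightLinear.δᵣ F d c)
  μᵣ_naturality_left f d := by
    rw [IsIso.comp_inv_eq, Category.assoc, IsIso.eq_inv_comp,
      OplaxRightLinear.δᵣ_naturality_left]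
  μᵣ_naturality_right d c c' f := by
    rw [IsIso.comp_inv_eq, Category.assoc, IsIso.eq_inv_comp,
      OplaxRightLinear.δᵣ_naturality_right]
  μᵣ_associativity d c c' := by
    rw [IsIso.inv_comp_eq, ← Category.assoc, OplaxRightLinear.δᵣ_associativity]
    simp only [Category.assoc]
    rw [← MonoidalRightAction.comp_actionHomLeft_assoc, IsIso.hom_inv_id,
      MonoidalRightAction.id_actionHomLeft, Category.id_comp, IsIso.hom_inv_id, Category.comp_id]
  μᵣ_unitality d := by
    rw [IsIso.eq_inv_comp, OplaxRightLinear.δᵣ_unitality_hom]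
  μᵣ_comp_δᵣ c d := IsIso.inv_hom_id _
  δᵣ_comp_μᵣ c d := IsIso.hom_inv_id _

end OfOplax

/-! ### Functors out of the additive envelope -/

lemma isIso_biproduct_desc {D E : Type*} [Category* D] [Preadditive D] [HasFiniteBiproducts D]
    [Category* E] [Preadditive E] [HasFiniteBiproducts E] (T : D ⥤ E) [T.Additive] {ι : Type}
    [Finite ι] (Y : ι → D) (X : ι → E) (d : ∀ i, X i ⟶ T.obj (Y i)) (hd : ∀ i, IsIso (d i)) :
    IsIso (biproduct.desc fun i => d i ≫ T.map (biproduct.ι Y i)) := by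
  let e : (⨁ X) ≅ T.obj (⨁ Y) := biproduct.mapIso (fun i => asIso (d i)) ≪≫
    (T.mapBiproduct Y).symm
  have he : (biproduct.desc fun i => d i ≫ T.map (biproduct.ι Y i)) = e.hom := by
    refine biproduct.hom_ext' _ _ fun i => ?_
    simp only [e, biproduct.ι_desc, Iso.trans_hom, biproduct.mapIso_hom, asIso_hom, Iso.symm_hom,
      Functor.mapBiproduct_inv]
    erw [biproduct.ι_map_assoc, biproduct.ι_desc]
  rw [he]
  exact Iso.isIso_hom e

section MatLift

variable {P : Type u₁} [Category.{v₁} P] [Preadditive P]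
  {D : Type u₂} [Category.{v₂} D] [Preadditive D] [HasFiniteBiproducts D]
  (F : P ⥤ D) [F.Additive]

/-- The inclusion of a summand into the value of the induced functor. -/
def matι (A : Mat_ P) (i : A.ι) : F.obj (A.X i) ⟶ (matLift F).obj A :=
  biproduct.ι (fun i => F.obj (A.X i)) i

/-- The projection of the value of the induced functor to a summand. -/
def matπ (A : Mat_ P) (i : A.ι) : (matLift F).obj A ⟶ F.obj (A.X i) :=
  biproduct.π (fun i => F.obj (A.X i)) i

variable {F}

lemma matι_hom_ext {A : Mat_ P} {Z : D} {f g : (matLift F).obj A ⟶ Z}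
    (h : ∀ i, matι F A i ≫ f = matι F A i ≫ g) : f = g :=
  biproduct.hom_ext' _ _ h

lemma matπ_hom_ext {A : Mat_ P} {Z : D} {f g : Z ⟶ (matLift F).obj A}
    (h : ∀ i, f ≫ matπ F A i = g ≫ matπ F A i) : f = g :=
  biproduct.hom_ext _ _ h

lemma matι_matπ_hom_ext {A B : Mat_ P} {f g : (matLift F).obj A ⟶ (matLift F).obj B}
    (h : ∀ i j, matι F A i ≫ f ≫ matπ F B j = matι F A i ≫ g ≫ matπ F B j) : f = g :=
  matι_hom_ext fun i => matπ_hom_ext fun j => by simpa only [Category.assoc] using h i j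

variable (F)

lemma matι_map_matπ {A B : Mat_ P} (f : A ⟶ B) (i : A.ι) (j : B.ι) :
    matι F A i ≫ (matLift F).map f ≫ matπ F B j = F.map (f i j) := by
  simp [matLift, matι, matπ]

lemma matι_map {A B : Mat_ P} (f : A ⟶ B) (i : A.ι) :
    matι F A i ≫ (matLift F).map f = ∑ j, F.map (f i j) ≫ matι F B j := by
  have ht : ∑ j, matπ F B j ≫ matι F B j = 𝟙 _ := biproduct.total
  rw [← Category.comp_id ((matLift F).map f), ← ht, Preadditive.comp_sum, Preadditive.comp_sum]
  refine Finset.sum_congr rfl fun j _ => ?_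
  rw [← matι_map_matπ F f i j, Category.assoc, Category.assoc]

lemma matι_map_diag {ι : Type} [Fintype ι] {X Y : ι → P} (f : ∀ i, X i ⟶ Y i) (i : ι) :
    matι F ⟨ι, X⟩ i ≫ (matLift F).map (diag f) = F.map (f i) ≫ matι F ⟨ι, Y⟩ i := by
  rw [matι_map, Finset.sum_eq_single i]
  · simp [diag]
  · intro j _ h
    simp [diag, h.symm]
  · simp

instance : (matLift F).Additive where
  map_add {A B f g} := matι_matπ_hom_ext fun i j => by
    simp only [Preadditive.comp_add, Preadditive.add_comp, matι_map_matπ]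
    exact F.map_add

instance {k : Type w} [Field k] [Linear k P] [Linear k D] [F.Linear k] :
    (matLift F).Linear k where
  map_smul {A B} f a := matι_matπ_hom_ext fun i j => by
    simp only [Linear.comp_smul, Linear.smul_comp, matι_map_matπ]
    exact Functor.Linear.map_smul (F := F) (X := A.X i) (Y := B.X j) (f i j) a

instance [F.Faithful] : (matLift F).Faithful where
  map_injective {A B f g} h := by
    ext i j
    apply F.map_injective
    rw [← matι_map_matπ, ← matι_map_matπ, h]

instance [F.Full] : (matLift F).Full where
  map_surjective {A B} g := by
    let f : A ⟶ B := fun i j => F.preimage (matι F A i ≫ g ≫ matπ F B j)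
    refine ⟨f, matι_matπ_hom_ext fun i j => ?_⟩
    rw [matι_map_matπ]
    exact F.map_preimage _

instance [F.EssSurj] : (matLift F).EssSurj where
  mem_essImage Z := ⟨_, ⟨matLiftSingle F (F.objPreimage Z) ≪≫ F.objObjPreimageIso Z⟩⟩

instance [F.IsEquivalence] : (matLift F).IsEquivalence where

lemma matι_matLiftSingle (A : P) :
    matι F ((Mat_.embedding P).obj A) PUnit.unit ≫ (matLiftSingle F A).hom = 𝟙 (F.obj A) := by
  change biproduct.ι (fun _ : PUnit => F.obj A) _ ≫
    (biproductUniqueIso (fun _ : PUnit => F.obj A)).hom = _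
  exact biproduct.ι_desc _ _

end MatLift

section MatLiftLeft

open Functor OplaxLeftLinear

variable {C : Type u₁} [Category.{v₁} C] [MonoidalCategory C]
  {P : Type u₂} [Category.{v₂} P] [Preadditive P] [MonoidalLeftAction C P]
  {D : Type u₃} [Category.{v₃} D] [Preadditive D] [HasFiniteBiproducts D]
  [MonoidalLeftAction C D]
  (F : P ⥤ D) [F.Additive]

/-- The lineator of a functor induced on the additive envelope. -/
def matδₗ [F.OplaxLeftLinear C] (x : C) (A : Mat_ P) :
    (matLift F).obj ⟨A.ι, fun i => x ⊙ₗ A.X i⟩ ⟶ x ⊙ₗ (matLift F).obj A :=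
  biproduct.desc fun i => δₗ F x (A.X i) ≫ x ⊴ₗ matι F A i

lemma matι_matδₗ [F.OplaxLeftLinear C] (x : C) (A : Mat_ P) (i : A.ι) :
    matι F ⟨A.ι, fun i => x ⊙ₗ A.X i⟩ i ≫ matδₗ F x A = δₗ F x (A.X i) ≫ x ⊴ₗ matι F A i :=
  biproduct.ι_desc _ _

lemma isIso_matδₗ [F.OplaxLeftLinear C] (x : C) (A : Mat_ P)
    [((MonoidalLeftAction.curriedAction C D).obj x).Additive]
    [∀ B : P, IsIso (δₗ F x B)] : IsIso (matδₗ F x A) :=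
  isIso_biproduct_desc ((MonoidalLeftAction.curriedAction C D).obj x) _ _
    (fun i => δₗ F x (A.X i)) fun i => inferInstanceAs (IsIso (δₗ F x (A.X i)))

lemma matδₗ_naturality_left [F.OplaxLeftLinear C] {x x' : C} (f : x ⟶ x') (A : Mat_ P) :
    (matLift F).map (diag fun i => f ⊵ₗ A.X i) ≫ matδₗ F x' A =
      matδₗ F x A ≫ f ⊵ₗ (matLift F).obj A := by
  refine matι_hom_ext (A := ⟨A.ι, fun i => x ⊙ₗ A.X i⟩) fun i => ?_
  rw [← Category.assoc, matι_map_diag, ← Category.assoc, matι_matδₗ, Category.assoc, matι_matδₗ,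
    δₗ_naturality_left_assoc, Category.assoc, MonoidalLeftAction.action_exchange]

lemma matδₗ_naturality_right [Preadditive C] [F.OplaxLeftLinear C] (x : C)
    [((MonoidalLeftAction.curriedAction C D).obj x).Additive] {A B : Mat_ P} (f : A ⟶ B) :
    (matLift F).map (matL x f) ≫ matδₗ F x B = matδₗ F x A ≫ x ⊴ₗ (matLift F).map f := by
  refine matι_hom_ext (A := ⟨A.ι, fun i => x ⊙ₗ A.X i⟩) fun i => ?_
  have hs : x ⊴ₗ ∑ j, F.map (f i j) ≫ matι F B j = ∑ j, x ⊴ₗ (F.map (f i j) ≫ matι F B j) :=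
    ((MonoidalLeftAction.curriedAction C D).obj x).map_sum _ _
  rw [← Category.assoc, matι_map, ← Category.assoc, matι_matδₗ, Preadditive.sum_comp,
    Category.assoc, ← MonoidalLeftAction.actionHomRight_comp, matι_map, hs, Preadditive.comp_sum]
  refine Finset.sum_congr rfl fun j _ => ?_
  rw [Category.assoc, matι_matδₗ, matL_apply, δₗ_naturality_right_assoc,
    MonoidalLeftAction.actionHomRight_comp]

lemma matδₗ_associativity [F.OplaxLeftLinear C] (x y : C) (A : Mat_ P) :
    matδₗ F (x ⊗ y) A ≫ (αₗ x y ((matLift F).obj A)).hom =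
      (matLift F).map (diag fun i => (αₗ x y (A.X i)).hom) ≫
        matδₗ F x ⟨A.ι, fun i => y ⊙ₗ A.X i⟩ ≫ x ⊴ₗ matδₗ F y A := by
  refine matι_hom_ext (A := ⟨A.ι, fun i => (x ⊗ y) ⊙ₗ A.X i⟩) fun i => ?_
  have h := matι_matδₗ F x ⟨A.ι, fun i => y ⊙ₗ A.X i⟩ i
  rw [← Category.assoc, matι_matδₗ, ← Category.assoc, matι_map_diag, Category.assoc,
    Category.assoc, reassoc_of% h, ← MonoidalLeftAction.actionHomRight_comp, matι_matδₗ,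
    MonoidalLeftAction.actionHomRight_comp, ← δₗ_associativity_assoc]
  simp

lemma matδₗ_unitality_inv [F.OplaxLeftLinear C] (A : Mat_ P) :
    (λₗ[C] ((matLift F).obj A)).inv =
      (matLift F).map (diag fun i => (λₗ[C] (A.X i)).inv) ≫ matδₗ F (𝟙_ C) A := by
  refine matι_hom_ext fun i => ?_
  rw [← Category.assoc, matι_map_diag, Category.assoc, matι_matδₗ,
    ← δₗ_unitality_inv_assoc, MonoidalLeftAction.actionUnitIso_inv_naturality]

lemma matδₗ_comp_matLiftSingle [F.OplaxLeftLinear C] (x : C) (B : P) :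
    matδₗ F x ((Mat_.embedding P).obj B) ≫ x ⊴ₗ (matLiftSingle F B).hom = (matLiftSingle F (x ⊙ₗ B)).hom ≫ δₗ F x B := by
  refine matι_hom_ext (A := (Mat_.embedding P).obj (x ⊙ₗ B)) fun i => ?_
  have h₁ := matι_matLiftSingle F B
  have h₂ := matι_matLiftSingle F (x ⊙ₗ B)
  have h₃ := matι_matδₗ F x ((Mat_.embedding P).obj B) PUnit.unit
  have h₄ := (MonoidalLeftAction.actionHomRight_comp x _ _).symm.trans ((congrArg (x ⊴ₗ ·) h₁).trans
      (MonoidalLeftAction.actionHomRight_id x _))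
  have h₅ := congrArg (δₗ F x B ≫ ·) h₄
  refine (Category.assoc _ _ _).symm.trans ((congrArg (· ≫ _) h₃).trans
    ((Category.assoc _ _ _).trans (h₅.trans ((Category.comp_id _).trans ?_))))
  exact ((Category.assoc _ _ _).symm.trans
    ((congrArg (· ≫ _) h₂).trans (Category.id_comp _))).symm

/-- The functor induced on the additive envelope by an oplax left linear functor. -/
@[reducible]
def matLiftOplaxLeftLinear (k : Type w) [Field k] [Preadditive C] [Linear k C] [Linear k P]
    [LinearLeftAction k C P] [Linear k D] [LinearLeftAction k C D] [F.OplaxLeftLinear C] :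
    letI := matLeftAction k C P
    (matLift F).OplaxLeftLinear C :=
  letI := matLeftAction k C P
  { δₗ := matδₗ F
    δₗ_naturality_left := matδₗ_naturality_left F
    δₗ_naturality_right := fun x _ _ f =>
      have := actionLeft_additive k C D x
      matδₗ_naturality_right F x f
    δₗ_associativity := matδₗ_associativity F
    δₗ_unitality_inv := matδₗ_unitality_inv F }

end MatLiftLeft

section MatLiftRight

open Functor OplaxRightLinear

variable {C : Type u₁} [Category.{v₁} C] [MonoidalCategory C]
  {P : Type u₂} [Category.{v₂} P] [Preadditive P] [MonoidalRightAction C P]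
  {D : Type u₃} [Category.{v₃} D] [Preadditive D] [HasFiniteBiproducts D]
  [MonoidalRightAction C D]
  (F : P ⥤ D) [F.Additive]

/-- The right lineator of a functor induced on the additive envelope. -/
def matδᵣ [F.OplaxRightLinear C] (A : Mat_ P) (s : C) :
    (matLift F).obj ⟨A.ι, fun i => A.X i ⊙ᵣ s⟩ ⟶ (matLift F).obj A ⊙ᵣ s :=
  biproduct.desc fun i => δᵣ F (A.X i) s ≫ matι F A i ⊵ᵣ s

lemma matι_matδᵣ [F.OplaxRightLinear C] (A : Mat_ P) (s : C) (i : A.ι) :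
    matι F ⟨A.ι, fun i => A.X i ⊙ᵣ s⟩ i ≫ matδᵣ F A s = δᵣ F (A.X i) s ≫ matι F A i ⊵ᵣ s :=
  biproduct.ι_desc _ _

lemma isIso_matδᵣ [F.OplaxRightLinear C] (A : Mat_ P) (s : C)
    [((MonoidalRightAction.curriedAction C D).obj s).Additive]
    [∀ B : P, IsIso (δᵣ F B s)] : IsIso (matδᵣ F A s) :=
  isIso_biproduct_desc ((MonoidalRightAction.curriedAction C D).obj s) _ _
    (fun i => δᵣ F (A.X i) s) fun i => inferInstanceAs (IsIso (δᵣ F (A.X i) s))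

lemma matδᵣ_naturality_right [F.OplaxRightLinear C] (A : Mat_ P) {s s' : C} (f : s ⟶ s') :
    (matLift F).map (diag fun i => A.X i ⊴ᵣ f) ≫ matδᵣ F A s' =
      matδᵣ F A s ≫ (matLift F).obj A ⊴ᵣ f := by
  refine matι_hom_ext (A := ⟨A.ι, fun i => A.X i ⊙ᵣ s⟩) fun i => ?_
  rw [← Category.assoc, matι_map_diag, ← Category.assoc, matι_matδᵣ, Category.assoc, matι_matδᵣ,
    δᵣ_naturality_right_assoc, Category.assoc, MonoidalRightAction.action_exchange]

lemma matδᵣ_naturality_left [Preadditive C] [F.OplaxRightLinear C] {A B : Mat_ P} (f : A ⟶ B) (s : C)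
    [((MonoidalRightAction.curriedAction C D).obj s).Additive] :
    (matLift F).map (matR s f) ≫ matδᵣ F B s = matδᵣ F A s ≫ (matLift F).map f ⊵ᵣ s := by
  refine matι_hom_ext (A := ⟨A.ι, fun i => A.X i ⊙ᵣ s⟩) fun i => ?_
  have hs : (∑ j, F.map (f i j) ≫ matι F B j) ⊵ᵣ s = ∑ j, (F.map (f i j) ≫ matι F B j) ⊵ᵣ s :=
    ((MonoidalRightAction.curriedAction C D).obj s).map_sum _ _
  rw [← Category.assoc, matι_map, ← Category.assoc, matι_matδᵣ, Preadditive.sum_comp,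
    Category.assoc, ← MonoidalRightAction.comp_actionHomLeft, matι_map, hs, Preadditive.comp_sum]
  refine Finset.sum_congr rfl fun j _ => ?_
  rw [Category.assoc, matι_matδᵣ, matR_apply, δᵣ_naturality_left_assoc,
    MonoidalRightAction.comp_actionHomLeft]

lemma matδᵣ_associativity [F.OplaxRightLinear C] (A : Mat_ P) (s t : C) :
    matδᵣ F A (s ⊗ t) ≫ (αᵣ ((matLift F).obj A) s t).hom =
      (matLift F).map (diag fun i => (αᵣ (A.X i) s t).hom) ≫
        matδᵣ F ⟨A.ι, fun i => A.X i ⊙ᵣ s⟩ t ≫ matδᵣ F A s ⊵ᵣ t := by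
  refine matι_hom_ext (A := ⟨A.ι, fun i => A.X i ⊙ᵣ (s ⊗ t)⟩) fun i => ?_
  have h := matι_matδᵣ F ⟨A.ι, fun i => A.X i ⊙ᵣ s⟩ t i
  rw [← Category.assoc, matι_matδᵣ, ← Category.assoc, matι_map_diag, Category.assoc,
    Category.assoc, reassoc_of% h, ← MonoidalRightAction.comp_actionHomLeft, matι_matδᵣ,
    MonoidalRightAction.comp_actionHomLeft, ← δᵣ_associativity_assoc]
  simp

lemma matδᵣ_unitality_inv [F.OplaxRightLinear C] (A : Mat_ P) :
    (ρᵣ[C] ((matLift F).obj A)).inv =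
      (matLift F).map (diag fun i => (ρᵣ[C] (A.X i)).inv) ≫ matδᵣ F A (𝟙_ C) := by
  refine matι_hom_ext fun i => ?_
  rw [← Category.assoc, matι_map_diag, Category.assoc, matι_matδᵣ,
    ← δᵣ_unitality_inv_assoc, MonoidalRightAction.actionUnitIso_inv_naturality]

lemma matδᵣ_comp_matLiftSingle [F.OplaxRightLinear C] (B : P) (s : C) :
    matδᵣ F ((Mat_.embedding P).obj B) s ≫ (matLiftSingle F B).hom ⊵ᵣ s = (matLiftSingle F (B ⊙ᵣ s)).hom ≫ δᵣ F B s := by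
  refine matι_hom_ext (A := (Mat_.embedding P).obj (B ⊙ᵣ s)) fun i => ?_
  have h₁ := matι_matLiftSingle F B
  have h₂ := matι_matLiftSingle F (B ⊙ᵣ s)
  have h₃ := matι_matδᵣ F ((Mat_.embedding P).obj B) s PUnit.unit
  have h₄ := (MonoidalRightAction.comp_actionHomLeft _ _ s).symm.trans ((congrArg (· ⊵ᵣ s) h₁).trans
      (MonoidalRightAction.id_actionHomLeft s _))
  have h₅ := congrArg (δᵣ F B s ≫ ·) h₄
  refine (Category.assoc _ _ _).symm.trans ((congrArg (· ≫ _) h₃).trans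
    ((Category.assoc _ _ _).trans (h₅.trans ((Category.comp_id _).trans ?_))))
  exact ((Category.assoc _ _ _).symm.trans
    ((congrArg (· ≫ _) h₂).trans (Category.id_comp _))).symm

/-- The functor induced on the additive envelope by an oplax right linear functor. -/
@[reducible]
def matLiftOplaxRightLinear (k : Type w) [Field k] [Preadditive C] [Linear k C] [Linear k P]
    [LinearRightAction k C P] [Linear k D] [LinearRightAction k C D] [F.OplaxRightLinear C] :
    letI := matRightAction k C P
    (matLift F).OplaxRightLinear C :=
  letI := matRightAction k C P
  { δᵣ := matδᵣ F
    δᵣ_naturality_right := matδᵣ_naturality_right F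
    δᵣ_naturality_left := fun f s =>
      have := actionRight_additive k C D s
      matδᵣ_naturality_left F f s
    δᵣ_associativity := matδᵣ_associativity F
    δᵣ_unitality_inv := matδᵣ_unitality_inv F }

end MatLiftRight

section MatLiftBimodule

open Functor OplaxLeftLinear OplaxRightLinear

lemma matLift_compat {C₁ : Type*} [Category* C₁] [MonoidalCategory C₁]
    {C₂ : Type*} [Category* C₂] [MonoidalCategory C₂]
    {P : Type*} [Category* P] [Preadditive P] [MonoidalLeftAction C₁ P] [MonoidalRightAction C₂ P]
    [Bimodule C₁ C₂ P]
    {D : Type*} [Category* D] [Preadditive D] [HasFiniteBiproducts D]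
    [MonoidalLeftAction C₁ D] [MonoidalRightAction C₂ D] [Bimodule C₁ C₂ D]
    (F : P ⥤ D) [F.Additive] [F.OplaxLeftLinear C₁] [F.OplaxRightLinear C₂]
    (x : C₁) (s : C₂)
    (h : ∀ B : P, δᵣ F (x ⊙ₗ B) s ≫ δₗ F x B ⊵ᵣ s ≫ (Bimodule.middle x (F.obj B) s).hom =
      F.map (Bimodule.middle x B s).hom ≫ δₗ F x (B ⊙ᵣ s) ≫ x ⊴ₗ δᵣ F B s) (A : Mat_ P) :
    matδᵣ F ⟨A.ι, fun i => x ⊙ₗ A.X i⟩ s ≫ matδₗ F x A ⊵ᵣ s ≫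
        (Bimodule.middle x ((matLift F).obj A) s).hom =
      (matLift F).map (diag fun i => (Bimodule.middle x (A.X i) s).hom) ≫
        matδₗ F x ⟨A.ι, fun i => A.X i ⊙ᵣ s⟩ ≫ x ⊴ₗ matδᵣ F A s := by
  refine matι_hom_ext (A := ⟨A.ι, fun i => (x ⊙ₗ A.X i) ⊙ᵣ s⟩) fun i => ?_
  have h₁ := matι_matδᵣ F ⟨A.ι, fun i => x ⊙ₗ A.X i⟩ s i
  have h₂ := matι_matδₗ F x ⟨A.ι, fun i => A.X i ⊙ᵣ s⟩ i
  have h₃ := matι_map_diag F (fun i => (Bimodule.middle x (A.X i) s).hom) i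
  rw [reassoc_of% h₁, reassoc_of% h₃, reassoc_of% h₂,
    ← MonoidalRightAction.comp_actionHomLeft_assoc, matι_matδₗ,
    MonoidalRightAction.comp_actionHomLeft_assoc, Bimodule.naturality_mid,
    ← MonoidalLeftAction.actionHomRight_comp, matι_matδᵣ,
    MonoidalLeftAction.actionHomRight_comp]
  simpa only [Category.assoc] using congrArg (· ≫ x ⊴ₗ (matι F A i ⊵ᵣ s)) (h (A.X i))

end MatLiftBimodule

/-! ### Exactness -/

section Exact

variable {A B E : Type*} [Category* A] [Category* B] [Category* E]

lemma IsExact.comp {F : A ⥤ B} {H : B ⥤ E} (hF : IsExact F) (hH : IsExact H) :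
    IsExact (F ⋙ H) :=
  have := hF.left
  have := hF.right
  have := hH.left
  have := hH.right
  ⟨comp_preservesFiniteLimits F H, comp_preservesFiniteColimits F H⟩

lemma IsExact.of_iso {F H : A ⥤ B} (hF : IsExact F) (e : F ≅ H) : IsExact H :=
  have := hF.left
  have := hF.right
  ⟨preservesFiniteLimits_of_natIso e, preservesFiniteColimits_of_natIso e⟩

lemma isExact_of_isEquivalence (F : A ⥤ B) [F.IsEquivalence] : IsExact F :=
  ⟨inferInstance, inferInstance⟩

/-- Exactness can be checked after composition with a fully faithful functor. -/
lemma IsExact.of_comp_fullyFaithful {F : A ⥤ B} (H : B ⥤ E) [H.Full] [H.Faithful]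
    (h : IsExact (F ⋙ H)) : IsExact F :=
  have := h.left
  have := h.right
  ⟨⟨fun _ _ _ => preservesLimitsOfShape_of_reflects_of_preserves F H⟩,
    ⟨fun _ _ _ => preservesColimitsOfShape_of_reflects_of_preserves F H⟩⟩

lemma isExact_ι {C : Type*} [Category* C] [Abelian C] (P : ObjectProperty C) [P.ContainsZero]
    [P.IsClosedUnderKernels] [P.IsClosedUnderCokernels] [P.IsClosedUnderFiniteProducts] :
    IsExact P.ι := by
  have := P.preservesKernels_ι
  have := P.preservesCokernels_ι
  exact ⟨Functor.preservesFiniteLimits_of_preservesKernels P.ι,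
    Functor.preservesFiniteColimits_of_preservesCokernels P.ι⟩

end Exact

/-! ### Transport of the bimodule conditions along an equivalence -/

section Transport

open Functor

variable {k : Type*} [Field k] {C D M N : Type*}
  [Category* C] [MonoidalCategory C] [Preadditive C] [Linear k C]
  [Category* D] [MonoidalCategory D] [Preadditive D] [Linear k D]
  [Category* M] [Preadditive M] [Linear k M] [MonoidalLeftAction C M] [MonoidalRightAction D M]
  [Category* N] [Preadditive N] [Linear k N] [MonoidalLeftAction C N] [MonoidalRightAction D N]

lemma IsAbelianBimodule.of_equivalence (hN : IsAbelianBimodule k C D N) [HasFiniteProducts M]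
    [LinearLeftAction k C M] [LinearRightAction k D M]
    (F : M ⥤ N) [F.LeftLinear C] [F.RightLinear D] [F.IsEquivalence] :
    IsAbelianBimodule k C D M where
  abelian := by
    obtain ⟨_, rfl⟩ := hN.abelian
    exact ⟨abelianOfEquivalence F, rfl⟩
  linear_left := inferInstance
  linear_right := inferInstance
  exact_left x := by
    refine .of_comp_fullyFaithful F (((isExact_of_isEquivalence F).comp (hN.exact_left x)).of_iso ?_)
    exact NatIso.ofComponents (fun m => LeftLinear.μₗIso F x m)
      fun f => LaxLeftLinear.μₗ_naturality_right F x f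
  exact_left' m := by
    refine .of_comp_fullyFaithful F ((hN.exact_left' (F.obj m)).of_iso ?_)
    exact NatIso.ofComponents (fun x => LeftLinear.μₗIso F x m)
      fun f => LaxLeftLinear.μₗ_naturality_left F f m
  exact_right s := by
    refine .of_comp_fullyFaithful F
      (((isExact_of_isEquivalence F).comp (hN.exact_right s)).of_iso ?_)
    exact NatIso.ofComponents (fun m => RightLinear.μᵣIso F m s)
      fun f => LaxRightLinear.μᵣ_naturality_left F f s
  exact_right' m := by
    refine .of_comp_fullyFaithful F ((hN.exact_right' (F.obj m)).of_iso ?_)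
    exact NatIso.ofComponents (fun s => RightLinear.μᵣIso F m s)
      fun f => LaxRightLinear.μᵣ_naturality_right F m f

end Transport

namespace TensorGrading

variable {k : Type w} [Field k] {G : Type u₂} [Group G] {C : Type u₁} [Category.{v₁} C] [Abelian C]
  [Linear k C] [MonoidalCategory C] [MonoidalPreadditive C] [MonoidalLinear k C]
  [IsTensorCategory k C] (𝒜 : TensorGrading k G C)

/-! ### The homogeneous components -/

lemma isAbelianBimodule_comp (g : G) :
    IsAbelianBimodule k (𝒜.comp 1) (𝒜.comp 1) (𝒜.comp g) where
  abelian := ⟨inferInstance, rfl⟩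
  linear_left := inferInstance
  linear_right := inferInstance
  exact_left x := .of_comp_fullyFaithful (𝒜.part g).ι
    ((isExact_ι (𝒜.part g)).comp (IsTensorCategory.exact_left (k := k) x.obj))
  exact_left' m := .of_comp_fullyFaithful (𝒜.part g).ι
    ((isExact_ι (𝒜.part 1)).comp (IsTensorCategory.exact_right (k := k) m.obj))
  exact_right s := .of_comp_fullyFaithful (𝒜.part g).ι
    ((isExact_ι (𝒜.part g)).comp (IsTensorCategory.exact_right (k := k) s.obj))
  exact_right' m := .of_comp_fullyFaithful (𝒜.part g).ι
    ((isExact_ι (𝒜.part 1)).comp (IsTensorCategory.exact_left (k := k) m.obj))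

/-! ### The bimodule structure of the canonical functor -/

section Lift

variable (g h : G)

instance liftOplaxLeftLinear : (𝒜.tensorBilinear g h).lift.OplaxLeftLinear (𝒜.comp 1) where
  δₗ x A := (𝒜.part (g * h)).homMk (α_ x.obj A.fst.obj A.snd.obj).hom
  δₗ_naturality_left {x x'} f A := by
    apply ObjectProperty.hom_ext
    change ((f.hom ▷ A.fst.obj) ⊗ₘ 𝟙 A.snd.obj) ≫ (α_ _ _ _).hom =
      (α_ _ _ _).hom ≫ f.hom ▷ (A.fst.obj ⊗ A.snd.obj)
    simp
  δₗ_naturality_right x {A B} f := by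
    have := actionLeft_additive k (𝒜.comp 1) (𝒜.comp (g * h)) x
    have : ((MonoidalLeftAction.curriedAction (𝒜.comp 1) (𝒜.comp (g * h))).obj x).Linear k :=
      { map_smul := fun f a => LinearLeftAction.smul_right x a f }
    refine Symb.naturality_of_generators
      (leftFunctor k (𝒜.comp 1) (𝒜.comp g) (𝒜.comp h) x ⋙ (𝒜.tensorBilinear g h).lift)
      ((𝒜.tensorBilinear g h).lift ⋙
        (MonoidalLeftAction.curriedAction (𝒜.comp 1) (𝒜.comp (g * h))).obj x)
      (fun A => (𝒜.part (g * h)).homMk (α_ x.obj A.fst.obj A.snd.obj).hom) ?_ ?_ f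
    · intro X X' Y Y' u v
      apply ObjectProperty.hom_ext
      change ((x.obj ◁ u.hom) ⊗ₘ v.hom) ≫ (α_ _ _ _).hom =
        (α_ _ _ _).hom ≫ x.obj ◁ (u.hom ⊗ₘ v.hom)
      simp [MonoidalCategory.tensorHom_def]
    · intro X V Y
      apply ObjectProperty.hom_ext
      change (((α_ x.obj X.obj V.obj).inv ⊗ₘ 𝟙 Y.obj) ≫
          (α_ (x.obj ⊗ X.obj) V.obj Y.obj).hom) ≫ (α_ x.obj X.obj (V.obj ⊗ Y.obj)).hom =
        (α_ x.obj (X.obj ⊗ V.obj) Y.obj).hom ≫ x.obj ◁ (α_ X.obj V.obj Y.obj).hom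
      simp
  δₗ_associativity x y A := by
    apply ObjectProperty.hom_ext
    change (α_ (x.obj ⊗ y.obj) A.fst.obj A.snd.obj).hom ≫
        (α_ x.obj y.obj (A.fst.obj ⊗ A.snd.obj)).hom =
      ((α_ x.obj y.obj A.fst.obj).hom ⊗ₘ 𝟙 A.snd.obj) ≫
        (α_ x.obj (y.obj ⊗ A.fst.obj) A.snd.obj).hom ≫
          x.obj ◁ (α_ y.obj A.fst.obj A.snd.obj).hom
    simp
  δₗ_unitality_inv A := by
    apply ObjectProperty.hom_ext
    change (λ_ (A.fst.obj ⊗ A.snd.obj)).inv = ((λ_ A.fst.obj).inv ⊗ₘ 𝟙 A.snd.obj) ≫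
      (α_ (𝟙_ C) A.fst.obj A.snd.obj).hom
    simp

instance liftOplaxRightLinear : (𝒜.tensorBilinear g h).lift.OplaxRightLinear (𝒜.comp 1) where
  δᵣ A s := (𝒜.part (g * h)).homMk (α_ A.fst.obj A.snd.obj s.obj).inv
  δᵣ_naturality_right A {s s'} f := by
    apply ObjectProperty.hom_ext
    change (𝟙 A.fst.obj ⊗ₘ (A.snd.obj ◁ f.hom)) ≫ (α_ _ _ _).inv =
      (α_ _ _ _).inv ≫ (A.fst.obj ⊗ A.snd.obj) ◁ f.hom
    simp
  δᵣ_naturality_left {A B} f s := by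
    have := actionRight_additive k (𝒜.comp 1) (𝒜.comp (g * h)) s
    have : ((MonoidalRightAction.curriedAction (𝒜.comp 1) (𝒜.comp (g * h))).obj s).Linear k :=
      { map_smul := fun f a => LinearRightAction.smul_left a f s }
    refine Symb.naturality_of_generators
      (rightFunctor k (𝒜.comp 1) (𝒜.comp g) (𝒜.comp h) s ⋙ (𝒜.tensorBilinear g h).lift)
      ((𝒜.tensorBilinear g h).lift ⋙
        (MonoidalRightAction.curriedAction (𝒜.comp 1) (𝒜.comp (g * h))).obj s)
      (fun A => (𝒜.part (g * h)).homMk (α_ A.fst.obj A.snd.obj s.obj).inv) ?_ ?_ f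
    · intro X X' Y Y' u v
      apply ObjectProperty.hom_ext
      change (u.hom ⊗ₘ (v.hom ▷ s.obj)) ≫ (α_ _ _ _).inv =
        (α_ _ _ _).inv ≫ (u.hom ⊗ₘ v.hom) ▷ s.obj
      simp [MonoidalCategory.tensorHom_def]
    · intro X V Y
      apply ObjectProperty.hom_ext
      change ((α_ X.obj V.obj (Y.obj ⊗ s.obj)).hom ≫
          (𝟙 X.obj ⊗ₘ (α_ V.obj Y.obj s.obj).inv)) ≫ (α_ X.obj (V.obj ⊗ Y.obj) s.obj).inv =
        (α_ (X.obj ⊗ V.obj) Y.obj s.obj).inv ≫ (α_ X.obj V.obj Y.obj).hom ▷ s.obj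
      simp
  δᵣ_associativity A s t := by
    apply ObjectProperty.hom_ext
    change (α_ A.fst.obj A.snd.obj (s.obj ⊗ t.obj)).inv ≫
        (α_ (A.fst.obj ⊗ A.snd.obj) s.obj t.obj).inv =
      (𝟙 A.fst.obj ⊗ₘ (α_ A.snd.obj s.obj t.obj).inv) ≫
        (α_ A.fst.obj (A.snd.obj ⊗ s.obj) t.obj).inv ≫
          (α_ A.fst.obj A.snd.obj s.obj).inv ▷ t.obj
    simp
  δᵣ_unitality_inv A := by
    apply ObjectProperty.hom_ext
    change (ρ_ (A.fst.obj ⊗ A.snd.obj)).inv = (𝟙 A.fst.obj ⊗ₘ (ρ_ A.snd.obj).inv) ≫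
      (α_ A.fst.obj A.snd.obj (𝟙_ C)).inv
    simp

end Lift

end TensorGrading

/-- The unit object of a tensor category is indecomposable: if it is a finite direct sum, then it
is isomorphic to one of the summands. -/
lemma exists_iso_unit_of_iso_biproduct (k : Type w) [Field k] {C : Type u₁} [Category.{v₁} C]
    [Abelian C] [Linear k C] [MonoidalCategory C] [MonoidalPreadditive C] [MonoidalLinear k C]
    [IsTensorCategory k C] [HasFiniteBiproducts C] {n : ℕ} (Y : Fin n → C) (e : 𝟙_ C ≅ ⨁ Y) :
    ∃ i, Nonempty (Y i ≅ 𝟙_ C) := by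
  have hu := IsTensorCategory.unit (k := k) (C := C)
  have : Nontrivial (𝟙_ C ⟶ 𝟙_ C) := Module.nontrivial_of_finrank_pos (R := k) (by omega)
  have h1 : 𝟙 (𝟙_ C) ≠ 0 := by
    intro h
    obtain ⟨f, hf⟩ := exists_ne (0 : 𝟙_ C ⟶ 𝟙_ C)
    exact hf (by rw [← Category.id_comp f, h, zero_comp])
  obtain ⟨i, hi⟩ : ∃ i, e.hom ≫ biproduct.π Y i ≫ biproduct.ι Y i ≫ e.inv ≠ 0 := by
    by_contra! hcon
    apply h1
    rw [← e.hom_inv_id, ← Category.id_comp e.inv, ← biproduct.total, Preadditive.sum_comp,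
      Preadditive.comp_sum]
    exact Finset.sum_eq_zero fun i _ => by rw [Category.assoc]; exact hcon i
  set p := e.hom ≫ biproduct.π Y i ≫ biproduct.ι Y i ≫ e.inv with hp
  have hpp : p ≫ p = p := by simp [hp]
  obtain ⟨a, ha⟩ := (finrank_eq_one_iff_of_nonzero' (𝟙 (𝟙_ C)) h1).mp hu p
  have ha1 : a = 1 := by
    rw [← ha, Linear.smul_comp, Category.id_comp, smul_smul] at hpp
    have h2 : (a * a - a) • 𝟙 (𝟙_ C) = 0 := by rw [sub_smul, hpp, sub_self]
    have h3 : a * (a - 1) = 0 := by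
      have := (smul_eq_zero.mp h2).resolve_right h1
      linear_combination this
    rcases mul_eq_zero.mp h3 with h | h
    · exact absurd (by rw [← ha, h, zero_smul]) hi
    · linear_combination h
  have hp1 : p = 𝟙 _ := by rw [← ha, ha1, one_smul]
  exact ⟨i, ⟨{
    hom := biproduct.ι Y i ≫ e.inv
    inv := e.hom ≫ biproduct.π Y i
    hom_inv_id := by simp
    inv_hom_id := by rw [Category.assoc, ← hp, hp1] }⟩⟩

namespace TensorGrading

variable {k : Type w} [Field k] {G : Type u₂} [Group G] {C : Type u₁} [Category.{v₁} C] [Abelian C]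
  [Linear k C] [MonoidalCategory C] [MonoidalPreadditive C] [MonoidalLinear k C]
  [IsTensorCategory k C] (𝒜 : TensorGrading k G C)

/-- In a strong grading, the unit is a product of homogeneous objects of inverse degrees. -/
lemma IsStronglyGraded.exists_tensor_iso_unit {𝒜 : TensorGrading k G C} (h𝒜 : 𝒜.IsStronglyGraded)
    (g : G) : ∃ X Y : C, 𝒜.part g X ∧ 𝒜.part g⁻¹ Y ∧ Nonempty (X ⊗ Y ≅ 𝟙_ C) := by
  have := h𝒜 g g⁻¹
  have hu : 𝒜.part (g * g⁻¹) (𝟙_ C) := by rw [mul_inv_cancel]; exact 𝒜.part_unit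
  let Z := (ObjectProperty.ιOfLE (𝒜.prod_le g g⁻¹)).objPreimage ⟨𝟙_ C, hu⟩
  let e := (𝒜.part (g * g⁻¹)).ι.mapIso
    ((ObjectProperty.ιOfLE (𝒜.prod_le g g⁻¹)).objObjPreimageIso ⟨𝟙_ C, hu⟩)
  obtain ⟨n, V, W, hV, hW, ⟨e'⟩⟩ := Z.property
  have := Abelian.hasFiniteBiproducts (C := C)
  obtain ⟨i, hi⟩ := exists_iso_unit_of_iso_biproduct k (fun i => V i ⊗ W i) (e.symm ≪≫ e')
  exact ⟨V i, W i, hV i, hW i, hi⟩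

section Inverse

variable {𝒜} {g : G} (h : G) {X₀ Y₀ : C} (hX : 𝒜.part g X₀) (hY : 𝒜.part g⁻¹ Y₀)
  (e : X₀ ⊗ Y₀ ≅ 𝟙_ C)

lemma part_inv_tensor {𝒜 : TensorGrading k G C} {g : G} (h : G) {Y₀ : C} (hY : 𝒜.part g⁻¹ Y₀)
    {Z : C} (hZ : 𝒜.part (g * h) Z) : 𝒜.part h (Y₀ ⊗ Z) := by
  simpa using 𝒜.tensor hY hZ

/-- The functor `Z ↦ [X₀, Y₀ ⊗ Z]`. -/
def symbFunctor : 𝒜.comp (g * h) ⥤ Symb k (𝒜.comp 1) (𝒜.comp g) (𝒜.comp h) where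
  obj Z := ⟨⟨X₀, hX⟩, ⟨Y₀ ⊗ Z.obj, part_inv_tensor h hY Z.property⟩⟩
  map f := Symb.pair (𝟙 _) ((𝒜.part h).homMk (Y₀ ◁ f.hom))
  map_id Z := by
    rw [← Symb.pair_id]
    congr 1
    ext
    simp
  map_comp f f' := by
    rw [Symb.pair_comp, Category.comp_id]
    congr 1
    ext
    simp

instance : (symbFunctor (k := k) h hX hY).Additive where
  map_add {_ _ f f'} := by
    refine (congrArg (Symb.pair _) ?_).trans (Symb.pair_add_right _ _ _)
    exact ObjectProperty.hom_ext _ (MonoidalPreadditive.whiskerLeft_add f.hom f'.hom)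

instance : (symbFunctor (k := k) h hX hY).Linear k where
  map_smul f a := by
    refine (congrArg (Symb.pair _) ?_).trans (Symb.pair_smul_right a _ _)
    exact ObjectProperty.hom_ext _ (MonoidalLinear.whiskerLeft_smul Y₀ a f.hom)

/-- The isomorphism `X₀ ⊗ (Y₀ ⊗ Z) ≅ Z`. -/
@[simps!]
def contractIso (Z : C) : X₀ ⊗ (Y₀ ⊗ Z) ≅ Z :=
  (α_ X₀ Y₀ Z).symm ≪≫ whiskerRightIso e Z ≪≫ λ_ Z

lemma contractIso_hom_naturality {Z Z' : C} (f : Z ⟶ Z') :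
    X₀ ◁ Y₀ ◁ f ≫ (contractIso e Z').hom = (contractIso e Z).hom ≫ f := by
  simp only [contractIso_hom, Category.assoc]
  rw [← leftUnitor_naturality, ← whisker_exchange_assoc, associator_inv_naturality_right_assoc]

lemma contractIso_tensor (Z W : C) :
    (contractIso e (Z ⊗ W)).hom = X₀ ◁ (α_ Y₀ Z W).inv ≫ (α_ X₀ (Y₀ ⊗ Z) W).inv ≫
      (contractIso e Z).hom ▷ W := by
  simp

/-- The object `Y₀ ⊗ X` of degree `1`. -/
abbrev invTensor (X : 𝒜.comp g) : 𝒜.comp 1 :=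
  ⟨Y₀ ⊗ X.obj, by simpa using 𝒜.tensor hY X.property⟩

/-- The object `Y₀ ⊗ (X ⊗ Y)` of degree `h`. -/
abbrev invTensorTensor (X : 𝒜.comp g) (Y : 𝒜.comp h) : 𝒜.comp h :=
  ⟨Y₀ ⊗ (X.obj ⊗ Y.obj), part_inv_tensor h hY (𝒜.tensor X.property Y.property)⟩

/-- The associator `Y₀ ⊗ (X ⊗ Y) ≅ (Y₀ ⊗ X) ⊗ Y`. -/
def invTensorAssoc (X : 𝒜.comp g) (Y : 𝒜.comp h) :
    invTensorTensor h hY X Y ≅ invTensor hY X ⊙ₗ Y :=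
  (𝒜.part h).isoMk (α_ Y₀ X.obj Y.obj).symm

/-- The isomorphism `X₀ ⊗ (Y₀ ⊗ X) ≅ X` in degree `g`. -/
def contractInvTensor (X : 𝒜.comp g) : (⟨X₀, hX⟩ : 𝒜.comp g) ⊙ᵣ invTensor hY X ≅ X :=
  (𝒜.part g).isoMk (contractIso e X.obj)

/-- The isomorphism `[X₀, Y₀ ⊗ (X ⊗ Y)] ≅ [X, Y]`. -/
def symbFunctorObjIso (A : Symb k (𝒜.comp 1) (𝒜.comp g) (𝒜.comp h)) :
    (symbFunctor h hX hY).obj ((𝒜.tensorBilinear g h).lift.obj A) ≅ A :=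
  Symb.pairIso (Iso.refl (⟨X₀, hX⟩ : 𝒜.comp g)) (invTensorAssoc h hY A.fst A.snd) ≪≫
    (Symb.assocIso (⟨X₀, hX⟩ : 𝒜.comp g) (invTensor hY A.fst) A.snd).symm ≪≫
      Symb.pairIso (contractInvTensor hX hY e A.fst) (Iso.refl A.snd)

lemma symbFunctorObjIso_naturality_pair {X X' : 𝒜.comp g} {Y Y' : 𝒜.comp h} (u : X ⟶ X')
    (v : Y ⟶ Y') :
    (symbFunctor h hX hY).map ((𝒜.tensorBilinear g h).map u v) ≫
        (symbFunctorObjIso h hX hY e ⟨X', Y'⟩).hom =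
      (symbFunctorObjIso h hX hY e ⟨X, Y⟩).hom ≫ Symb.pair (k := k) (C := 𝒜.comp 1) u v := by
  let x₀ : 𝒜.comp g := ⟨X₀, hX⟩
  let w : invTensor hY X ⟶ invTensor hY X' := (𝒜.part 1).homMk (Y₀ ◁ u.hom)
  have n := Symb.assoc_naturality (k := k) (𝟙 x₀) w v
  rw [← Iso.eq_comp_inv, Category.assoc, ← Iso.inv_comp_eq] at n
  let m : invTensorTensor h hY X Y ⟶ invTensorTensor h hY X' Y' :=
    (𝒜.part h).homMk (Y₀ ◁ (u.hom ⊗ₘ v.hom))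
  have h₁ : Symb.pair (k := k) (C := 𝒜.comp 1) (𝟙 x₀) m ≫
      Symb.pair (𝟙 x₀) (invTensorAssoc h hY X' Y').hom =
        Symb.pair (𝟙 x₀) (invTensorAssoc h hY X Y).hom ≫ Symb.pair (𝟙 x₀) (w ⊙ₗₘ v) := by
    rw [Symb.pair_comp, Symb.pair_comp]
    congr 1
    apply ObjectProperty.hom_ext
    change Y₀ ◁ (u.hom ⊗ₘ v.hom) ≫ (α_ _ _ _).inv =
      (α_ _ _ _).inv ≫ (Y₀ ◁ u.hom) ▷ Y.obj ≫ (Y₀ ⊗ X'.obj) ◁ v.hom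
    simp [MonoidalCategory.tensorHom_def]
  have h₂ : Symb.pair (k := k) (C := 𝒜.comp 1) (𝟙 x₀ ⊙ᵣₘ w) v ≫
        Symb.pair (contractInvTensor hX hY e X').hom (𝟙 Y') =
      Symb.pair (contractInvTensor hX hY e X).hom (𝟙 Y) ≫ Symb.pair u v := by
    rw [Symb.pair_comp, Symb.pair_comp, Category.comp_id, Category.id_comp,
      MonoidalRightAction.id_actionHom]
    congr 1
    exact ObjectProperty.hom_ext _ (contractIso_hom_naturality e u.hom)
  change Symb.pair (𝟙 x₀) m ≫ Symb.pair (𝟙 x₀) (invTensorAssoc h hY X' Y').hom ≫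
      (Symb.assocIso x₀ (invTensor hY X') Y').inv ≫
        Symb.pair (contractInvTensor hX hY e X').hom (𝟙 Y') =
    (Symb.pair (𝟙 x₀) (invTensorAssoc h hY X Y).hom ≫
      (Symb.assocIso x₀ (invTensor hY X) Y).inv ≫
        Symb.pair (contractInvTensor hX hY e X).hom (𝟙 Y)) ≫ Symb.pair u v
  rw [reassoc_of% h₁, ← reassoc_of% n, h₂]
  simp only [Category.assoc]

lemma symbFunctorObjIso_naturality_assoc (X : 𝒜.comp g) (V : 𝒜.comp 1) (Y : 𝒜.comp h) :
    (symbFunctor h hX hY).map ((𝒜.tensorBilinear g h).balance X V Y).hom ≫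
        (symbFunctorObjIso h hX hY e ⟨X, V ⊙ₗ Y⟩).hom =
      (symbFunctorObjIso h hX hY e ⟨X ⊙ᵣ V, Y⟩).hom ≫
        (Symb.assocIso (k := k) (C := 𝒜.comp 1) X V Y).hom := by
  let x₀ : 𝒜.comp g := ⟨X₀, hX⟩
  let a : invTensor hY (X ⊙ᵣ V) ⟶ invTensor hY X ⊗ V :=
    (𝒜.part 1).homMk (α_ Y₀ X.obj V.obj).inv
  let c := contractInvTensor hX hY e X
  have n := Symb.assoc_naturality (k := k) (𝟙 x₀) a (𝟙 Y)
  rw [← Iso.eq_comp_inv, Category.assoc, ← Iso.inv_comp_eq] at n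
  have n' := Symb.assoc_naturality_fst (k := k) V Y c.hom
  have co := (Iso.comp_inv_eq _).mpr (Symb.coherence (k := k) x₀ (invTensor hY X) V Y)
  simp only [Category.assoc] at co
  have h₁ : Symb.pair (k := k) (C := 𝒜.comp 1) (contractInvTensor hX hY e (X ⊙ᵣ V)).hom (𝟙 Y) =
      Symb.pair (𝟙 x₀ ⊙ᵣₘ a) (𝟙 Y) ≫ Symb.pair (αᵣ x₀ (invTensor hY X) V).hom (𝟙 Y) ≫
        Symb.pair (c.hom ⊵ᵣ V) (𝟙 Y) := by
    rw [Symb.pair_comp, Symb.pair_comp, Category.comp_id, Category.comp_id,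
      MonoidalRightAction.id_actionHom]
    congr 1
    exact ObjectProperty.hom_ext _ (contractIso_tensor e X.obj V.obj)
  have h₂ : Symb.pair (k := k) (C := 𝒜.comp 1) (αᵣ x₀ (invTensor hY X) V).hom (𝟙 Y) ≫
      Symb.pair (αᵣ x₀ (invTensor hY X) V).inv (𝟙 Y) = 𝟙 _ := by
    rw [Symb.pair_comp, Iso.hom_inv_id, Category.comp_id, Symb.pair_id]
  let m : invTensorTensor h hY (X ⊙ᵣ V) Y ⟶ invTensorTensor h hY X (V ⊙ₗ Y) :=
    (𝒜.part h).homMk (Y₀ ◁ (α_ X.obj V.obj Y.obj).hom)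
  have h₃ : Symb.pair (k := k) (C := 𝒜.comp 1) (𝟙 x₀) (invTensorAssoc h hY (X ⊙ᵣ V) Y).hom ≫
      Symb.pair (𝟙 x₀) (a ⊙ₗₘ 𝟙 Y) ≫ Symb.pair (𝟙 x₀) (αₗ (invTensor hY X) V Y).hom =
      Symb.pair (𝟙 x₀) m ≫ Symb.pair (𝟙 x₀) (invTensorAssoc h hY X (V ⊙ₗ Y)).hom := by
    rw [Symb.pair_comp, Symb.pair_comp, Symb.pair_comp, Category.comp_id,
      Category.comp_id, MonoidalLeftAction.actionHom_id]
    congr 1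
    apply ObjectProperty.hom_ext
    change (α_ Y₀ (X.obj ⊗ V.obj) Y.obj).inv ≫ (α_ Y₀ X.obj V.obj).inv ▷ Y.obj ≫
        (α_ (Y₀ ⊗ X.obj) V.obj Y.obj).hom =
      Y₀ ◁ (α_ X.obj V.obj Y.obj).hom ≫ (α_ Y₀ X.obj (V.obj ⊗ Y.obj)).inv
    simp
  change Symb.pair (𝟙 x₀) m ≫ Symb.pair (𝟙 x₀) (invTensorAssoc h hY X (V ⊙ₗ Y)).hom ≫
      (Symb.assocIso x₀ (invTensor hY X) (V ⊙ₗ Y)).inv ≫ Symb.pair c.hom (𝟙 (V ⊙ₗ Y)) =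
    (Symb.pair (𝟙 x₀) (invTensorAssoc h hY (X ⊙ᵣ V) Y).hom ≫
      (Symb.assocIso x₀ (invTensor hY (X ⊙ᵣ V)) Y).inv ≫
        Symb.pair (contractInvTensor hX hY e (X ⊙ᵣ V)).hom (𝟙 Y)) ≫ (Symb.assocIso X V Y).hom
  rw [h₁]
  simp only [Category.assoc]
  rw [n', reassoc_of% n, ← reassoc_of% co, reassoc_of% h₂, Iso.inv_hom_id_assoc, reassoc_of% h₃]

/-- `X ⊗ Y ↦ [X₀, Y₀ ⊗ (X ⊗ Y)]` is isomorphic to the identity on symbols. -/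
def liftSymbFunctorIso :
    (𝒜.tensorBilinear g h).lift ⋙ symbFunctor h hX hY ≅
      𝟭 (Symb k (𝒜.comp 1) (𝒜.comp g) (𝒜.comp h)) :=
  NatIso.ofComponents (symbFunctorObjIso h hX hY e) fun f =>
    Symb.naturality_of_generators ((𝒜.tensorBilinear g h).lift ⋙ symbFunctor h hX hY) (𝟭 _)
      (fun A => (symbFunctorObjIso h hX hY e A).hom)
      (symbFunctorObjIso_naturality_pair h hX hY e)
      (symbFunctorObjIso_naturality_assoc h hX hY e) f

/-- `Z ↦ X₀ ⊗ (Y₀ ⊗ Z)` is isomorphic to the identity. -/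
def symbFunctorLiftIso :
    symbFunctor (k := k) h hX hY ⋙ (𝒜.tensorBilinear g h).lift ≅ 𝟭 (𝒜.comp (g * h)) :=
  NatIso.ofComponents (fun Z => (𝒜.part (g * h)).isoMk (contractIso e Z.obj)) fun f => by
    apply ObjectProperty.hom_ext
    change (𝟙 X₀ ⊗ₘ (Y₀ ◁ f.hom)) ≫ _ = _
    rw [id_tensorHom]
    exact contractIso_hom_naturality e f.hom

lemma isEquivalence_lift {𝒜 : TensorGrading k G C} {g : G} (h : G) {X₀ Y₀ : C}
    (hX : 𝒜.part g X₀) (hY : 𝒜.part g⁻¹ Y₀) (e : X₀ ⊗ Y₀ ≅ 𝟙_ C) :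
    (𝒜.tensorBilinear g h).lift.IsEquivalence :=
  (CategoryTheory.Equivalence.mk _ _ (liftSymbFunctorIso h hX hY e).symm
    (symbFunctorLiftIso h hX hY e)).isEquivalence_functor

end Inverse

variable (g h : G)

instance (x : 𝒜.comp 1) (A : Symb k (𝒜.comp 1) (𝒜.comp g) (𝒜.comp h)) :
    IsIso (Functor.OplaxLeftLinear.δₗ (𝒜.tensorBilinear g h).lift x A) :=
  ((𝒜.part (g * h)).isoMk (X := (𝒜.tensorBilinear g h).lift.obj (x ⊙ₗ A))
    (Y := x ⊙ₗ (𝒜.tensorBilinear g h).lift.obj A) (α_ x.obj A.fst.obj A.snd.obj)).isIso_hom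

instance (A : Symb k (𝒜.comp 1) (𝒜.comp g) (𝒜.comp h)) (s : 𝒜.comp 1) :
    IsIso (Functor.OplaxRightLinear.δᵣ (𝒜.tensorBilinear g h).lift A s) :=
  ((𝒜.part (g * h)).isoMk (X := (𝒜.tensorBilinear g h).lift.obj (A ⊙ᵣ s))
    (Y := (𝒜.tensorBilinear g h).lift.obj A ⊙ᵣ s) (α_ A.fst.obj A.snd.obj s.obj).symm).isIso_hom

/-- The oplax left linear structure of the canonical functor, through the associator. -/
@[reducible]
def canonicalFunctorOplaxLeftLinear :
    (𝒜.canonicalFunctor g h).OplaxLeftLinear (𝒜.comp 1) :=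
  matLiftOplaxLeftLinear (𝒜.tensorBilinear g h).lift k

/-- The oplax right linear structure of the canonical functor, through the inverse associator. -/
@[reducible]
def canonicalFunctorOplaxRightLinear :
    (𝒜.canonicalFunctor g h).OplaxRightLinear (𝒜.comp 1) :=
  matLiftOplaxRightLinear (𝒜.tensorBilinear g h).lift k

/-- The canonical functor is left linear. -/
@[reducible]
def canonicalFunctorLeftLinear : (𝒜.canonicalFunctor g h).LeftLinear (𝒜.comp 1) :=
  have (x : 𝒜.comp 1) (A : RelTensor k (𝒜.comp 1) (𝒜.comp g) (𝒜.comp h)) :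
      IsIso ((𝒜.canonicalFunctorOplaxLeftLinear g h).δₗ x A) :=
    have := actionLeft_additive k (𝒜.comp 1) (𝒜.comp (g * h)) x
    isIso_matδₗ (𝒜.tensorBilinear g h).lift x A
  letI := 𝒜.canonicalFunctorOplaxLeftLinear g h
  leftLinearOfOplax _ _

/-- The canonical functor is right linear. -/
@[reducible]
def canonicalFunctorRightLinear : (𝒜.canonicalFunctor g h).RightLinear (𝒜.comp 1) :=
  have (A : RelTensor k (𝒜.comp 1) (𝒜.comp g) (𝒜.comp h)) (s : 𝒜.comp 1) :
      IsIso ((𝒜.canonicalFunctorOplaxRightLinear g h).δᵣ A s) :=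
    have := actionRight_additive k (𝒜.comp 1) (𝒜.comp (g * h)) s
    isIso_matδᵣ (𝒜.tensorBilinear g h).lift A s
  letI := 𝒜.canonicalFunctorOplaxRightLinear g h
  rightLinearOfOplax _ _

lemma lift_compat (x : 𝒜.comp 1) (A : Symb k (𝒜.comp 1) (𝒜.comp g) (𝒜.comp h)) (s : 𝒜.comp 1) :
    Functor.OplaxRightLinear.δᵣ (𝒜.tensorBilinear g h).lift (x ⊙ₗ A) s ≫
        Functor.OplaxLeftLinear.δₗ (𝒜.tensorBilinear g h).lift x A ⊵ᵣ s ≫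
          (Bimodule.middle x ((𝒜.tensorBilinear g h).lift.obj A) s).hom =
      (𝒜.tensorBilinear g h).lift.map (Bimodule.middle x A s).hom ≫
        Functor.OplaxLeftLinear.δₗ (𝒜.tensorBilinear g h).lift x (A ⊙ᵣ s) ≫
          x ⊴ₗ Functor.OplaxRightLinear.δᵣ (𝒜.tensorBilinear g h).lift A s := by
  apply ObjectProperty.hom_ext
  change (α_ (x.obj ⊗ A.fst.obj) A.snd.obj s.obj).inv ≫
      (α_ x.obj A.fst.obj A.snd.obj).hom ▷ s.obj ≫
        (α_ x.obj (A.fst.obj ⊗ A.snd.obj) s.obj).hom =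
    (𝟙 (x.obj ⊗ A.fst.obj) ⊗ₘ 𝟙 (A.snd.obj ⊗ s.obj)) ≫
      (α_ x.obj A.fst.obj (A.snd.obj ⊗ s.obj)).hom ≫
        x.obj ◁ (α_ A.fst.obj A.snd.obj s.obj).inv
  simp

lemma isBimoduleFunctor_canonicalFunctor [(𝒜.canonicalFunctor g h).IsEquivalence] :
    letI := 𝒜.canonicalFunctorLeftLinear g h
    letI := 𝒜.canonicalFunctorRightLinear g h
    IsBimoduleFunctor k (𝒜.comp 1) (𝒜.comp 1) (𝒜.canonicalFunctor g h) :=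
  letI := 𝒜.canonicalFunctorLeftLinear g h
  letI := 𝒜.canonicalFunctorRightLinear g h
  { additive := inferInstanceAs (matLift (𝒜.tensorBilinear g h).lift).Additive
    linear := inferInstanceAs ((matLift (𝒜.tensorBilinear g h).lift).Linear k)
    exact := isExact_of_isEquivalence _
    compat := fun x A s => matLift_compat (𝒜.tensorBilinear g h).lift x s
      (fun B => 𝒜.lift_compat g h x B s) A }

lemma canonicalFunctor_δₗ_symb {g h : G} (V : 𝒜.comp 1) (X : 𝒜.comp g) (Y : 𝒜.comp h) :
    (𝒜.canonicalFunctorOplaxLeftLinear g h).δₗ V (symb k (𝒜.comp 1) X Y) ≫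
        V ⊴ₗ (𝒜.canonicalFunctorSymb X Y).hom =
      (𝒜.canonicalFunctorSymb (V ⊙ₗ X) Y).hom ≫
        (𝒜.part (g * h)).homMk (α_ V.obj X.obj Y.obj).hom :=
  matδₗ_comp_matLiftSingle (𝒜.tensorBilinear g h).lift V ⟨X, Y⟩

lemma canonicalFunctor_δᵣ_symb {g h : G} (X : 𝒜.comp g) (Y : 𝒜.comp h) (V : 𝒜.comp 1) :
    (𝒜.canonicalFunctorOplaxRightLinear g h).δᵣ (symb k (𝒜.comp 1) X Y) V ≫
        (𝒜.canonicalFunctorSymb X Y).hom ⊵ᵣ V =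
      (𝒜.canonicalFunctorSymb X (Y ⊙ᵣ V)).hom ≫
        (𝒜.part (g * h)).homMk (α_ X.obj Y.obj V.obj).inv :=
  matδᵣ_comp_matLiftSingle (𝒜.tensorBilinear g h).lift ⟨X, Y⟩ V

lemma IsStronglyGraded.isEquivalence_canonicalFunctor {𝒜 : TensorGrading k G C}
    (h𝒜 : 𝒜.IsStronglyGraded) (g h : G) : (𝒜.canonicalFunctor g h).IsEquivalence := by
  obtain ⟨X, Y, hX, hY, ⟨e⟩⟩ := h𝒜.exists_tensor_iso_unit g
  have := isEquivalence_lift h hX hY e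
  exact inferInstanceAs (matLift (𝒜.tensorBilinear g h).lift).IsEquivalence

end TensorGrading

end TensorCat

end

theorem mainTheorem5 {k : Type*} [Field k] {G : Type*} [Group G]
    {C : Type*} [Category* C] [Abelian C] [Linear k C] [MonoidalCategory C]
    [MonoidalPreadditive C] [MonoidalLinear k C] [IsTensorCategory k C]
    (𝒜 : TensorGrading k G C) (h𝒜 : 𝒜.IsStronglyGraded) (σ τ : G) :
    -- `C_σ ⊠ C_τ` and `C_{στ}` are bimodule categories over `C_1`
    IsAbelianBimodule k (𝒜.comp 1) (𝒜.comp 1) (RelTensor k (𝒜.comp 1) (𝒜.comp σ) (𝒜.comp τ)) ∧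
    IsAbelianBimodule k (𝒜.comp 1) (𝒜.comp 1) (𝒜.comp (σ * τ)) ∧
    -- the canonical functor is an equivalence
    (𝒜.canonicalFunctor σ τ).IsEquivalence ∧
    -- it is a bimodule functor
    ∃ (_ : (𝒜.canonicalFunctor σ τ).LeftLinear (𝒜.comp 1))
      (_ : (𝒜.canonicalFunctor σ τ).RightLinear (𝒜.comp 1)),
      IsBimoduleFunctor k (𝒜.comp 1) (𝒜.comp 1) (𝒜.canonicalFunctor σ τ) ∧
      -- whose structure morphisms are, on the objects `[X, Y] ↦ X ⊗ Y`, the associators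
      (∀ (V : 𝒜.comp 1) (X : 𝒜.comp σ) (Y : 𝒜.comp τ),
        Functor.OplaxLeftLinear.δₗ (𝒜.canonicalFunctor σ τ) V (symb k (𝒜.comp 1) X Y) ≫
            V ⊴ₗ (𝒜.canonicalFunctorSymb X Y).hom =
          (𝒜.canonicalFunctorSymb (V ⊙ₗ X) Y).hom ≫
            (𝒜.part (σ * τ)).homMk (α_ V.obj X.obj Y.obj).hom) ∧
      (∀ (X : 𝒜.comp σ) (Y : 𝒜.comp τ) (V : 𝒜.comp 1),
        Functor.OplaxRightLinear.δᵣ (𝒜.canonicalFunctor σ τ) (symb k (𝒜.comp 1) X Y) V ≫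
            (𝒜.canonicalFunctorSymb X Y).hom ⊵ᵣ V =
          (𝒜.canonicalFunctorSymb X (Y ⊙ᵣ V)).hom ≫
            (𝒜.part (σ * τ)).homMk (α_ X.obj Y.obj V.obj).inv) := by

  have := h𝒜.isEquivalence_canonicalFunctor σ τ
  let l := 𝒜.canonicalFunctorLeftLinear σ τ
  let r := 𝒜.canonicalFunctorRightLinear σ τ
  exact ⟨(𝒜.isAbelianBimodule_comp (σ * τ)).of_equivalence (𝒜.canonicalFunctor σ τ),
    𝒜.isAbelianBimodule_comp (σ * τ), this, l, r,
    𝒜.isBimoduleFunctor_canonicalFunctor σ τ, 𝒜.canonicalFunctor_δₗ_symb,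
    𝒜.canonicalFunctor_δᵣ_symb⟩
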